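/- Let $d\ge 2$ and $m\ge 1$, let $\phi_1,\dots,\phi_m:\mathbb{R}^d\times\mathbb{R}^d\to\mathbb{R}$ be $C^\infty$ functions, $\vec\phi=(\phi_1,\dots,\phi_m)$, and let $T=T_1\times\cdots\times T_m$, where each $T_l\subset\mathbb{R}$ is an interval with non-empty interior. Assume that for every $t\in T$ and every $(x,y)$ with $\vec\phi(x,y)=t$, the gradients $\nabla_x\phi_1(x,y),\dots,\nabla_x\phi_m(x,y)$ are linearly independent, and so are $\nabla_y\phi_1(x,y),\dots,\nabla_y\phi_m(x,y)$. Let $E\subset\mathbb{R}^d$ be compact with Hausdorff dimension $\alpha$, and let $\mu$ be a Borel probability measure supported on $E$ for which there is a constant $C_\mu$ with $$\mu(B_\delta(x))\le C_\mu\,\delta^{\alpha}\qquad\text{for all }x\in E,\ \delta>0$$ (for example, an Ahlfors--David regular probability measure on $E$). Let $\psi\in C_c^\infty(\mathbb{R}^d\times\mathbb{R}^d)$ be a real-valued cutoff function with $\psi=1$ on $E\times E$. For $t\in T$ define $$T_{\vec\phi_t}f(x)=\int_{\{y:\ \phi_l(x,y)=t_l,\ 1\le l\le m\}}f(y)\,\psi(x,y)\,d\sigma_{x,t}(y),$$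 where $\sigma_{x,t}$ is the $(d-m)$-dimensional surface measure on $\{y:\vec\phi(x,y)=t\}$. Let $L^2_s(\mathbb{R}^d)$ be the Sobolev space with norm $\|(1+|\xi|^2)^{s/2}\,\widehat{g}(\xi)\|_{L^2}$. Suppose that, for some real $s$, $T_{\vec\phi_t}:L^2(\mathbb{R}^d)\to L^2_s(\mathbb{R}^d)$ is bounded uniformly in $t\in T$; that is, there is a constant $B$ with $\|T_{\vec\phi_t}f\|_{L^2_s}\le B\|f\|_{L^2}$ for all $t\in T$ and all Schwartz functions $f$. Suppose finally that $d-s<\alpha<d$. Then for every compact $K\subset T$ there is a constant $C$ such that, for all $t\in K$ and all $\varepsilon>0$, $$\mu\times\mu\,\{(x,y)\in E\times E:\ t_l\le\phi_l(x,y)\le t_l+\varepsilon,\ 1\le l\le m\}\le C\,\varepsilon^m .$$ -/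

import Mathlib

open MeasureTheory FourierTransform
open scoped ENNReal NNReal ContDiff SchwartzMap

noncomputable section

/-- Coordinate space `ℝᵈ` with the Euclidean norm. -/
abbrev Eucl (d : ℕ) : Type := EuclideanSpace ℝ (Fin d)

/-- The level set `{y : φ_l(x, y) = t_l, 1 ≤ l ≤ m}`. -/
def levelSet {d m : ℕ} (φ : Fin m → Eucl d × Eucl d → ℝ) (t : Fin m → ℝ) (x : Eucl d) :
    Set (Eucl d) :=
  {y | ∀ l, φ l (x, y) = t l}

/-- The generalized Radon transform
`T_{φ_t} f (x) = ∫_{φ_l(x, y) = t_l, 1 ≤ l ≤ m} f(y) ψ(x, y) dσ_{x,t}(y)`, where `σ_{x,t}` is the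
`(d - m)`-dimensional surface measure on the level set, that is, the Euclidean Hausdorff measure
(normalized so as to agree with Lebesgue measure on `ℝ^(d-m)`) restricted to it. -/
def radonTransform {d m : ℕ} (φ : Fin m → Eucl d × Eucl d → ℝ) (ψ : Eucl d × Eucl d → ℝ)
    (t : Fin m → ℝ) (f : Eucl d → ℂ) (x : Eucl d) : ℂ :=
  ∫ y in levelSet φ t x, f y * (ψ (x, y) : ℂ) ∂(Measure.euclideanHausdorffMeasure (d - m))

/-- The gradients `∇_x φ_1, …, ∇_x φ_m` are linearly independent, and so are
`∇_y φ_1, …, ∇_y φ_m`, at every point `(x, y)` of a level set `φ = t` with `t ∈ T`. -/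
def NondegenerateOn {d m : ℕ} (φ : Fin m → Eucl d × Eucl d → ℝ) (T : Set (Fin m → ℝ)) : Prop :=
  ∀ t ∈ T, ∀ x y : Eucl d, (∀ l, φ l (x, y) = t l) →
    LinearIndependent ℝ (fun l => gradient (fun x' => φ l (x', y)) x) ∧
    LinearIndependent ℝ (fun l => gradient (fun y' => φ l (x, y')) y)

/-- The norm `‖(1 + |ξ|²)^(s/2) 𝓕g‖_{L²}` of the Sobolev space `L²_s(ℝᵈ)`, for `g ∈ L²(ℝᵈ)`
(it is `∞` if `g` is not in `L²_s`). -/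
def sobolevNorm {d : ℕ} (s : ℝ) (g : Lp ℂ 2 (volume : Measure (Eucl d))) : ℝ≥0∞ :=
  eLpNorm (fun ξ => (((1 + ‖ξ‖ ^ 2) ^ (s / 2) : ℝ) : ℂ) *
    (𝓕 g : Lp ℂ 2 (volume : Measure (Eucl d))) ξ) 2 volume

/-- `A` maps `L²(ℝᵈ)` to `L²_s(ℝᵈ)` boundedly, with constant `B`. As usual this is expressed on the
dense class of Schwartz functions. -/
def BoundedToSobolev {d : ℕ} (A : (Eucl d → ℂ) → Eucl d → ℂ) (s : ℝ) (B : ℝ≥0) : Prop :=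
  ∀ f : 𝓢(Eucl d, ℂ), ∃ h : MemLp (A f) 2 (volume : Measure (Eucl d)),
    sobolevNorm s (h.toLp (A f)) ≤ B * eLpNorm f 2 (volume : Measure (Eucl d))

/-- `μ` is carried by `E` and satisfies `μ(B_δ(x)) ≤ C δ^α` for all `x ∈ E` and `δ > 0`. -/
def IsFrostman {d : ℕ} (μ : Measure (Eucl d)) (E : Set (Eucl d)) (α : ℝ≥0) : Prop :=
  μ Eᶜ = 0 ∧ ∃ C : ℝ≥0, ∀ x ∈ E, ∀ δ : ℝ, 0 < δ →
    μ (Metric.ball x δ) ≤ C * ENNReal.ofReal (δ ^ (α : ℝ))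

end

/-! Put `β = d - α`, so that `0 < β < s`, let `Φ = (φ_1, …, φ_m)`, and let `N(r)` be the `μ × μ`
measure of `{|Φ - t| ≤ r}`. Let `f_n` be `μ` mollified by a nonnegative bump at scale `2^(-n)`.
Since `ψ ≥ 1/2` near `E × E`, the pairing `⟨T_t f_n, f_n⟩` is at least `c 2^(nm) N(c₀ 2^(-n))`
(`exists_le_integral_realRadon_mul`), so it must be bounded from above. Two mechanisms do this.

Smoothing. The Frostman condition gives `‖f_n‖_2 ≲ 2^(nβ/2)` and an energy `≲ R^β` of `μ` at
frequencies up to `R`. If `g` is `μ` filtered to frequencies `≳ 1/ε`, its `L²_{-s}` norm is `≲ ε^(s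
- β/2)`. For `f` mollified at scale `δ`, duality gives `|⟨T_t f, g⟩| ≲ ε^(s - β/2) δ^(-β/2)`
(`IsFrostman.exists_abs_pair_le`). For `ε = δ` this is `δ^(s - β)`, which is where `α > d - s`
enters, and there is still room for an `ε` slightly larger than `δ`.

Geometry. Pair the transform of a mollifier at scale `δ` centred at `v` with one at scale `ε ≥ δ`
centred at `u`. Moving `v` by `O(δ)` changes the pairing by `O((δ/ε + ε) ε^(-m))`, and by nothing
unless `|Φ(u, v) - t| ≲ ε` (`exists_abs_integral_translate_sub_le`). Indeed a shift `h` of `y` can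
be compensated by a shift `w` of `x` with `(w, h)` in the kernel of `DΦ(u, v)`; by nondegeneracy
`|w| ≲ |h|`. The level sets then change only to second order. Integrated against `μ × μ`, replacing
scale `δ` by `δ/2` costs `(δ/ε + ε) N(C'ε) ε^(-m)`.

Let `g_k` be `f_n` low-passed at scale `l^k`, with `l` slightly above `1/2`. Passing from `⟨T_t f_n,
f_n⟩` to `⟨T_t f_n, g_n⟩` and from `⟨T_t f_(i+1), g_(i+1)⟩` to `⟨T_t f_(i+1), g_i⟩` is paid for by
smoothing, with geometrically small errors. Passing to `⟨T_t f_i, g_i⟩` is paid for by geometry,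
with `δ/ε = (2l)^(-i)`. Stopping at a fixed `k` gives `N(c₀ 2^(-n)) ≤ 2^(-nm) (C_k + C Σ_{k ≤ i < n}
θ^i N(C' l^i) / l^(im))` with `θ < 1`. For `k` large the sum can be absorbed, and induction on the
scale yields `N(r) ≲ r^m` (`exists_le_mul_pow_of_recursion`). All constants are uniform in `t ∈ K`
by compactness of `E × E × K`. -/

/-! ### Hausdorff measure under antilipschitz maps -/

section HausdorffTransfer

variable {X : Type*} [MetricSpace X] [MeasurableSpace X] [BorelSpace X]

/-- If `S` maps to `S'` so that distances are contracted at most by the factor `K`, then the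
`n`-dimensional measure of `S` is at most `K ^ n` times that of `S'`. -/
theorem euclideanHausdorffMeasure_le_of_antilipschitz (n : ℕ) {S S' : Set X} {K : ℝ≥0} (q : X → X)
    (hq : ∀ z ∈ S, q z ∈ S')
    (hK : ∀ z₁ ∈ S, ∀ z₂ ∈ S, dist z₁ z₂ ≤ K * dist (q z₁) (q z₂)) :
    Measure.euclideanHausdorffMeasure n S ≤ (K : ℝ≥0∞) ^ n * Measure.euclideanHausdorffMeasure n S' := by
  rcases S.eq_empty_or_nonempty with rfl | ⟨z₀, hz₀⟩
  · simp
  have : Nonempty X := ⟨z₀⟩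
  have hinj : Set.InjOn q S := by
    intro z₁ h₁ z₂ h₂ h
    have := hK z₁ h₁ z₂ h₂
    rw [h, dist_self, mul_zero] at this
    exact dist_le_zero.1 this
  have hleft : ∀ z ∈ S, Function.invFunOn q S (q z) = z := fun z hz => hinj.leftInvOn_invFunOn hz
  -- Only the inverse of `q` on `S` has to be Lipschitz; neither `q` nor `S` needs to be measurable.
  have hlip : LipschitzOnWith K (Function.invFunOn q S) (q '' S) := by
    refine LipschitzOnWith.of_dist_le_mul ?_
    rintro _ ⟨z₁, h₁, rfl⟩ _ ⟨z₂, h₂, rfl⟩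
    rw [hleft z₁ h₁, hleft z₂ h₂]
    exact hK z₁ h₁ z₂ h₂
  have himg : Function.invFunOn q S '' (q '' S) = S := by
    ext z
    constructor
    · rintro ⟨_, ⟨w, hw, rfl⟩, rfl⟩
      rwa [hleft w hw]
    · intro hz
      exact ⟨q z, ⟨z, hz, rfl⟩, hleft z hz⟩
  have h1 := hlip.hausdorffMeasure_image_le (d := (n : ℝ)) (Nat.cast_nonneg n)
  rw [himg, ENNReal.rpow_natCast] at h1
  simp only [Measure.euclideanHausdorffMeasure_def, Measure.smul_apply, ENNReal.smul_def, smul_eq_mul]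
  calc _ ≤ _ * ((K : ℝ≥0∞) ^ n * Measure.hausdorffMeasure (n : ℝ) (q '' S)) := by gcongr
    _ ≤ _ * ((K : ℝ≥0∞) ^ n * Measure.hausdorffMeasure (n : ℝ) S') := by
        gcongr
        rintro _ ⟨z, hz, rfl⟩
        exact hq z hz
    _ = _ := by ring

/-- Integrated form of `euclideanHausdorffMeasure_le_of_antilipschitz`. -/
theorem lintegral_le_of_antilipschitz (n : ℕ) {S S' : Set X} {K : ℝ≥0} (q : X → X)
    (hq : ∀ z ∈ S, q z ∈ S')
    (hK : ∀ z₁ ∈ S, ∀ z₂ ∈ S, dist z₁ z₂ ≤ K * dist (q z₁) (q z₂))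
    {F G : X → ℝ} (hF : Measurable F) (hG : Measurable G) (hF0 : ∀ x, 0 ≤ F x) (hG0 : ∀ x, 0 ≤ G x)
    (hFG : ∀ z ∈ S, F z ≤ G (q z)) :
    ∫⁻ z in S, ENNReal.ofReal (F z) ∂(Measure.euclideanHausdorffMeasure n) ≤
      (K : ℝ≥0∞) ^ n * ∫⁻ z in S', ENNReal.ofReal (G z) ∂(Measure.euclideanHausdorffMeasure n) := by
  -- Layer cake formula: `q` maps each superlevel set of `F` in `S` into the corresponding one of
  -- `G` in `S'`.
  rw [lintegral_eq_lintegral_meas_lt _ (Filter.Eventually.of_forall hF0) hF.aemeasurable,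
    lintegral_eq_lintegral_meas_lt _ (Filter.Eventually.of_forall hG0) hG.aemeasurable,
    ← lintegral_const_mul' _ _ (by finiteness)]
  refine lintegral_mono fun s => ?_
  rw [Measure.restrict_apply (measurableSet_lt measurable_const hF),
    Measure.restrict_apply (measurableSet_lt measurable_const hG)]
  refine euclideanHausdorffMeasure_le_of_antilipschitz n q ?_ fun z₁ h₁ z₂ h₂ => hK z₁ h₁.2 z₂ h₂.2
  rintro z ⟨hz, hzS⟩
  exact ⟨lt_of_lt_of_le hz (hFG z hzS), hq z hzS⟩

end HausdorffTransfer

/-! ### Balls in subspaces, and perturbations of the identity -/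

/-- The volume of balls in an `n`-dimensional linear subspace. -/
theorem exists_euclideanHausdorffMeasure_submodule_inter_closedBall (n : ℕ) :
    ∃ c : ℝ, 0 < c ∧ ∀ {d : ℕ} (W : Submodule ℝ (Eucl d)), Module.finrank ℝ W = n →
      ∀ p ∈ W, ∀ r : ℝ, 0 ≤ r →
      Measure.euclideanHausdorffMeasure n ((W : Set (Eucl d)) ∩ Metric.closedBall p r) =
        ENNReal.ofReal (c * r ^ n) := by
  refine ⟨(volume (Metric.closedBall (0 : Eucl n) 1)).toReal,
    ENNReal.toReal_pos (Metric.measure_closedBall_pos _ _ one_pos).ne' measure_closedBall_lt_top.ne,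
    ?_⟩
  intro d W hW p hp r hr
  have hset : (W : Set (Eucl d)) ∩ Metric.closedBall p r =
      (W.subtype : W → Eucl d) '' (Metric.closedBall (⟨p, hp⟩ : W) r) := by
    ext z
    constructor
    · rintro ⟨hz, hzr⟩
      exact ⟨⟨z, hz⟩, by simpa [Subtype.dist_eq] using hzr, rfl⟩
    · rintro ⟨w, hw, rfl⟩
      exact ⟨w.2, by simpa [Subtype.dist_eq] using hw⟩
  have hiso : Isometry (W.subtype : W → Eucl d) := isometry_subtype_coe
  rw [hset, hiso.euclideanHausdorffMeasure_image]
  subst hW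
  rw [InnerProductSpace.euclideanHausdorffMeasure_eq_volume]
  have h1 : volume (Metric.closedBall (⟨p, hp⟩ : W) r) =
      volume (Metric.closedBall ((stdOrthonormalBasis ℝ W).repr ⟨p, hp⟩) r) := by
    rw [← (stdOrthonormalBasis ℝ W).measurePreserving_repr.measure_preimage
      Metric.isClosed_closedBall.measurableSet.nullMeasurableSet]
    congr 1
    ext z
    simp
  rw [h1, Measure.addHaar_closedBall' _ _ hr, finrank_euclideanSpace, Fintype.card_fin,
    mul_comm (ENNReal.toReal _), ENNReal.ofReal_mul (by positivity),
    ENNReal.ofReal_toReal measure_closedBall_lt_top.ne]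

/-- A map that is close to the identity on a ball covers a smaller ball. -/
theorem exists_eq_of_near_id {X : Type*} [NormedAddCommGroup X] [NormedSpace ℝ X] [CompleteSpace X]
    {Θ : X → X} {z p : X} {r : ℝ} (hr : 0 ≤ r)
    (hΘ : ∀ y ∈ Metric.closedBall z r, ∀ y' ∈ Metric.closedBall z r,
      ‖Θ y - Θ y' - (y - y')‖ ≤ 1 / 2 * ‖y - y'‖)
    (hp : ‖p - Θ z‖ ≤ r / 2) : ∃ y ∈ Metric.closedBall z r, Θ y = p := by
  let I : (ContinuousLinearMap.id ℝ X).NonlinearRightInverse :=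
    { toFun := id
      nnnorm := 1
      bound' := fun y => by simp
      right_inv' := fun y => by simp }
  have h : ApproximatesLinearOn Θ (ContinuousLinearMap.id ℝ X) (Metric.closedBall z r) (1 / 2) := by
    intro y hy y' hy'
    simpa using hΘ y hy y' hy'
  have := h.surjOn_closedBall_of_nonlinearRightInverse I hr subset_rfl
  have hp' : p ∈ Metric.closedBall (Θ z) ((((1 : ℝ≥0) : ℝ)⁻¹ - ((1 / 2 : ℝ≥0) : ℝ)) * r) := by
    rw [mem_closedBall_iff_norm]
    refine hp.trans_eq ?_
    push_cast
    ring
  exact this hp'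

/-! ### Surface measure of level sets of nearly linear maps -/

section LevelSets

variable {d m : ℕ} {A : Eucl d →L[ℝ] (Fin m → ℝ)} {R : (Fin m → ℝ) →L[ℝ] Eucl d} {L η : ℝ}

theorem finrank_ker_of_rightInverse (hAR : ∀ y, A (R y) = y) :
    Module.finrank ℝ (LinearMap.ker (A : Eucl d →ₗ[ℝ] (Fin m → ℝ))) = d - m := by
  have h1 := LinearMap.finrank_range_add_finrank_ker (A : Eucl d →ₗ[ℝ] (Fin m → ℝ))
  have h2 : LinearMap.range (A : Eucl d →ₗ[ℝ] (Fin m → ℝ)) = ⊤ :=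
    LinearMap.range_eq_top.2 fun y => ⟨R y, hAR y⟩
  rw [h2, finrank_top] at h1
  simp at h1
  omega

theorem le_of_rightInverse (hAR : ∀ y, A (R y) = y) : m ≤ d := by
  have h2 : Function.Surjective (A : Eucl d →ₗ[ℝ] (Fin m → ℝ)) := fun y => ⟨R y, hAR y⟩
  simpa using LinearMap.finrank_le_finrank_of_surjective h2

/-- The map that straightens `{a = 0}` to the kernel of `A`. -/
def straighten (A : Eucl d →L[ℝ] (Fin m → ℝ)) (R : (Fin m → ℝ) →L[ℝ] Eucl d)
    (a : Eucl d → Fin m → ℝ) (y : Eucl d) : Eucl d :=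
  y - R (A y - a y)

theorem apply_straighten (hAR : ∀ y, A (R y) = y) (a : Eucl d → Fin m → ℝ) (y : Eucl d) :
    A (straighten A R a y) = a y := by
  simp [straighten, hAR]

/-- The straightening map differs from the identity by `R ∘ (a - A)`, so the deviation of `a` from
`A` is amplified at most by `L`. In consequence the map is bi-Lipschitz with constants `1/2` and
`3/2`, without any inverse function theorem. -/
theorem norm_straighten_sub_sub_le (hL : 0 ≤ L) (hR : ∀ y, ‖R y‖ ≤ L * ‖y‖) (hη : L * η ≤ 1 / 2)
    {a : Eucl d → Fin m → ℝ} {s : Set (Eucl d)}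
    (ha : ∀ y ∈ s, ∀ y' ∈ s, ‖a y - a y' - A (y - y')‖ ≤ η * ‖y - y'‖) :
    ∀ y ∈ s, ∀ y' ∈ s, ‖straighten A R a y - straighten A R a y' - (y - y')‖ ≤
      1 / 2 * ‖y - y'‖ := by
  intro y hy y' hy'
  have h : straighten A R a y - straighten A R a y' - (y - y') = R (a y - a y' - A (y - y')) := by
    simp only [straighten, map_sub]
    abel
  rw [h]
  calc _ ≤ L * ‖a y - a y' - A (y - y')‖ := hR _
    _ ≤ L * (η * ‖y - y'‖) := by gcongr; exact ha y hy y' hy'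
    _ = (L * η) * ‖y - y'‖ := by ring
    _ ≤ _ := by gcongr

/-- Upper bound for the surface measure of a level set in a ball. -/
theorem exists_euclideanHausdorffMeasure_level_le (d m : ℕ) : ∃ C : ℝ, 1 ≤ C ∧
    ∀ (A : Eucl d →L[ℝ] (Fin m → ℝ)) (R : (Fin m → ℝ) →L[ℝ] Eucl d) (L η : ℝ)
      (a : Eucl d → Fin m → ℝ) (v : Eucl d) (r : ℝ), 0 ≤ L → (∀ y, A (R y) = y) →
      (∀ y, ‖R y‖ ≤ L * ‖y‖) → L * η ≤ 1 / 2 → 0 ≤ r →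
      (∀ y ∈ Metric.closedBall v r, ∀ y' ∈ Metric.closedBall v r,
        ‖a y - a y' - A (y - y')‖ ≤ η * ‖y - y'‖) →
      Measure.euclideanHausdorffMeasure (d - m) ({y | a y = 0} ∩ Metric.closedBall v r) ≤
        ENNReal.ofReal (C * r ^ (d - m)) := by
  obtain ⟨c, hc, H⟩ := exists_euclideanHausdorffMeasure_submodule_inter_closedBall (d - m)
  refine ⟨max 1 (2 ^ (d - m) * c * 3 ^ (d - m)), le_max_left _ _, ?_⟩
  intro A R L η a v r hL hAR hR hη hr ha
  have hΘ := norm_straighten_sub_sub_le hL hR hη ha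
  set S := {y | a y = 0} ∩ Metric.closedBall v r with hS
  rcases S.eq_empty_or_nonempty with h0 | ⟨y₀, hy₀⟩
  · rw [h0]; simp
  have hker : ∀ y ∈ S, straighten A R a y ∈ LinearMap.ker (A : Eucl d →ₗ[ℝ] (Fin m → ℝ)) := by
    intro y hy
    rw [LinearMap.mem_ker]
    exact (apply_straighten hAR a y).trans hy.1
  -- Straightening contracts distances at most by the factor 2. Two points of the ball are at
  -- distance at most `2r`, so their images are at distance at most `3/2 * 2r = 3r`.
  have h1 := euclideanHausdorffMeasure_le_of_antilipschitz (d - m) (S := S) (K := 2)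
    (S' := (LinearMap.ker (A : Eucl d →ₗ[ℝ] (Fin m → ℝ)) : Set (Eucl d)) ∩
      Metric.closedBall (straighten A R a y₀) (3 * r)) (straighten A R a) ?_ ?_
  · refine h1.trans ?_
    rw [H _ (finrank_ker_of_rightInverse hAR) _ (hker y₀ hy₀) _ (by positivity)]
    have : ((2 : ℝ≥0) : ℝ≥0∞) ^ (d - m) = ENNReal.ofReal (2 ^ (d - m)) := by
      rw [ENNReal.ofReal_pow (by norm_num)]; simp
    rw [this, ← ENNReal.ofReal_mul (by positivity)]
    refine ENNReal.ofReal_le_ofReal ?_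
    rw [mul_pow]
    calc _ = (2 ^ (d - m) * c * 3 ^ (d - m)) * r ^ (d - m) := by ring
      _ ≤ _ := by gcongr; exact le_max_right _ _
  · intro y hy
    refine ⟨hker y hy, ?_⟩
    rw [mem_closedBall_iff_norm]
    have h2 := hΘ y hy.2 y₀ hy₀.2
    have h3 : ‖y - y₀‖ ≤ 2 * r := by
      have h4 := hy.2; have h5 := hy₀.2
      rw [Metric.mem_closedBall] at h4 h5
      rw [← dist_eq_norm]
      linarith [dist_triangle_right y y₀ v]
    have := norm_le_norm_add_norm_sub' (straighten A R a y - straighten A R a y₀) (y - y₀)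
    linarith
  · intro y hy y' hy'
    have h2 := hΘ y hy.2 y' hy'.2
    rw [dist_eq_norm, dist_eq_norm]
    have := norm_le_norm_add_norm_sub (straighten A R a y - straighten A R a y') (y - y')
    push_cast
    linarith

/-- Lower bound for the surface measure of a level set in a ball. -/
theorem exists_le_euclideanHausdorffMeasure_level (d m : ℕ) : ∃ c : ℝ, 0 < c ∧
    ∀ (A : Eucl d →L[ℝ] (Fin m → ℝ)) (R : (Fin m → ℝ) →L[ℝ] Eucl d) (L η : ℝ)
      (a : Eucl d → Fin m → ℝ) (v : Eucl d) (r : ℝ), 0 ≤ L → (∀ y, A (R y) = y) →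
      (∀ y, ‖R y‖ ≤ L * ‖y‖) → L * η ≤ 1 / 2 → 0 ≤ r →
      (∀ y ∈ Metric.closedBall v r, ∀ y' ∈ Metric.closedBall v r,
        ‖a y - a y' - A (y - y')‖ ≤ η * ‖y - y'‖) → L * ‖a v‖ ≤ r / 4 →
      ENNReal.ofReal (c * r ^ (d - m)) ≤
        Measure.euclideanHausdorffMeasure (d - m) ({y | a y = 0} ∩ Metric.closedBall v r) := by
  obtain ⟨c, hc, H⟩ := exists_euclideanHausdorffMeasure_submodule_inter_closedBall (d - m)
  refine ⟨c / 8 ^ (d - m), by positivity, ?_⟩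
  intro A R L η a v r hL hAR hR hη hr ha hav
  have hΘ := norm_straighten_sub_sub_le hL hR hη ha
  set W := LinearMap.ker (A : Eucl d →ₗ[ℝ] (Fin m → ℝ))
  have hp₀ : v - R (A v) ∈ W := by
    rw [LinearMap.mem_ker]
    change A (v - R (A v)) = 0
    simp [hAR]
  -- The straightened centre is within `L * ‖a v‖ ≤ r / 4` of `v - R (A v)`. So every point of this
  -- disc is within `r / 2` of it, as the covering lemma requires.
  have hsurj : ∀ p ∈ (W : Set (Eucl d)) ∩ Metric.closedBall (v - R (A v)) (r / 4),
      ∃ y ∈ Metric.closedBall v r, straighten A R a y = p := by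
    rintro p ⟨-, hp⟩
    refine exists_eq_of_near_id hr hΘ ?_
    rw [mem_closedBall_iff_norm] at hp
    have h1 : p - straighten A R a v = (p - (v - R (A v))) - R (a v) := by
      simp only [straighten, map_sub]; abel
    rw [h1]
    have := norm_sub_le (p - (v - R (A v))) (R (a v))
    have := hR (a v)
    linarith
  choose! q hq hqp using hsurj
  have h1 := euclideanHausdorffMeasure_le_of_antilipschitz (d - m)
    (S := (W : Set (Eucl d)) ∩ Metric.closedBall (v - R (A v)) (r / 4)) (K := 2)
    (S' := {y | a y = 0} ∩ Metric.closedBall v r) q ?_ ?_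
  · rw [H _ (finrank_ker_of_rightInverse hAR) _ hp₀ _ (by positivity)] at h1
    have h2 : ((2 : ℝ≥0) : ℝ≥0∞) ^ (d - m) = ENNReal.ofReal (2 ^ (d - m)) := by
      rw [ENNReal.ofReal_pow (by norm_num)]; simp
    rw [h2] at h1
    have h3 : c * (r / 4) ^ (d - m) = 2 ^ (d - m) * (c / 8 ^ (d - m) * r ^ (d - m)) := by
      rw [show (8 : ℝ) = 2 * 4 by norm_num, mul_pow, div_pow]
      field_simp
    rw [h3, ENNReal.ofReal_mul (by positivity)] at h1
    exact (ENNReal.mul_le_mul_iff_right (by simp) (by simp)).1 h1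
  · intro p hp
    refine ⟨?_, hq p hp⟩
    have := apply_straighten hAR a (q p)
    rw [hqp p hp] at this
    exact this.symm.trans hp.1
  · intro p hp p' hp'
    have h2 := hΘ _ (hq p hp) _ (hq p' hp')
    rw [hqp p hp, hqp p' hp'] at h2
    rw [dist_eq_norm, dist_eq_norm]
    have := norm_le_norm_add_norm_sub' (p - p') (q p - q p')
    push_cast
    linarith [norm_nonneg (q p - q p')]

/-- Nearby level sets are related by a map that is nearly an isometry. -/
theorem exists_level_transfer {M κ β ρ ρ' : ℝ} {a b : Eucl d → Fin m → ℝ} {v : Eucl d}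
    (hL : 0 ≤ L) (hM : 0 ≤ M) (hκ : 0 ≤ κ) (hβ : 0 ≤ β)
    (hAR : ∀ y, A (R y) = y) (hR : ∀ y, ‖R y‖ ≤ L * ‖y‖) (hη : L * η ≤ 1 / 2)
    (hρ : ρ' + 2 * L * β ≤ ρ)
    (hb : ∀ y ∈ Metric.closedBall v ρ, ∀ y' ∈ Metric.closedBall v ρ,
        ‖b y - b y' - A (y - y')‖ ≤ η * ‖y - y'‖)
    (hb₂ : ∀ y ∈ Metric.closedBall v ρ, ∀ y' ∈ Metric.closedBall v ρ, ∀ e,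
        y + e ∈ Metric.closedBall v ρ → y' + e ∈ Metric.closedBall v ρ →
        ‖b (y + e) - b (y' + e) - (b y - b y')‖ ≤ M * ‖e‖ * ‖y - y'‖)
    (hab : ∀ y ∈ Metric.closedBall v ρ, ‖b y - a y‖ ≤ β)
    (hab₂ : ∀ y ∈ Metric.closedBall v ρ, ∀ y' ∈ Metric.closedBall v ρ,
        ‖(b y - a y) - (b y' - a y')‖ ≤ κ * ‖y - y'‖)
    (hsmall : 2 * L * (κ + 2 * L * M * β) ≤ 1 / 2) :
    ∃ q : Eucl d → Eucl d, (∀ z ∈ {y | a y = 0} ∩ Metric.closedBall v ρ',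
        b (q z) = 0 ∧ ‖q z - z‖ ≤ 2 * L * β) ∧
      ∀ z₁ ∈ {y | a y = 0} ∩ Metric.closedBall v ρ', ∀ z₂ ∈ {y | a y = 0} ∩ Metric.closedBall v ρ',
        dist z₁ z₂ ≤ (1 + 4 * L * (κ + 2 * L * M * β)) * dist (q z₁) (q z₂) := by
  have hLβ : 0 ≤ 2 * L * β := by positivity
  have hball : ∀ z ∈ Metric.closedBall v ρ', Metric.closedBall z (2 * L * β) ⊆ Metric.closedBall v ρ := by
    intro z hz
    refine Metric.closedBall_subset_closedBall' ?_
    rw [Metric.mem_closedBall] at hz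
    linarith
  have hΘ := norm_straighten_sub_sub_le hL hR hη hb
  -- The transfer map straightens with `a` and unstraightens with `b`; applying `A` to the equation
  -- shows that `b (q z) = a z`.
  have hex : ∀ z ∈ {y | a y = 0} ∩ Metric.closedBall v ρ',
      ∃ y ∈ Metric.closedBall z (2 * L * β), straighten A R b y = straighten A R a z := by
    rintro z ⟨-, hz⟩
    refine exists_eq_of_near_id hLβ (fun y hy y' hy' => hΘ y (hball z hz hy) y' (hball z hz hy')) ?_
    have h1 : straighten A R a z - straighten A R b z = - R (b z - a z) := by
      simp only [straighten, map_sub]; abel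
    rw [h1, norm_neg]
    have h2 := hR (b z - a z)
    have h3 := hab z (hball z hz (Metric.mem_closedBall_self hLβ))
    have h4 : L * ‖b z - a z‖ ≤ L * β := by gcongr
    linarith
  choose! q hq hqz using hex
  refine ⟨q, fun z hz => ⟨?_, ?_⟩, ?_⟩
  · rw [← apply_straighten hAR b, hqz z hz, apply_straighten hAR]
    exact hz.1
  · exact mem_closedBall_iff_norm.1 (hq z hz)
  · intro z₁ hz₁ z₂ hz₂
    have e₁ := hqz z₁ hz₁
    have e₂ := hqz z₂ hz₂
    have n₁ : ‖q z₁ - z₁‖ ≤ 2 * L * β := mem_closedBall_iff_norm.1 (hq z₁ hz₁)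
    have m₁ := hball z₁ hz₁.2 (hq z₁ hz₁)
    have m₂ := hball z₂ hz₂.2 (hq z₂ hz₂)
    have s₁ := hball z₁ hz₁.2 (Metric.mem_closedBall_self hLβ)
    have s₂ := hball z₂ hz₂.2 (Metric.mem_closedBall_self hLβ)
    have m₃ : z₂ + (q z₁ - z₁) ∈ Metric.closedBall v ρ := by
      refine hball z₂ hz₂.2 ?_
      rw [mem_closedBall_iff_norm]
      simpa using n₁
    have k₁ := hab₂ z₁ s₁ z₂ s₂
    have k₂ := hb₂ z₁ s₁ z₂ s₂ (q z₁ - z₁) (by simpa using m₁) m₃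
    have k₃ := hb _ m₃ _ m₂
    -- The difference of the two displacements is split by carrying the displacement of `z₁` over to
    -- `z₂`. The three terms are controlled by the Lipschitz bound on `b - a`, by the second
    -- differences of `b`, and by the linearization of `b`; the last is at most half of the left
    -- side and is absorbed.
    have key : (q z₁ - z₁) - (q z₂ - z₂) =
        -R ((b z₁ - a z₁) - (b z₂ - a z₂)) -
        R (b (z₁ + (q z₁ - z₁)) - b (z₂ + (q z₁ - z₁)) - (b z₁ - b z₂)) -
        R (b (z₂ + (q z₁ - z₁)) - b (q z₂) - A (z₂ + (q z₁ - z₁) - q z₂)) := by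
      simp only [straighten, map_sub] at e₁ e₂
      simp only [map_sub, map_add, add_sub_cancel]
      linear_combination (norm := module) e₁ - e₂
    have l₁ := hR ((b z₁ - a z₁) - (b z₂ - a z₂))
    have l₂ := hR (b (z₁ + (q z₁ - z₁)) - b (z₂ + (q z₁ - z₁)) - (b z₁ - b z₂))
    have l₃ := hR (b (z₂ + (q z₁ - z₁)) - b (q z₂) - A (z₂ + (q z₁ - z₁) - q z₂))
    have hw : z₂ + (q z₁ - z₁) - q z₂ = (q z₁ - z₁) - (q z₂ - z₂) := by abel
    rw [hw] at k₃
    have hE : ‖(q z₁ - z₁) - (q z₂ - z₂)‖ ≤ L * (κ * ‖z₁ - z₂‖) +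
        L * (M * (2 * L * β) * ‖z₁ - z₂‖) + 1 / 2 * ‖(q z₁ - z₁) - (q z₂ - z₂)‖ := by
      calc ‖(q z₁ - z₁) - (q z₂ - z₂)‖ ≤ L * ‖(b z₁ - a z₁) - (b z₂ - a z₂)‖ +
            L * ‖b (z₁ + (q z₁ - z₁)) - b (z₂ + (q z₁ - z₁)) - (b z₁ - b z₂)‖ +
            L * ‖b (z₂ + (q z₁ - z₁)) - b (q z₂) - A (z₂ + (q z₁ - z₁) - q z₂)‖ := by
            conv_lhs => rw [key]
            refine (norm_sub_le _ _).trans (add_le_add ((norm_sub_le _ _).trans (add_le_add ?_ l₂)) l₃)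
            rw [norm_neg]
            exact l₁
        _ ≤ L * (κ * ‖z₁ - z₂‖) + L * (M * (2 * L * β) * ‖z₁ - z₂‖) +
            L * (η * ‖(q z₁ - z₁) - (q z₂ - z₂)‖) := by
            rw [hw]
            gcongr
            refine k₂.trans ?_
            gcongr
        _ ≤ _ := by
            rw [← mul_assoc L η]
            gcongr
    have hΔ : ‖z₁ - z₂‖ ≤ ‖q z₁ - q z₂‖ + ‖(q z₁ - z₁) - (q z₂ - z₂)‖ := by
      have h1 : z₁ - z₂ = (q z₁ - q z₂) - ((q z₁ - z₁) - (q z₂ - z₂)) := by abel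
      conv_lhs => rw [h1]
      exact norm_sub_le _ _
    rw [dist_eq_norm, dist_eq_norm]
    set k := 2 * L * (κ + 2 * L * M * β) with hk
    have hk0 : 0 ≤ k := by positivity
    have hE' : ‖(q z₁ - z₁) - (q z₂ - z₂)‖ ≤ k * ‖z₁ - z₂‖ := by
      rw [hk]; linarith
    -- For `0 ≤ k ≤ 1/2` one has `(1 + 2k)(1 - k) ≥ 1`, which turns this into the claimed factor `1
    -- + 2k`.
    have h1 : (1 - k) * ‖z₁ - z₂‖ ≤ ‖q z₁ - q z₂‖ := by linarith
    have h2 : 4 * L * (κ + 2 * L * M * β) = 2 * k := by rw [hk]; ring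
    rw [h2]
    have h3 : 0 ≤ ‖z₁ - z₂‖ := norm_nonneg _
    nlinarith [mul_nonneg (mul_nonneg hk0 (sub_nonneg.2 hsmall)) h3]

end LevelSets

/-! ### Integrals over neighbouring level sets, and volumes of slabs -/

section LevelIntegrals

variable {d m : ℕ}

/-- Quantitative closeness of the maps `a` and `b` on a ball around `v`; both of them are close to
the linear map `A`, which has the right inverse `R`. -/
structure AreCloseLevels (A : Eucl d →L[ℝ] (Fin m → ℝ)) (R : (Fin m → ℝ) →L[ℝ] Eucl d)
    (L η M κ β ρ : ℝ) (v : Eucl d) (a b : Eucl d → Fin m → ℝ) : Prop where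
  rightInverse : ∀ y, A (R y) = y
  norm_le : ∀ y, ‖R y‖ ≤ L * ‖y‖
  lin_left : ∀ y ∈ Metric.closedBall v ρ, ∀ y' ∈ Metric.closedBall v ρ,
    ‖a y - a y' - A (y - y')‖ ≤ η * ‖y - y'‖
  lin_right : ∀ y ∈ Metric.closedBall v ρ, ∀ y' ∈ Metric.closedBall v ρ,
    ‖b y - b y' - A (y - y')‖ ≤ η * ‖y - y'‖
  second_left : ∀ y ∈ Metric.closedBall v ρ, ∀ y' ∈ Metric.closedBall v ρ, ∀ e,
    y + e ∈ Metric.closedBall v ρ → y' + e ∈ Metric.closedBall v ρ →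
    ‖a (y + e) - a (y' + e) - (a y - a y')‖ ≤ M * ‖e‖ * ‖y - y'‖
  second_right : ∀ y ∈ Metric.closedBall v ρ, ∀ y' ∈ Metric.closedBall v ρ, ∀ e,
    y + e ∈ Metric.closedBall v ρ → y' + e ∈ Metric.closedBall v ρ →
    ‖b (y + e) - b (y' + e) - (b y - b y')‖ ≤ M * ‖e‖ * ‖y - y'‖
  sub_le : ∀ y ∈ Metric.closedBall v ρ, ‖b y - a y‖ ≤ β
  sub_lip : ∀ y ∈ Metric.closedBall v ρ, ∀ y' ∈ Metric.closedBall v ρ,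
    ‖(b y - a y) - (b y' - a y')‖ ≤ κ * ‖y - y'‖

theorem AreCloseLevels.symm {A : Eucl d →L[ℝ] (Fin m → ℝ)} {R : (Fin m → ℝ) →L[ℝ] Eucl d}
    {L η M κ β ρ : ℝ} {v : Eucl d} {a b : Eucl d → Fin m → ℝ}
    (h : AreCloseLevels A R L η M κ β ρ v a b) : AreCloseLevels A R L η M κ β ρ v b a where
  rightInverse := h.rightInverse
  norm_le := h.norm_le
  lin_left := h.lin_right
  lin_right := h.lin_left
  second_left := h.second_right
  second_right := h.second_left
  sub_le y hy := by rw [norm_sub_rev]; exact h.sub_le y hy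
  sub_lip y hy y' hy' := by
    have := h.sub_lip y hy y' hy'
    rwa [← norm_neg, show -(a y - b y - (a y' - b y')) = b y - a y - (b y' - a y') by abel]

theorem one_add_pow_le {x : ℝ} (hx0 : 0 ≤ x) (hx1 : x ≤ 1) (n : ℕ) :
    (1 + x) ^ n ≤ 1 + 3 ^ n * x := by
  induction n with
  | zero => simpa using hx0
  | succ n ih =>
    have h3 : (1 : ℝ) ≤ 3 ^ n := one_le_pow₀ (by norm_num)
    rw [pow_succ, pow_succ]
    calc (1 + x) ^ n * (1 + x) ≤ (1 + 3 ^ n * x) * (1 + x) := by gcongr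
      _ ≤ _ := by nlinarith [mul_nonneg (mul_nonneg (zero_le_one.trans h3) hx0) (sub_nonneg.2 hx1)]

theorem integrableOn_of_continuous_of_eq_zero {μ : Measure (Eucl d)} {S B : Set (Eucl d)}
    (hS : MeasurableSet S) (hB : IsCompact B) (hfin : μ (S ∩ B) ≠ ⊤) {F : Eucl d → ℝ}
    (hF : Continuous F) (hsupp : ∀ y, y ∉ B → F y = 0) : IntegrableOn F S μ := by
  obtain ⟨C, hC⟩ := hB.exists_bound_of_continuousOn hF.continuousOn
  have hon : IntegrableOn F (S ∩ B) μ :=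
    Measure.integrableOn_of_bounded hfin hF.aestronglyMeasurable
      ((ae_restrict_iff' (hS.inter hB.measurableSet)).2
        (Filter.Eventually.of_forall fun y hy => hC y hy.2))
  exact hon.of_forall_sdiff_eq_zero hS fun y hy => hsupp y fun hy' => hy.2 ⟨hy.1, hy'⟩

/-- The transfer map distorts area by at most `(1 + k)^n` and moves points by at most `2Lβ`, so the
left integral is at most `(1 + k)^n` times that of `F + 2LβF₁` over the other level set. The a
priori bound `F₀σ` converts the relative error into an absolute one. -/
theorem setIntegral_level_le {A : Eucl d →L[ℝ] (Fin m → ℝ)} {R : (Fin m → ℝ) →L[ℝ] Eucl d}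
    {L η M κ β ρ ρ' σ : ℝ} {v : Eucl d} {a b : Eucl d → Fin m → ℝ} {n : ℕ}
    (h : AreCloseLevels A R L η M κ β ρ v a b) (ha : Continuous a) (hb : Continuous b)
    (hL : 0 ≤ L) (hM : 0 ≤ M) (hκ : 0 ≤ κ) (hβ : 0 ≤ β) (hη : L * η ≤ 1 / 2)
    (hρ : ρ' + 2 * L * β ≤ ρ) (hsmall : 2 * L * (κ + 2 * L * M * β) ≤ 1 / 2) (hσ0 : 0 ≤ σ)
    (hσ : Measure.euclideanHausdorffMeasure n ({y | b y = 0} ∩ Metric.closedBall v ρ) ≤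
      ENNReal.ofReal σ)
    {F : Eucl d → ℝ} {F₀ F₁ : ℝ} (hF0 : ∀ y, 0 ≤ F y) (hF1 : ∀ y, F y ≤ F₀) (hF₁ : 0 ≤ F₁)
    (hlip : ∀ y y', |F y - F y'| ≤ F₁ * ‖y - y'‖) (hF : Continuous F)
    (hsupp : ∀ y, y ∉ Metric.closedBall v ρ' → F y = 0) :
    ∫ y in {y | a y = 0}, F y ∂(Measure.euclideanHausdorffMeasure n) ≤
      ∫ y in {y | b y = 0}, F y ∂(Measure.euclideanHausdorffMeasure n) +
        3 ^ n * (4 * L * (κ + 2 * L * M * β) * F₀ + 2 * L * β * F₁) * σ := by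
  obtain ⟨q, hq, hK⟩ := exists_level_transfer hL hM hκ hβ h.rightInverse h.norm_le hη hρ
    h.lin_right h.second_right h.sub_le h.sub_lip hsmall
  have hLβ : 0 ≤ 2 * L * β := by positivity
  set k := 4 * L * (κ + 2 * L * M * β) with hk
  have hk0 : 0 ≤ k := by positivity
  have hk1 : k ≤ 1 := by rw [hk]; linarith
  set Sa := {y | a y = 0} ∩ Metric.closedBall v ρ' with hSa
  set Sb := {y | b y = 0} ∩ Metric.closedBall v ρ with hSb
  set c := 2 * L * β * F₁ with hc
  have hc0 : 0 ≤ c := by positivity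
  have hF₀ : 0 ≤ F₀ := (hF0 v).trans (hF1 v)
  have hfin : Measure.euclideanHausdorffMeasure n Sb < ⊤ := hσ.trans_lt ENNReal.ofReal_lt_top
  have hσ' : (Measure.euclideanHausdorffMeasure n).real Sb ≤ σ :=
    ENNReal.toReal_le_of_le_ofReal hσ0 hσ
  have hsuppρ : ∀ y, y ∉ Metric.closedBall v ρ → F y = 0 := fun y hy =>
    hsupp y fun hy' => hy (Metric.closedBall_subset_closedBall (by linarith) hy')
  have hmeas_a : MeasurableSet {y | a y = 0} := (isClosed_eq ha continuous_const).measurableSet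
  have hmeas_b : MeasurableSet {y | b y = 0} := (isClosed_eq hb continuous_const).measurableSet
  have hint : IntegrableOn F Sb (Measure.euclideanHausdorffMeasure n) :=
    (integrableOn_of_continuous_of_eq_zero hmeas_b (isCompact_closedBall v ρ) hfin.ne hF
      hsuppρ).mono_set Set.inter_subset_left
  have ea : ∫ y in {y | a y = 0}, F y ∂(Measure.euclideanHausdorffMeasure n) =
      ∫ y in Sa, F y ∂(Measure.euclideanHausdorffMeasure n) :=
    setIntegral_eq_of_subset_of_forall_sdiff_eq_zero hmeas_a Set.inter_subset_left
      fun y hy => hsupp y fun hy' => hy.2 ⟨hy.1, hy'⟩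
  have eb : ∫ y in {y | b y = 0}, F y ∂(Measure.euclideanHausdorffMeasure n) =
      ∫ y in Sb, F y ∂(Measure.euclideanHausdorffMeasure n) :=
    setIntegral_eq_of_subset_of_forall_sdiff_eq_zero hmeas_b Set.inter_subset_left
      fun y hy => hsuppρ y fun hy' => hy.2 ⟨hy.1, hy'⟩
  have hconst : IntegrableOn (fun _ : Eucl d => c) Sb (Measure.euclideanHausdorffMeasure n) :=
    integrableOn_const hfin.ne
  have main : ∫⁻ z in Sa, ENNReal.ofReal (F z) ∂(Measure.euclideanHausdorffMeasure n) ≤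
      ENNReal.ofReal ((1 + k) ^ n * ∫ z in Sb, (F z + c) ∂(Measure.euclideanHausdorffMeasure n)) := by
    rw [ENNReal.ofReal_mul (by positivity), ofReal_integral_eq_lintegral_ofReal
      (show Integrable (fun z => F z + c) _ from hint.add hconst) (Filter.Eventually.of_forall fun y => add_nonneg (hF0 y) hc0), ENNReal.ofReal_pow (by positivity)]
    refine lintegral_le_of_antilipschitz n (K := (1 + k).toNNReal) q ?_ ?_ hF.measurable
      (hF.measurable.add_const c) hF0 (fun y => add_nonneg (hF0 y) hc0) ?_
    · intro z hz
      refine ⟨(hq z hz).1, ?_⟩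
      have h1 := (hq z hz).2
      have h2 := hz.2
      rw [Metric.mem_closedBall] at h2 ⊢
      rw [← dist_eq_norm] at h1
      linarith [dist_triangle (q z) z v]
    · rw [Real.coe_toNNReal _ (by positivity)]
      exact hK
    · intro z hz
      have h1 := hlip z (q z)
      have h2 : F₁ * ‖z - q z‖ ≤ F₁ * (2 * L * β) := by
        gcongr
        rw [norm_sub_rev]
        exact (hq z hz).2
      have := le_abs_self (F z - F (q z))
      rw [hc]; linarith
  have hI0 : 0 ≤ ∫ z in Sb, F z ∂(Measure.euclideanHausdorffMeasure n) :=
    integral_nonneg hF0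
  have hI1 : ∫ z in Sb, F z ∂(Measure.euclideanHausdorffMeasure n) ≤ F₀ * σ := by
    calc _ ≤ ∫ z in Sb, F₀ ∂(Measure.euclideanHausdorffMeasure n) :=
          integral_mono hint (integrableOn_const hfin.ne) hF1
      _ = (Measure.euclideanHausdorffMeasure n).real Sb * F₀ := by simp
      _ ≤ _ := by rw [mul_comm]; gcongr
  have hsum : ∫ z in Sb, (F z + c) ∂(Measure.euclideanHausdorffMeasure n) ≤
      ∫ z in Sb, F z ∂(Measure.euclideanHausdorffMeasure n) + c * σ := by
    rw [integral_add hint hconst]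
    simp only [integral_const, MeasurableSet.univ, measureReal_restrict_apply, Set.univ_inter,
      smul_eq_mul]
    rw [mul_comm]
    gcongr
  rw [ea, eb, integral_eq_lintegral_of_nonneg_ae (Filter.Eventually.of_forall hF0)
    hF.aestronglyMeasurable]
  refine (ENNReal.toReal_le_of_le_ofReal (mul_nonneg (by positivity)
    (integral_nonneg fun y => add_nonneg (hF0 y) hc0)) main).trans ?_
  have hp := one_add_pow_le hk0 hk1 n
  have h3 : (1 + k) ^ n ≤ 3 ^ n := by gcongr; linarith
  set I := ∫ z in Sb, F z ∂(Measure.euclideanHausdorffMeasure n)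
  calc _ ≤ (1 + k) ^ n * (I + c * σ) := by gcongr
    _ = (1 + k) ^ n * I + (1 + k) ^ n * (c * σ) := by ring
    _ ≤ (1 + 3 ^ n * k) * I + 3 ^ n * (c * σ) := by gcongr
    _ = I + 3 ^ n * k * I + 3 ^ n * (c * σ) := by ring
    _ ≤ I + 3 ^ n * k * (F₀ * σ) + 3 ^ n * (c * σ) := by gcongr
    _ = _ := by ring

theorem abs_setIntegral_level_sub_le {A : Eucl d →L[ℝ] (Fin m → ℝ)} {R : (Fin m → ℝ) →L[ℝ] Eucl d}
    {L η M κ β ρ ρ' σ : ℝ} {v : Eucl d} {a b : Eucl d → Fin m → ℝ} {n : ℕ}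
    (h : AreCloseLevels A R L η M κ β ρ v a b) (ha : Continuous a) (hb : Continuous b)
    (hL : 0 ≤ L) (hM : 0 ≤ M) (hκ : 0 ≤ κ) (hβ : 0 ≤ β) (hη : L * η ≤ 1 / 2)
    (hρ : ρ' + 2 * L * β ≤ ρ) (hsmall : 2 * L * (κ + 2 * L * M * β) ≤ 1 / 2) (hσ0 : 0 ≤ σ)
    (hσa : Measure.euclideanHausdorffMeasure n ({y | a y = 0} ∩ Metric.closedBall v ρ) ≤
      ENNReal.ofReal σ)
    (hσb : Measure.euclideanHausdorffMeasure n ({y | b y = 0} ∩ Metric.closedBall v ρ) ≤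
      ENNReal.ofReal σ)
    {F : Eucl d → ℝ} {F₀ F₁ : ℝ} (hF0 : ∀ y, 0 ≤ F y) (hF1 : ∀ y, F y ≤ F₀) (hF₁ : 0 ≤ F₁)
    (hlip : ∀ y y', |F y - F y'| ≤ F₁ * ‖y - y'‖) (hF : Continuous F)
    (hsupp : ∀ y, y ∉ Metric.closedBall v ρ' → F y = 0) :
    |∫ y in {y | a y = 0}, F y ∂(Measure.euclideanHausdorffMeasure n) -
      ∫ y in {y | b y = 0}, F y ∂(Measure.euclideanHausdorffMeasure n)| ≤
        3 ^ n * (4 * L * (κ + 2 * L * M * β) * F₀ + 2 * L * β * F₁) * σ := by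
  have h1 := setIntegral_level_le h ha hb hL hM hκ hβ hη hρ hsmall hσ0 hσb hF0 hF1 hF₁ hlip hF hsupp
  have h2 := setIntegral_level_le h.symm hb ha hL hM hκ hβ hη hρ hsmall hσ0 hσa hF0 hF1 hF₁ hlip hF
    hsupp
  rw [abs_le]
  constructor <;> linarith

/-- The volume of a neighbourhood of a level set. -/
theorem volume_slab_le {A : Eucl d →L[ℝ] (Fin m → ℝ)} {R : (Fin m → ℝ) →L[ℝ] Eucl d}
    {L η ρ G ε r : ℝ} {u : Eucl d} {f : Eucl d → Fin m → ℝ} (hf : Continuous f)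
    (hL : 0 ≤ L) (hG : 0 ≤ G) (hε : 0 < ε) (hr : 0 ≤ r)
    (hAR : ∀ y, A (R y) = y) (hR : ∀ y, ‖R y‖ ≤ L * ‖y‖) (hη : L * η ≤ 1 / 2)
    (hρ : (G + L) * ε ≤ ρ)
    (hlin : ∀ y ∈ Metric.closedBall u ρ, ∀ y' ∈ Metric.closedBall u ρ,
        ‖f y - f y' - A (y - y')‖ ≤ η * ‖y - y'‖) :
    volume {x ∈ Metric.closedBall u (G * ε) | ‖f x‖ ≤ r} ≤
      ENNReal.ofReal (4 ^ m * (G + L) ^ d * volume.real (Metric.ball (0 : Eucl d) 1) *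
        (ε ^ d * (r / ε) ^ m)) := by
  set S := {x ∈ Metric.closedBall u (G * ε) | ‖f x‖ ≤ r} with hSdef
  have hS : MeasurableSet S :=
    (Metric.isClosed_closedBall.inter (isClosed_le hf.norm continuous_const)).measurableSet
  set V := Metric.closedBall (0 : Fin m → ℝ) ε
  set B := Metric.closedBall u ((G + L) * ε) with hB
  have hV : volume V = ENNReal.ofReal ((2 * ε) ^ m) := by
    rw [Real.volume_pi_closedBall _ hε.le, Fintype.card_fin]
  -- Averaging over the translates by `R τ`, with `τ` in a cube of side `2ε`, replaces a change of
  -- variables along the level sets.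
  have e1 : volume S * volume V =
      ∫⁻ x, ∫⁻ τ in V, S.indicator (fun _ => (1 : ℝ≥0∞)) (x - R τ) := by
    rw [lintegral_lintegral_swap]
    · have : ∀ τ : Fin m → ℝ, ∫⁻ x, S.indicator (fun _ => (1 : ℝ≥0∞)) (x - R τ) = volume S := by
        intro τ
        rw [lintegral_sub_right_eq_self (fun x => S.indicator (fun _ => (1 : ℝ≥0∞)) x),
          lintegral_indicator_const hS, one_mul]
      simp only [this]
      rw [setLIntegral_const]
    · exact ((measurable_const.indicator hS).comp (by fun_prop :
        Measurable fun p : Eucl d × (Fin m → ℝ) => p.1 - R p.2)).aemeasurable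
  have e2 : ∀ x, ∫⁻ τ in V, S.indicator (fun _ => (1 : ℝ≥0∞)) (x - R τ) ≤
      B.indicator (fun _ => ENNReal.ofReal ((2 * (4 * r)) ^ m)) x := by
    intro x
    have e3 : ∫⁻ τ in V, S.indicator (fun _ => (1 : ℝ≥0∞)) (x - R τ) =
        volume (V ∩ (fun τ => x - R τ) ⁻¹' S) := by
      have : (fun τ => S.indicator (fun _ => (1 : ℝ≥0∞)) (x - R τ)) =
          ((fun τ => x - R τ) ⁻¹' S).indicator (fun _ => 1) := by
        ext τ
        rfl
      have hm : MeasurableSet ((fun τ => x - R τ) ⁻¹' S) :=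
        hS.preimage (by fun_prop : Measurable fun τ => x - R τ)
      rw [this, lintegral_indicator_const hm, one_mul, Measure.restrict_apply hm, Set.inter_comm]
    rw [e3]
    rcases (V ∩ (fun τ => x - R τ) ⁻¹' S).eq_empty_or_nonempty with h0 | ⟨τ₀, hτ₀V, hτ₀S⟩
    · rw [h0]; simp
    · have hmem : ∀ τ ∈ V, ‖R τ‖ ≤ L * ε := fun τ hτ => by
        refine (hR τ).trans ?_
        gcongr
        simpa [V] using hτ
      have hxB : x ∈ B := by
        have h1 : x - R τ₀ ∈ Metric.closedBall u (G * ε) := hτ₀S.1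
        rw [mem_closedBall_iff_norm] at h1
        rw [hB, mem_closedBall_iff_norm]
        have h2 := norm_add_le (x - R τ₀ - u) (R τ₀)
        rw [show x - R τ₀ - u + R τ₀ = x - u by abel] at h2
        linarith [hmem τ₀ hτ₀V]
      rw [Set.indicator_of_mem hxB]
      -- Moving `x` by `-R τ` changes `f` by `-τ` up to half its size. Hence two admissible `τ`
      -- differ by at most `2r` plus half their distance.
      have hsub : V ∩ (fun τ => x - R τ) ⁻¹' S ⊆ Metric.closedBall τ₀ (4 * r) := by
        rintro τ ⟨hτV, hτS⟩
        have hS' : ∀ z ∈ S, z ∈ Metric.closedBall u ρ := fun z hz =>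
          Metric.closedBall_subset_closedBall (by nlinarith) hz.1
        have h1 := hlin _ (hS' _ hτS) _ (hS' _ hτ₀S)
        have h2 : x - R τ - (x - R τ₀) = - R (τ - τ₀) := by rw [map_sub]; abel
        rw [h2, map_neg, hAR, norm_neg] at h1
        have hη0 : η * ‖R (τ - τ₀)‖ ≤ 1 / 2 * ‖τ - τ₀‖ := by
          rcases le_or_gt 0 η with h0 | h0
          · calc η * ‖R (τ - τ₀)‖ ≤ η * (L * ‖τ - τ₀‖) := by gcongr; exact hR _
              _ = (L * η) * ‖τ - τ₀‖ := by ring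
              _ ≤ _ := by gcongr
          · nlinarith [norm_nonneg (R (τ - τ₀)), norm_nonneg (τ - τ₀)]
        have h3 := norm_sub_le (f (x - R τ) - f (x - R τ₀) - -(τ - τ₀))
          (f (x - R τ) - f (x - R τ₀))
        have h4 := norm_sub_le (f (x - R τ)) (f (x - R τ₀))
        rw [show f (x - R τ) - f (x - R τ₀) - -(τ - τ₀) - (f (x - R τ) - f (x - R τ₀)) = τ - τ₀
          by abel] at h3
        have h5 : ‖f (x - R τ)‖ ≤ r := hτS.2
        have h6 : ‖f (x - R τ₀)‖ ≤ r := hτ₀S.2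
        rw [mem_closedBall_iff_norm]
        linarith
      refine (measure_mono hsub).trans ?_
      rw [Real.volume_pi_closedBall _ (by positivity), Fintype.card_fin]
  have e4 : volume S * volume V ≤
      ENNReal.ofReal ((2 * (4 * r)) ^ m) * volume B := by
    rw [e1]
    refine (lintegral_mono e2).trans ?_
    rw [lintegral_indicator_const Metric.isClosed_closedBall.measurableSet]
  have hBv : volume B = ENNReal.ofReal (((G + L) * ε) ^ d * volume.real (Metric.ball (0 : Eucl d) 1)) := by
    rw [hB, Measure.addHaar_closedBall _ _ (by positivity), finrank_euclideanSpace, Fintype.card_fin,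
      ENNReal.ofReal_mul (by positivity), measureReal_def, ENNReal.ofReal_toReal measure_ball_lt_top.ne]
  rw [hV, hBv, ← ENNReal.ofReal_mul (by positivity)] at e4
  rw [← ENNReal.le_div_iff_mul_le (by left; simp [hε]) (by simp),
    ← ENNReal.ofReal_div_of_pos (by positivity)] at e4
  refine e4.trans (ENNReal.ofReal_le_ofReal (le_of_eq ?_))
  rw [show 2 * (4 * r) = (2 * ε) * 4 * (r / ε) by field_simp]
  rw [mul_pow, mul_pow ((2 : ℝ) * ε), mul_pow (G + L)]
  field_simp

end LevelIntegrals

/-! ### Local estimates for the Radon transform of a mollifier -/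

section RadonLocal

variable {d m : ℕ}

/-- The vector-valued map with components `φ l`. -/
def jointMap (φ : Fin m → Eucl d × Eucl d → ℝ) (p : Eucl d × Eucl d) : Fin m → ℝ := fun l => φ l p

/-- The generalized Radon transform of a real function. -/
noncomputable def realRadon (φ : Fin m → Eucl d × Eucl d → ℝ) (ψ : Eucl d × Eucl d → ℝ)
    (t : Fin m → ℝ) (f : Eucl d → ℝ) (x : Eucl d) : ℝ :=
  ∫ y in levelSet φ t x, f y * ψ (x, y) ∂(Measure.euclideanHausdorffMeasure (d - m))

theorem radonTransform_ofReal (φ : Fin m → Eucl d × Eucl d → ℝ) (ψ : Eucl d × Eucl d → ℝ)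
    (t : Fin m → ℝ) (f : Eucl d → ℝ) (x : Eucl d) :
    radonTransform φ ψ t (fun y => (f y : ℂ)) x = (realRadon φ ψ t f x : ℂ) := by
  rw [radonTransform, realRadon, ← integral_complex_ofReal]
  simp only [Complex.ofReal_mul]

theorem levelSet_eq (φ : Fin m → Eucl d × Eucl d → ℝ) (t : Fin m → ℝ) (x : Eucl d) :
    levelSet φ t x = {y | jointMap φ (x, y) - t = 0} := by
  ext y
  simp [levelSet, jointMap, sub_eq_zero, funext_iff]

theorem continuous_jointMap {φ : Fin m → Eucl d × Eucl d → ℝ} (hφ : ∀ l, Continuous (φ l)) :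
    Continuous (jointMap φ) := continuous_pi hφ

/-- Size, smoothness and support of a mollifier at scale `ε`. -/
structure KernelBound (q : Eucl d → ℝ) (G ε : ℝ) : Prop where
  bound : ∀ x, |q x| ≤ G / ε ^ d
  lip : ∀ x y, |q x - q y| ≤ G / ε ^ (d + 1) * ‖x - y‖
  supp : ∀ x, G * ε < ‖x‖ → q x = 0

theorem KernelBound.continuous {q : Eucl d → ℝ} {G ε : ℝ} (hq : KernelBound q G ε) :
    Continuous q := by
  have h : LipschitzWith (G / ε ^ (d + 1)).toNNReal q := by
    refine LipschitzWith.of_dist_le_mul fun x y => ?_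
    rw [Real.dist_eq, dist_eq_norm]
    refine (hq.lip x y).trans ?_
    gcongr
    exact Real.le_coe_toNNReal _
  exact h.continuous

/-- Bounds, on the ball of radius `ρ₀` around `(u, v)`, for the defining functions and the cutoff;
`D` is the derivative at `(u, v)`, and `M` bounds the data. -/
structure IsBoundedNear (φ : Fin m → Eucl d × Eucl d → ℝ) (ψ : Eucl d × Eucl d → ℝ) (u v : Eucl d)
    (ρ₀ M : ℝ) (D : Eucl d × Eucl d →L[ℝ] (Fin m → ℝ)) : Prop where
  norm_le : ∀ e, ‖D e‖ ≤ M * ‖e‖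
  lip : ∀ p ∈ Metric.closedBall (u, v) ρ₀, ∀ p' ∈ Metric.closedBall (u, v) ρ₀,
    ‖jointMap φ p - jointMap φ p'‖ ≤ M * ‖p - p'‖
  lin : ∀ ρ ≤ ρ₀, ∀ p ∈ Metric.closedBall (u, v) ρ, ∀ p' ∈ Metric.closedBall (u, v) ρ,
    ‖jointMap φ p - jointMap φ p' - D (p - p')‖ ≤ M * ρ * ‖p - p'‖
  second : ∀ p ∈ Metric.closedBall (u, v) ρ₀, ∀ p' ∈ Metric.closedBall (u, v) ρ₀, ∀ e,
    p + e ∈ Metric.closedBall (u, v) ρ₀ → p' + e ∈ Metric.closedBall (u, v) ρ₀ →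
    ‖jointMap φ (p + e) - jointMap φ (p' + e) - (jointMap φ p - jointMap φ p')‖ ≤
      M * ‖e‖ * ‖p - p'‖
  cutoff_le : ∀ p ∈ Metric.closedBall (u, v) ρ₀, |ψ p| ≤ M
  cutoff_lip : ∀ p ∈ Metric.closedBall (u, v) ρ₀, ∀ p' ∈ Metric.closedBall (u, v) ρ₀,
    |ψ p - ψ p'| ≤ M * ‖p - p'‖

/-- Right inverses, bounded by `L`, for the two partial derivatives given by `D`. -/
structure HasRightInverses (D : Eucl d × Eucl d →L[ℝ] (Fin m → ℝ)) (L : ℝ)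
    (Rx Ry : (Fin m → ℝ) →L[ℝ] Eucl d) : Prop where
  left_eq : ∀ y, D (Rx y, 0) = y
  right_eq : ∀ y, D (0, Ry y) = y
  left_le : ∀ y, ‖Rx y‖ ≤ L * ‖y‖
  right_le : ∀ y, ‖Ry y‖ ≤ L * ‖y‖

theorem mem_closedBall_prod {u v x y : Eucl d} {ρ : ℝ} (hx : ‖x - u‖ ≤ ρ) (hy : ‖y - v‖ ≤ ρ) :
    (x, y) ∈ Metric.closedBall (u, v) ρ := by
  rw [mem_closedBall_iff_norm]
  exact max_le hx hy

theorem norm_pair_le {x y : Eucl d} {ρ : ℝ} (hx : ‖x‖ ≤ ρ) (hy : ‖y‖ ≤ ρ) : ‖(x, y)‖ ≤ ρ :=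
  max_le hx hy

/-- The measure of a level set in a small ball. -/
theorem exists_level_measure_le (d m : ℕ) : ∃ C : ℝ, 1 ≤ C ∧
    ∀ (φ : Fin m → Eucl d × Eucl d → ℝ) (ψ : Eucl d × Eucl d → ℝ) (u v : Eucl d) (ρ₀ M L : ℝ)
      (D : Eucl d × Eucl d →L[ℝ] (Fin m → ℝ)) (Rx Ry : (Fin m → ℝ) →L[ℝ] Eucl d) (t : Fin m → ℝ)
      (ρ r : ℝ) (x : Eucl d),
      IsBoundedNear φ ψ u v ρ₀ M D → HasRightInverses D L Rx Ry → 0 ≤ L → ρ ≤ ρ₀ →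
      L * (M * ρ) ≤ 1 / 2 → 0 ≤ r → r ≤ ρ → ‖x - u‖ ≤ ρ →
      Measure.euclideanHausdorffMeasure (d - m)
        ({y | jointMap φ (x, y) - t = 0} ∩ Metric.closedBall v r) ≤
          ENNReal.ofReal (C * r ^ (d - m)) := by
  obtain ⟨C, hC, H⟩ := exists_euclideanHausdorffMeasure_level_le d m
  refine ⟨C, hC, ?_⟩
  intro φ ψ u v ρ₀ M L D Rx Ry t ρ r x hB hR hL hρ hη hr hrρ hx
  refine H (D.comp (ContinuousLinearMap.inr ℝ _ _)) Ry L (M * ρ)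
    (fun y => jointMap φ (x, y) - t) v r hL (fun y => by simpa using hR.right_eq y)
    hR.right_le hη hr ?_
  intro y hy y' hy'
  rw [mem_closedBall_iff_norm] at hy hy'
  have := hB.lin ρ hρ (x, y) (mem_closedBall_prod hx (hy.trans hrρ)) (x, y')
    (mem_closedBall_prod hx (hy'.trans hrρ))
  simpa using this

/-- Bound for the Radon transform of a mollifier. -/
theorem abs_realRadon_le {φ : Fin m → Eucl d × Eucl d → ℝ} {ψ : Eucl d × Eucl d → ℝ} {u v : Eucl d}
    {ρ₀ M : ℝ} {D : Eucl d × Eucl d →L[ℝ] (Fin m → ℝ)} (hB : IsBoundedNear φ ψ u v ρ₀ M D)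
    (hφ : ∀ l, Continuous (φ l)) {t : Fin m → ℝ}
    {r P σ : ℝ} {x : Eucl d} {p : Eucl d → ℝ} (hx : ‖x - u‖ ≤ ρ₀) (hr : r ≤ ρ₀) (hM : 0 ≤ M)
    (hP : ∀ y, |p y| ≤ P) (hp : ∀ y, y ∉ Metric.closedBall v r → p y = 0) (hσ0 : 0 ≤ σ)
    (hσ : Measure.euclideanHausdorffMeasure (d - m)
        ({y | jointMap φ (x, y) - t = 0} ∩ Metric.closedBall v r) ≤ ENNReal.ofReal σ) :
    |realRadon φ ψ t p x| ≤ P * M * σ := by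
  have hP0 : 0 ≤ P := (abs_nonneg _).trans (hP v)
  set S := {y | jointMap φ (x, y) - t = 0} ∩ Metric.closedBall v r with hS
  have hmeas : MeasurableSet {y | jointMap φ (x, y) - t = 0} :=
    (isClosed_eq (((continuous_jointMap hφ).comp (by fun_prop)).sub continuous_const)
      continuous_const).measurableSet
  have e : realRadon φ ψ t p x =
      ∫ y in S, p y * ψ (x, y) ∂(Measure.euclideanHausdorffMeasure (d - m)) := by
    rw [realRadon, levelSet_eq]
    exact setIntegral_eq_of_subset_of_forall_sdiff_eq_zero hmeas Set.inter_subset_left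
      fun y hy => by rw [hp y fun hy' => hy.2 ⟨hy.1, hy'⟩, zero_mul]
  rw [e, ← Real.norm_eq_abs]
  refine (norm_setIntegral_le_of_norm_le_const (hσ.trans_lt ENNReal.ofReal_lt_top)
    (C := P * M) ?_).trans ?_
  · intro y hy
    rw [norm_mul]
    exact mul_le_mul (hP y) (hB.cutoff_le _ (mem_closedBall_prod hx
      ((mem_closedBall_iff_norm.1 hy.2).trans hr))) (norm_nonneg _) hP0
  · gcongr
    exact ENNReal.toReal_le_of_le_ofReal hσ0 hσ

/-- The Radon transform of a mollifier centred at `v` vanishes away from the level set of `v`. -/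
theorem realRadon_eq_zero {φ : Fin m → Eucl d × Eucl d → ℝ} {ψ : Eucl d × Eucl d → ℝ}
    {t : Fin m → ℝ} {r : ℝ} {x w : Eucl d} {p : Eucl d → ℝ}
    (hp : ∀ y, y ∉ Metric.closedBall w r → p y = 0)
    (h : ∀ y ∈ Metric.closedBall w r, jointMap φ (x, y) ≠ t) :
    realRadon φ ψ t p x = 0 := by
  rw [realRadon, levelSet_eq]
  refine setIntegral_eq_zero_of_forall_eq_zero fun y hy => ?_
  rw [hp y fun hy' => h y hy' (sub_eq_zero.1 hy), zero_mul]

/-- The level sets of `φ (x, ·)` and of its translate are close to each other. -/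
theorem areCloseLevels_shift {φ : Fin m → Eucl d × Eucl d → ℝ} {ψ : Eucl d × Eucl d → ℝ}
    {u v : Eucl d} {ρ₀ M L : ℝ} {D : Eucl d × Eucl d →L[ℝ] (Fin m → ℝ)}
    {Rx Ry : (Fin m → ℝ) →L[ℝ] Eucl d} (hB : IsBoundedNear φ ψ u v ρ₀ M D)
    (hR : HasRightInverses D L Rx Ry) (hM : 0 ≤ M) {r ρ g : ℝ} (t : Fin m → ℝ) {x w h : Eucl d}
    (hr0 : 0 ≤ r) (hr : r ≤ ρ₀) (hw : ‖w‖ ≤ g) (hh : ‖h‖ ≤ g) (hD : D (w, h) = 0)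
    (hx : ‖x - u‖ ≤ r) (hxw : ‖x + w - u‖ ≤ r)
    (hy : ∀ y ∈ Metric.closedBall v ρ, ‖y - v‖ ≤ r)
    (hyh : ∀ y ∈ Metric.closedBall v ρ, ‖y + h - v‖ ≤ r) :
    AreCloseLevels (D.comp (ContinuousLinearMap.inr ℝ _ _)) Ry L (M * r) M (M * g) (M * r * g)
      ρ v (fun y => jointMap φ (x, y) - t) (fun y => jointMap φ (x + w, y + h) - t) := by
  have mem1 : ∀ y ∈ Metric.closedBall v ρ, (x, y) ∈ Metric.closedBall (u, v) r :=
    fun y hy' => mem_closedBall_prod hx (hy y hy')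
  have mem2 : ∀ y ∈ Metric.closedBall v ρ, (x + w, y + h) ∈ Metric.closedBall (u, v) r :=
    fun y hy' => mem_closedBall_prod hxw (hyh y hy')
  have sub := Metric.closedBall_subset_closedBall (x := (u, v)) hr
  have hwh : ‖(w, h)‖ ≤ g := norm_pair_le hw hh
  refine ⟨fun y => by simpa using hR.right_eq y, hR.right_le, ?_, ?_, ?_, ?_, ?_, ?_⟩
  · intro y hy y' hy'
    simpa using hB.lin _ hr _ (mem1 y hy) _ (mem1 y' hy')
  · intro y hy y' hy'
    simpa using hB.lin _ hr _ (mem2 y hy) _ (mem2 y' hy')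
  · intro y hy y' hy' e he he'
    have := hB.second _ (sub (mem1 y hy)) _ (sub (mem1 y' hy')) (0, e)
      (by simpa using sub (mem1 _ he)) (by simpa using sub (mem1 _ he'))
    simpa using this
  · intro y hy y' hy' e he he'
    have := hB.second _ (sub (mem2 y hy)) _ (sub (mem2 y' hy')) (0, e)
      (by simpa [add_right_comm] using sub (mem2 _ he))
      (by simpa [add_right_comm] using sub (mem2 _ he'))
    simpa [add_right_comm] using this
  · intro y hy
    have := hB.lin _ hr _ (mem2 y hy) _ (mem1 y hy)
    rw [Prod.mk_sub_mk, add_sub_cancel_left, add_sub_cancel_left, hD, sub_zero] at this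
    simp only [sub_sub_sub_cancel_right]
    refine this.trans ?_
    gcongr
  · intro y hy y' hy'
    have := hB.second _ (sub (mem1 y hy)) _ (sub (mem1 y' hy')) (w, h)
      (by simpa using sub (mem2 y hy)) (by simpa using sub (mem2 y' hy'))
    have e1 : jointMap φ (x + w, y + h) - t - (jointMap φ (x, y) - t) -
        (jointMap φ (x + w, y' + h) - t - (jointMap φ (x, y') - t)) = jointMap φ ((x, y) + (w, h)) -
        jointMap φ ((x, y') + (w, h)) - (jointMap φ (x, y) - jointMap φ (x, y')) := by
      simp only [Prod.mk_add_mk]; abel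
    rw [e1]
    refine this.trans ?_
    have e2 : ‖(x, y) - (x, y')‖ = ‖y - y'‖ := by simp [Prod.norm_def]
    rw [e2]
    gcongr

theorem realRadon_shift (φ : Fin m → Eucl d × Eucl d → ℝ) (ψ : Eucl d × Eucl d → ℝ)
    (t : Fin m → ℝ) (p : Eucl d → ℝ) (x h : Eucl d) :
    realRadon φ ψ t (fun y => p (y - h)) x =
      ∫ y in {y | jointMap φ (x, y + h) - t = 0}, p y * ψ (x, y + h)
        ∂(Measure.euclideanHausdorffMeasure (d - m)) := by
  have hmp := (IsometryEquiv.addRight h).measurePreserving_euclideanHausdorffMeasure (d - m)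
  have hemb : MeasurableEmbedding (IsometryEquiv.addRight h : Eucl d → Eucl d) :=
    (IsometryEquiv.addRight h).toHomeomorph.measurableEmbedding
  rw [realRadon, levelSet_eq, ← hmp.setIntegral_preimage_emb hemb]
  simp [Set.preimage]

/-- Lipschitz bound for the product of a mollifier and the cutoff. -/
theorem abs_mul_cutoff_sub_le {φ : Fin m → Eucl d × Eucl d → ℝ} {ψ : Eucl d × Eucl d → ℝ}
    {u v : Eucl d} {ρ₀ M : ℝ} {D : Eucl d × Eucl d →L[ℝ] (Fin m → ℝ)}
    (hB : IsBoundedNear φ ψ u v ρ₀ M D) (hM : 0 ≤ M) {r P P₁ : ℝ} {x : Eucl d} {p : Eucl d → ℝ}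
    (hx : ‖x - u‖ ≤ ρ₀) (hr : ∀ y ∈ Metric.closedBall v r, ‖y - v‖ ≤ ρ₀) (hP : ∀ y, |p y| ≤ P)
    (hlip : ∀ y y', |p y - p y'| ≤ P₁ * ‖y - y'‖)
    (hp : ∀ y, y ∉ Metric.closedBall v r → p y = 0) (y y' : Eucl d) :
    |p y * ψ (x, y) - p y' * ψ (x, y')| ≤ (P₁ * M + P * M) * ‖y - y'‖ := by
  have hP0 : 0 ≤ P := (abs_nonneg _).trans (hP v)
  have mem : ∀ y ∈ Metric.closedBall v r, (x, y) ∈ Metric.closedBall (u, v) ρ₀ := fun y hy =>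
    mem_closedBall_prod hx (hr y hy)
  -- The cutoff is controlled only near `(u, v)`, whereas the bound is wanted for all points. If
  -- `y'` lies outside the support, then `|p y| = |p y - p y'|` already carries the factor `‖y -
  -- y'‖`.
  have half : ∀ y y', y' ∉ Metric.closedBall v r →
      |p y * ψ (x, y) - p y' * ψ (x, y')| ≤ (P₁ * M + P * M) * ‖y - y'‖ := by
    intro y y' hy'
    rw [hp y' hy', zero_mul, sub_zero]
    by_cases hy : y ∈ Metric.closedBall v r
    · have h1 := hlip y y'
      rw [hp y' hy', sub_zero] at h1
      rw [abs_mul]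
      calc _ ≤ (P₁ * ‖y - y'‖) * M :=
            mul_le_mul h1 (hB.cutoff_le _ (mem y hy)) (abs_nonneg _) ((abs_nonneg _).trans h1)
        _ ≤ (P₁ * ‖y - y'‖) * M + P * M * ‖y - y'‖ := le_add_of_nonneg_right (by positivity)
        _ = _ := by ring
    · rw [hp y hy, zero_mul, abs_zero]
      have h1 := (abs_nonneg _).trans (hlip y y')
      have : 0 ≤ (P₁ * ‖y - y'‖) * M + P * M * ‖y - y'‖ := by positivity
      linarith
  by_cases hy : y ∈ Metric.closedBall v r
  · by_cases hy' : y' ∈ Metric.closedBall v r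
    · have e : p y * ψ (x, y) - p y' * ψ (x, y') =
          (p y - p y') * ψ (x, y) + p y' * (ψ (x, y) - ψ (x, y')) := by ring
      rw [e]
      refine (abs_add_le _ _).trans ?_
      rw [abs_mul, abs_mul, add_mul]
      have h1 := hlip y y'
      have h2 := hB.cutoff_lip _ (mem y hy) _ (mem y' hy')
      have e2 : ‖(x, y) - (x, y')‖ = ‖y - y'‖ := by simp [Prod.norm_def]
      rw [e2] at h2
      refine add_le_add ?_ ?_
      · calc _ ≤ (P₁ * ‖y - y'‖) * M :=
            mul_le_mul h1 (hB.cutoff_le _ (mem y hy)) (abs_nonneg _) ((abs_nonneg _).trans h1)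
          _ = _ := by ring
      · calc _ ≤ P * (M * ‖y - y'‖) := mul_le_mul (hP y') h2 (abs_nonneg _) hP0
          _ = _ := by ring
    · exact half y y' hy'
  · rw [abs_sub_comm, norm_sub_rev]
    exact half y' y hy

/-- Translating the variables `x` and `y` simultaneously, in a direction that is annihilated by the
derivative, changes the Radon transform of a mollifier only a little. -/
theorem abs_realRadon_shift_sub_le {φ : Fin m → Eucl d × Eucl d → ℝ} {ψ : Eucl d × Eucl d → ℝ}
    {u v : Eucl d} {ρ₀ M L : ℝ} {D : Eucl d × Eucl d →L[ℝ] (Fin m → ℝ)}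
    {Rx Ry : (Fin m → ℝ) →L[ℝ] Eucl d} (hB : IsBoundedNear φ ψ u v ρ₀ M D)
    (hR : HasRightInverses D L Rx Ry) (hM : 0 ≤ M) (hL : 0 ≤ L) (hφ : ∀ l, Continuous (φ l))
    (hψ : Continuous ψ) (hψ0 : ∀ p ∈ Metric.closedBall (u, v) ρ₀, 0 ≤ ψ p)
    {r ρ ρ' g P P₁ σ : ℝ} {t : Fin m → ℝ}
    {x w h : Eucl d} {p : Eucl d → ℝ}
    (hr0 : 0 ≤ r) (hr : r ≤ ρ₀) (hg : 0 ≤ g) (hw : ‖w‖ ≤ g) (hh : ‖h‖ ≤ g) (hD : D (w, h) = 0)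
    (hx : ‖x - u‖ ≤ r) (hxw : ‖x + w - u‖ ≤ r)
    (hy : ∀ y ∈ Metric.closedBall v ρ, ‖y - v‖ ≤ r)
    (hyh : ∀ y ∈ Metric.closedBall v ρ, ‖y + h - v‖ ≤ r)
    (hpc : Continuous p) (hp0 : ∀ y, 0 ≤ p y) (hP : ∀ y, p y ≤ P) (hP₁ : 0 ≤ P₁)
    (hlip : ∀ y y', |p y - p y'| ≤ P₁ * ‖y - y'‖)
    (hp : ∀ y, y ∉ Metric.closedBall v ρ' → p y = 0) (hσ0 : 0 ≤ σ)
    (hσ : ∀ a : Eucl d → Fin m → ℝ, (∀ y ∈ Metric.closedBall v ρ, ∀ y' ∈ Metric.closedBall v ρ,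
        ‖a y - a y' - D.comp (ContinuousLinearMap.inr ℝ _ _) (y - y')‖ ≤ M * r * ‖y - y'‖) →
      Measure.euclideanHausdorffMeasure (d - m) ({y | a y = 0} ∩ Metric.closedBall v ρ) ≤
        ENNReal.ofReal σ)
    (hη : L * (M * r) ≤ 1 / 2) (hρ : ρ' + 2 * L * (M * r * g) ≤ ρ)
    (hsmall : 2 * L * (M * g + 2 * L * M * (M * r * g)) ≤ 1 / 2) :
    |realRadon φ ψ t (fun y => p (y - h)) (x + w) - realRadon φ ψ t p x| ≤
      3 ^ (d - m) * (4 * L * (M * g + 2 * L * M * (M * r * g)) * (P * M) +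
        2 * L * (M * r * g) * (P₁ * M + P * M)) * σ + P * (M * g) * σ := by
  have hclose := areCloseLevels_shift hB hR hM t hr0 hr hw hh hD hx hxw hy hyh
  have hP0 : 0 ≤ P := (hp0 v).trans (hP v)
  have hPabs : ∀ y, |p y| ≤ P := fun y => by rw [abs_of_nonneg (hp0 y)]; exact hP y
  have hρ'ρ : ρ' ≤ ρ := by
    have : 0 ≤ 2 * L * (M * r * g) := by positivity
    linarith
  have hpρ : ∀ y, y ∉ Metric.closedBall v ρ → p y = 0 := fun y hy' =>
    hp y fun h' => hy' (Metric.closedBall_subset_closedBall hρ'ρ h')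
  have hyρ₀ : ∀ y ∈ Metric.closedBall v ρ, (x, y) ∈ Metric.closedBall (u, v) ρ₀ := fun y hy' =>
    mem_closedBall_prod (hx.trans hr) ((hy y hy').trans hr)
  have hyhρ₀ : ∀ y ∈ Metric.closedBall v ρ, (x + w, y + h) ∈ Metric.closedBall (u, v) ρ₀ :=
    fun y hy' => mem_closedBall_prod (hxw.trans hr) ((hyh y hy').trans hr)
  have hac : Continuous fun y => jointMap φ (x, y) - t :=
    ((continuous_jointMap hφ).comp (by fun_prop)).sub continuous_const
  have hbc : Continuous fun y => jointMap φ (x + w, y + h) - t :=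
    ((continuous_jointMap hφ).comp (by fun_prop)).sub continuous_const
  have hσb := hσ _ hclose.lin_right
  set S := {y | jointMap φ (x + w, y + h) - t = 0} with hS
  have hmS : MeasurableSet S := (isClosed_eq hbc continuous_const).measurableSet
  set F : Eucl d → ℝ := fun y => p y * ψ (x, y) with hF
  set F' : Eucl d → ℝ := fun y => p y * ψ (x + w, y + h) with hF'
  have hFc : Continuous F := hpc.mul (hψ.comp (by fun_prop))
  have hFc' : Continuous F' := hpc.mul (hψ.comp (by fun_prop))
  have hlipF : ∀ y y', |F y - F y'| ≤ (P₁ * M + P * M) * ‖y - y'‖ :=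
    abs_mul_cutoff_sub_le hB hM (hx.trans hr) (fun y hy' => (hy y hy').trans hr) hPabs hlip hpρ
  -- Here the integrand stays fixed and the level set changes; the change of the cutoff along the
  -- shifted level set is the separate term `P * (M * g) * σ`.
  have main := abs_setIntegral_level_sub_le (F := F) (F₀ := P * M) (F₁ := P₁ * M + P * M)
    hclose hac hbc hL hM (by positivity) (by positivity) hη hρ hsmall hσ0
    (hσ _ hclose.lin_left) hσb ?_ ?_ (by positivity) hlipF hFc ?_
  · have hfin : Measure.euclideanHausdorffMeasure (d - m) (S ∩ Metric.closedBall v ρ) ≠ ⊤ :=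
      (hσb.trans_lt ENNReal.ofReal_lt_top).ne
    have i1 : IntegrableOn F S (Measure.euclideanHausdorffMeasure (d - m)) :=
      integrableOn_of_continuous_of_eq_zero hmS (isCompact_closedBall v ρ) hfin hFc
        fun y hy' => by simp only [hF, hpρ y hy', zero_mul]
    have i2 : IntegrableOn F' S (Measure.euclideanHausdorffMeasure (d - m)) :=
      integrableOn_of_continuous_of_eq_zero hmS (isCompact_closedBall v ρ) hfin hFc'
        fun y hy' => by simp only [hF', hpρ y hy', zero_mul]
    have e1 : realRadon φ ψ t (fun y => p (y - h)) (x + w) =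
        ∫ y in S, F' y ∂(Measure.euclideanHausdorffMeasure (d - m)) := realRadon_shift φ ψ t p _ h
    have e2 : realRadon φ ψ t p x = ∫ y in {y | jointMap φ (x, y) - t = 0}, F y
        ∂(Measure.euclideanHausdorffMeasure (d - m)) := by rw [realRadon, levelSet_eq]
    have hdiff : |∫ y in S, F' y ∂(Measure.euclideanHausdorffMeasure (d - m)) -
        ∫ y in S, F y ∂(Measure.euclideanHausdorffMeasure (d - m))| ≤ P * (M * g) * σ := by
      rw [← integral_sub i2 i1, ← Real.norm_eq_abs]
      rw [setIntegral_eq_of_subset_of_forall_sdiff_eq_zero hmS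
        (Set.inter_subset_left (t := Metric.closedBall v ρ)) fun y hy' => by
          simp only [hF, hF', hpρ y fun h' => hy'.2 ⟨hy'.1, h'⟩, zero_mul, sub_zero]]
      refine (norm_setIntegral_le_of_norm_le_const hfin.lt_top (C := P * (M * g)) ?_).trans ?_
      · intro y hy'
        have h1 := hB.cutoff_lip _ (hyhρ₀ y hy'.2) _ (hyρ₀ y hy'.2)
        rw [Prod.mk_sub_mk, add_sub_cancel_left, add_sub_cancel_left] at h1
        simp only [hF, hF']
        rw [← mul_sub, norm_mul]
        refine mul_le_mul (hPabs y) (h1.trans ?_) (norm_nonneg _) hP0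
        gcongr
        exact norm_pair_le hw hh
      · gcongr
        exact ENNReal.toReal_le_of_le_ofReal hσ0 hσb
    rw [e1, e2]
    rw [abs_sub_comm] at main
    refine (abs_sub_le _ (∫ y in S, F y ∂(Measure.euclideanHausdorffMeasure (d - m))) _).trans ?_
    linarith
  · intro y
    by_cases hy' : y ∈ Metric.closedBall v ρ
    · exact mul_nonneg (hp0 y) (hψ0 _ (hyρ₀ y hy'))
    · simp [hF, hpρ y hy']
  · intro y
    by_cases hy' : y ∈ Metric.closedBall v ρ
    · exact mul_le_mul (hP y) ((le_abs_self _).trans (hB.cutoff_le _ (hyρ₀ y hy')))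
        (hψ0 _ (hyρ₀ y hy')) hP0
    · simp only [hF, hpρ y hy', zero_mul]; positivity
  · intro y hy'
    simp [hF, hp y hy']

end RadonLocal

/-! ### Almost invariance under translations -/

section RadonTranslate

variable {d m : ℕ}

-- All points lie within `O(ε)` of `(u, v)` and the shift has size `O(δ)` in the kernel of `D`. So
-- `Φ` changes by `O(εδ)`, and its increments change by a factor `O(δ)`. The level set moves by
-- `O(εδ)` while the mollifier varies on scale `δ`: a relative error `O(ε)`. The area distortion and
-- the change of the cutoff are `O(δ)`, hence also `O(ε)`. The transform itself has the size of the
-- area `δ^(d-m)` times the height `δ^(-d)`.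
set_option maxHeartbeats 1000000 in
theorem exists_abs_realRadon_translate_sub_le (d m : ℕ) {ρ₀ M L G : ℝ} (hρ₀ : 0 < ρ₀) (hM : 1 ≤ M)
    (hL : 1 ≤ L) (hG : 1 ≤ G) : ∃ C r₀ : ℝ, 0 ≤ C ∧ 0 < r₀ ∧
    ∀ (φ : Fin m → Eucl d × Eucl d → ℝ) (ψ : Eucl d × Eucl d → ℝ) (u v : Eucl d)
      (D : Eucl d × Eucl d →L[ℝ] (Fin m → ℝ)) (Rx Ry : (Fin m → ℝ) →L[ℝ] Eucl d) (t : Fin m → ℝ),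
      (∀ l, Continuous (φ l)) → Continuous ψ →
      IsBoundedNear φ ψ u v ρ₀ M D → HasRightInverses D L Rx Ry →
      (∀ p ∈ Metric.closedBall (u, v) ρ₀, 0 ≤ ψ p) →
      ∀ (δ ε : ℝ) (p : Eucl d → ℝ) (w h x : Eucl d), 0 < δ → δ ≤ ε → ε ≤ r₀ → KernelBound p G δ →
      (∀ y, 0 ≤ p y) → ‖w‖ ≤ L * M * G * δ → ‖h‖ ≤ G * δ → D (w, h) = 0 →
      ‖x - u‖ ≤ (G + L * M * G) * ε →
      |realRadon φ ψ t (fun y => p (y - (v + h))) (x + w) -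
          realRadon φ ψ t (fun y => p (y - v)) x| ≤ C * ε * (δ ^ (d - m) / δ ^ d) ∧
      |realRadon φ ψ t (fun y => p (y - v)) x| ≤ C * (δ ^ (d - m) / δ ^ d) := by
  obtain ⟨Cσ, hCσ, hσ⟩ := exists_euclideanHausdorffMeasure_level_le d m
  obtain ⟨W, hW⟩ : ∃ W, W = L * M * G := ⟨_, rfl⟩
  have hLM : 1 ≤ L * M := one_le_mul_of_one_le_of_one_le hL hM
  have hW1 : 1 ≤ W := by rw [hW]; exact one_le_mul_of_one_le_of_one_le hLM hG
  have hGW : G ≤ W := by rw [hW]; exact le_mul_of_one_le_left (by positivity) hLM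
  obtain ⟨K₀, hK₀⟩ : ∃ K₀, K₀ = G + 2 * L := ⟨_, rfl⟩
  obtain ⟨K, hK⟩ : ∃ K, K = 2 * G + 2 * W + 2 * L := ⟨_, rfl⟩
  have hK1 : 1 ≤ K := by rw [hK]; linarith
  have hK₀1 : 1 ≤ K₀ := by rw [hK₀]; linarith
  obtain ⟨B, hBdef⟩ : ∃ B, B = M * K * W := ⟨_, rfl⟩
  have hB1 : 1 ≤ B := by
    rw [hBdef]
    exact one_le_mul_of_one_le_of_one_le (one_le_mul_of_one_le_of_one_le hM hK1) hW1
  obtain ⟨Q, hQ⟩ : ∃ Q, Q = 2 * L * (M * W + 2 * L * M) := ⟨_, rfl⟩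
  have hQ0 : 0 < Q := by rw [hQ]; positivity
  obtain ⟨Cs, hCs⟩ : ∃ Cs, Cs = Cσ * K₀ ^ (d - m) := ⟨_, rfl⟩
  have hCs0 : 0 ≤ Cs := by rw [hCs]; positivity
  obtain ⟨C₁, hC₁⟩ : ∃ C₁, C₁ = 3 ^ (d - m) * (2 * Q * (G * M) + 4 * L * B * (G * M)) * Cs +
    G * (M * W) * Cs := ⟨_, rfl⟩
  have hC₁0 : 0 ≤ C₁ := by rw [hC₁]; positivity
  obtain ⟨C₂, hC₂⟩ : ∃ C₂, C₂ = G * M * Cs := ⟨_, rfl⟩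
  have hC₂0 : 0 ≤ C₂ := by rw [hC₂]; positivity
  -- The four thresholds keep all points in the ball where the bounds hold, make the distortion at
  -- most one half, make the change of `Φ` at most `δ`, and keep the linearization good enough for
  -- straightening.
  refine ⟨C₁ + C₂, min (ρ₀ / K) (min (1 / (2 * Q)) (min (1 / B) (1 / (2 * L * M * K)))),
    by positivity, by positivity, ?_⟩
  intro φ ψ u v D Rx Ry t hφ hψ hB hR hψ0 δ ε p w h x hδ hδε hε hp hp0 hw hh hD hx
  rw [← hW] at hw hx
  have hε0 : 0 < ε := hδ.trans_le hδε
  have b1 : K * ε ≤ ρ₀ := by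
    rw [← le_div_iff₀' (by positivity)]; exact hε.trans (min_le_left _ _)
  have b2 : Q * ε ≤ 1 / 2 := by
    have : ε ≤ 1 / (2 * Q) := hε.trans ((min_le_right _ _).trans (min_le_left _ _))
    rw [le_div_iff₀' (by positivity)] at this
    linarith
  have b3 : B * ε ≤ 1 := by
    rw [← le_div_iff₀' (by positivity)]
    exact hε.trans ((min_le_right _ _).trans ((min_le_right _ _).trans (min_le_left _ _)))
  have b4 : L * (M * (K * ε)) ≤ 1 / 2 := by
    have : ε ≤ 1 / (2 * L * M * K) :=
      hε.trans ((min_le_right _ _).trans ((min_le_right _ _).trans (min_le_right _ _)))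
    rw [le_div_iff₀' (by positivity)] at this
    linarith
  clear hε
  have hε1 : ε ≤ 1 := by nlinarith
  have hGδ : G * δ ≤ G * ε := by gcongr
  have hWδ : W * δ ≤ W * ε := by gcongr
  have hLδ : L * δ ≤ L * ε := by gcongr
  have hGδW : G * δ ≤ W * δ := by gcongr
  have hKε : K * ε = 2 * (G * ε) + 2 * (W * ε) + 2 * (L * ε) := by rw [hK]; ring
  have hK₀δ : K₀ * δ = G * δ + 2 * (L * δ) := by rw [hK₀]; ring
  have hGε : 0 ≤ G * ε := by positivity
  have hWε : 0 ≤ W * ε := by positivity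
  have hLε : 0 ≤ L * ε := by positivity
  have hLδ0 : 0 ≤ L * δ := by positivity
  have hx1 : ‖x - u‖ ≤ K * ε := by rw [hKε]; linarith
  have hxw : ‖x + w - u‖ ≤ K * ε := by
    have := norm_add_le (x - u) w
    rw [show x - u + w = x + w - u by abel] at this
    rw [hKε]; linarith
  have hy1 : ∀ y ∈ Metric.closedBall v (K₀ * δ), ‖y - v‖ ≤ K * ε := by
    intro y hy
    rw [mem_closedBall_iff_norm, hK₀δ] at hy
    rw [hKε]; linarith
  have hyh : ∀ y ∈ Metric.closedBall v (K₀ * δ), ‖y + h - v‖ ≤ K * ε := by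
    intro y hy
    rw [mem_closedBall_iff_norm, hK₀δ] at hy
    have := norm_add_le (y - v) h
    rw [show y - v + h = y + h - v by abel] at this
    rw [hKε]; linarith
  have hσ' : ∀ a : Eucl d → Fin m → ℝ, (∀ y ∈ Metric.closedBall v (K₀ * δ),
      ∀ y' ∈ Metric.closedBall v (K₀ * δ),
        ‖a y - a y' - D.comp (ContinuousLinearMap.inr ℝ _ _) (y - y')‖ ≤
          M * (K * ε) * ‖y - y'‖) →
      Measure.euclideanHausdorffMeasure (d - m) ({y | a y = 0} ∩ Metric.closedBall v (K₀ * δ)) ≤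
        ENNReal.ofReal (Cs * δ ^ (d - m)) := by
    intro a ha
    have := hσ (D.comp (ContinuousLinearMap.inr ℝ _ _)) Ry L (M * (K * ε)) a v (K₀ * δ)
      (by positivity) (fun y => by simpa using hR.right_eq y) hR.right_le b4 (by positivity) ha
    rwa [mul_pow, ← mul_assoc, ← hCs] at this
  have hsupp : ∀ y, y ∉ Metric.closedBall v (G * δ) → p (y - v) = 0 := fun y hy =>
    hp.supp _ (by rwa [mem_closedBall_iff_norm, not_le] at hy)
  have hMrg : M * (K * ε) * (W * δ) = B * ε * δ := by rw [hBdef]; ring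
  have hMrg1 : M * (K * ε) * (W * δ) ≤ δ := by
    rw [hMrg]; exact mul_le_of_le_one_left hδ.le b3
  have hkey : 2 * L * (M * (W * δ) + 2 * L * M * (M * (K * ε) * (W * δ))) ≤ Q * δ := by
    calc _ ≤ 2 * L * (M * (W * δ) + 2 * L * M * δ) := by gcongr
      _ = _ := by rw [hQ]; ring
  have hQδ : Q * δ ≤ Q * ε := by gcongr
  have hP : ∀ y, |p (y - v)| ≤ G / δ ^ d := fun y => hp.bound _
  refine ⟨?_, ?_⟩
  · have main := abs_realRadon_shift_sub_le (t := t) (p := fun y => p (y - v)) (ρ := K₀ * δ)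
      (ρ' := G * δ) (g := W * δ) (P := G / δ ^ d) (P₁ := G / δ ^ (d + 1)) (σ := Cs * δ ^ (d - m))
      hB hR (by positivity) (by positivity) hφ hψ hψ0 (by positivity) b1 (by positivity) hw
      (hh.trans hGδW) hD hx1 hxw hy1 hyh (hp.continuous.comp (by fun_prop)) (fun y => hp0 _)
      (fun y => (le_abs_self _).trans (hP y)) (by positivity)
      (fun y y' => by simpa using hp.lip (y - v) (y' - v)) hsupp (by positivity) hσ' b4
      (by rw [hK₀δ]; linarith [mul_le_mul_of_nonneg_left hMrg1 (by positivity : 0 ≤ 2 * L)])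
      (by linarith)
    have e1 : (fun y => p (y - (v + h))) = fun y => p (y - h - v) := by
      ext y; rw [sub_sub, add_comm v h]
    rw [e1]
    refine main.trans ?_
    have hδ1 : δ ≤ 1 := hδε.trans hε1
    -- Since `δ ≤ 1`, the Lipschitz constant coming from the cutoff is dominated by the one coming
    -- from the mollifier.
    have hPP : G / δ ^ d ≤ G / δ ^ (d + 1) := by
      exact div_le_div_of_nonneg_left (by positivity) (by positivity)
        (pow_le_pow_of_le_one hδ.le hδ1 (Nat.le_succ d))
    have hkey' : 4 * L * (M * (W * δ) + 2 * L * M * (B * ε * δ)) ≤ 2 * (Q * δ) := by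
      rw [hMrg] at hkey; linarith
    calc _ ≤ 3 ^ (d - m) * (2 * (Q * δ) * (G / δ ^ d * M) +
          2 * L * (B * ε * δ) * (G / δ ^ (d + 1) * M + G / δ ^ (d + 1) * M)) * (Cs * δ ^ (d - m)) +
          G / δ ^ d * (M * (W * δ)) * (Cs * δ ^ (d - m)) := by
          rw [hMrg]
          gcongr
      _ = 3 ^ (d - m) * (2 * (Q * δ) * (G / δ ^ d * M) +
          4 * L * (B * ε) * (G / δ ^ d * M)) * (Cs * δ ^ (d - m)) +
          G / δ ^ d * (M * (W * δ)) * (Cs * δ ^ (d - m)) := by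
          congr 3
          rw [pow_succ]
          field_simp
          ring
      _ ≤ 3 ^ (d - m) * (2 * (Q * ε) * (G / δ ^ d * M) +
          4 * L * (B * ε) * (G / δ ^ d * M)) * (Cs * δ ^ (d - m)) +
          G / δ ^ d * (M * (W * ε)) * (Cs * δ ^ (d - m)) := by gcongr
      _ = C₁ * ε * (δ ^ (d - m) / δ ^ d) := by rw [hC₁]; ring
      _ ≤ _ := by gcongr; linarith
  · refine (abs_realRadon_le hB hφ (t := t) (r := K₀ * δ) (P := G / δ ^ d)
      (σ := Cs * δ ^ (d - m)) (p := fun y => p (y - v)) (hx1.trans b1) ?_ (by positivity) hP ?_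
      (by positivity) (hσ' _ ?_)).trans ?_
    · rw [hK₀δ]; linarith
    · intro y hy
      exact hsupp y fun hy' => hy (Metric.closedBall_subset_closedBall (by rw [hK₀δ]; linarith) hy')
    · intro y hy y' hy'
      simpa using hB.lin _ b1 _ (mem_closedBall_prod hx1 (hy1 y hy)) _
        (mem_closedBall_prod hx1 (hy1 y' hy'))
    · calc _ = C₂ * (δ ^ (d - m) / δ ^ d) := by rw [hC₂]; ring
        _ ≤ _ := by gcongr; linarith

theorem exists_mem_of_realRadon_ne_zero {φ : Fin m → Eucl d × Eucl d → ℝ}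
    {ψ : Eucl d × Eucl d → ℝ} {t : Fin m → ℝ} {G δ : ℝ} {x w : Eucl d} {p : Eucl d → ℝ}
    (hp : KernelBound p G δ) (h : realRadon φ ψ t (fun y => p (y - w)) x ≠ 0) :
    ∃ y, ‖y - w‖ ≤ G * δ ∧ jointMap φ (x, y) = t := by
  by_contra! H
  refine h (realRadon_eq_zero (w := w) (r := G * δ) ?_ ?_)
  · intro y hy
    exact hp.supp _ (by rwa [mem_closedBall_iff_norm, not_le] at hy)
  · intro y hy
    exact H y (mem_closedBall_iff_norm.1 hy)

/-- The pairing of two mollifiers vanishes if they are centred away from the level set. -/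
theorem realRadon_mul_eq_zero {φ : Fin m → Eucl d × Eucl d → ℝ} {ψ : Eucl d × Eucl d → ℝ}
    {u v : Eucl d} {ρ₀ M G δ ε : ℝ} {D : Eucl d × Eucl d →L[ℝ] (Fin m → ℝ)}
    (hB : IsBoundedNear φ ψ u v ρ₀ M D) (hM : 0 ≤ M) (hG : 0 ≤ G) {t : Fin m → ℝ}
    {p q : Eucl d → ℝ} {h : Eucl d} (hδε : δ ≤ ε) (hε0 : 0 ≤ ε) (hε : 2 * G * ε ≤ ρ₀)
    (hp : KernelBound p G δ) (hq : KernelBound q G ε) (hh : ‖h‖ ≤ G * δ)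
    (hfar : 2 * M * G * ε < ‖jointMap φ (u, v) - t‖) (x : Eucl d) :
    realRadon φ ψ t (fun y => p (y - (v + h))) x * q (x - u) = 0 := by
  by_contra hne
  rw [mul_eq_zero, not_or] at hne
  obtain ⟨y, hy, hyt⟩ := exists_mem_of_realRadon_ne_zero hp hne.1
  have hx : ‖x - u‖ ≤ G * ε := by
    by_contra! hx
    exact hne.2 (hq.supp _ hx)
  have hGδ : G * δ ≤ G * ε := by gcongr
  have hGε : 0 ≤ G * ε := by positivity
  have hyv : ‖y - v‖ ≤ 2 * G * ε := by
    have := norm_add_le (y - (v + h)) h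
    rw [show y - (v + h) + h = y - v by abel] at this
    linarith
  have h1 := hB.lip (u, v) (Metric.mem_closedBall_self (le_trans (by positivity) hε)) (x, y)
    (mem_closedBall_prod (by linarith) (by linarith))
  rw [hyt, Prod.mk_sub_mk] at h1
  have h2 : ‖(u - x, v - y)‖ ≤ 2 * G * ε :=
    norm_pair_le (by rw [norm_sub_rev]; linarith) (by rwa [norm_sub_rev])
  have h3 : M * ‖(u - x, v - y)‖ ≤ M * (2 * G * ε) := by gcongr
  linarith

set_option maxHeartbeats 1000000 in
/-- The pairing of the Radon transform of a mollifier at scale `δ` with a mollifier at scale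
`ε ≥ δ` is almost invariant under translations of size `δ` of the first one. -/
theorem exists_abs_integral_translate_sub_le (d m : ℕ) {ρ₀ M L G : ℝ} (hρ₀ : 0 < ρ₀) (hM : 1 ≤ M)
    (hL : 1 ≤ L) (hG : 1 ≤ G) : ∃ C r₀ : ℝ, 0 ≤ C ∧ 0 < r₀ ∧
    ∀ (φ : Fin m → Eucl d × Eucl d → ℝ) (ψ : Eucl d × Eucl d → ℝ) (u v : Eucl d)
      (D : Eucl d × Eucl d →L[ℝ] (Fin m → ℝ)) (Rx Ry : (Fin m → ℝ) →L[ℝ] Eucl d) (t : Fin m → ℝ),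
      (∀ l, Continuous (φ l)) → Continuous ψ →
      IsBoundedNear φ ψ u v ρ₀ M D → HasRightInverses D L Rx Ry →
      (∀ p ∈ Metric.closedBall (u, v) ρ₀, 0 ≤ ψ p) →
      ∀ (δ ε : ℝ) (p q : Eucl d → ℝ) (h : Eucl d), 0 < δ → δ ≤ ε → ε ≤ r₀ → KernelBound p G δ →
      KernelBound q G ε → (∀ y, 0 ≤ p y) → ‖h‖ ≤ G * δ →
      Integrable (fun x => realRadon φ ψ t (fun y => p (y - (v + h))) x * q (x - u)) →
      Integrable (fun x => realRadon φ ψ t (fun y => p (y - v)) x * q (x - u)) →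
      |(∫ x, realRadon φ ψ t (fun y => p (y - (v + h))) x * q (x - u)) -
        ∫ x, realRadon φ ψ t (fun y => p (y - v)) x * q (x - u)| ≤ C * (δ / ε + ε) / ε ^ m := by
  obtain ⟨C₁, r₁, hC₁, hr₁, H⟩ := exists_abs_realRadon_translate_sub_le d m hρ₀ hM hL hG
  obtain ⟨W, hW⟩ : ∃ W, W = L * M * G := ⟨_, rfl⟩
  have hLM : 1 ≤ L * M := one_le_mul_of_one_le_of_one_le hL hM
  have hW1 : 1 ≤ W := by rw [hW]; exact one_le_mul_of_one_le_of_one_le hLM hG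
  obtain ⟨K, hK⟩ : ∃ K, K = 2 * G + W + L := ⟨_, rfl⟩
  have hK1 : 1 ≤ K := by rw [hK]; linarith
  obtain ⟨V, hV⟩ : ∃ V, V = 4 ^ m * (G + W + L) ^ d * volume.real (Metric.ball (0 : Eucl d) 1) :=
    ⟨_, rfl⟩
  have hV0 : 0 ≤ V := by rw [hV]; positivity
  obtain ⟨N, hN⟩ : ∃ N, N = M * (W + 2 * G) := ⟨_, rfl⟩
  have hN0 : 0 ≤ N := by rw [hN]; positivity
  refine ⟨C₁ * G * W * V * N ^ m, min r₁ (min (ρ₀ / K) (1 / (2 * L * M * K))), by positivity,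
    by positivity, ?_⟩
  intro φ ψ u v D Rx Ry t hφ hψ hB hR hψ0 δ ε p q h hδ hδε hε hp hq hp0 hh hi₁ hi₂
  have hε0 : 0 < ε := hδ.trans_le hδε
  have b0 : ε ≤ r₁ := hε.trans (min_le_left _ _)
  have b1 : K * ε ≤ ρ₀ := by
    rw [← le_div_iff₀' (by positivity)]
    exact hε.trans ((min_le_right _ _).trans (min_le_left _ _))
  have b4 : L * (M * (K * ε)) ≤ 1 / 2 := by
    have : ε ≤ 1 / (2 * L * M * K) := hε.trans ((min_le_right _ _).trans (min_le_right _ _))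
    rw [le_div_iff₀' (by positivity)] at this
    linarith
  clear hε
  -- The compensating shift of `x`, which puts `(w, h)` into the kernel of `D`.
  set w := - Rx (D (0, h)) with hw
  have hDw : D (w, h) = 0 := by
    have h1 : (w, h) = (0, h) - (Rx (D (0, h)), 0) := by simp [hw]
    rw [h1, map_sub, hR.left_eq, sub_self]
  have hwn : ‖w‖ ≤ W * δ := by
    rw [hw, norm_neg]
    have h0 : ‖((0 : Eucl d), h)‖ = ‖h‖ := by simp [Prod.norm_def]
    calc _ ≤ L * ‖D (0, h)‖ := hR.left_le _
      _ ≤ L * (M * ‖((0 : Eucl d), h)‖) := by gcongr; exact hB.norm_le _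
      _ ≤ L * (M * (G * δ)) := by rw [h0]; gcongr
      _ = _ := by rw [hW]; ring
  have hGδ : G * δ ≤ G * ε := by gcongr
  have hWδ : W * δ ≤ W * ε := by gcongr
  have hGε : 0 ≤ G * ε := by positivity
  have hWε : 0 ≤ W * ε := by positivity
  have hLε : 0 ≤ L * ε := by positivity
  have hKε : K * ε = 2 * (G * ε) + W * ε + L * ε := by rw [hK]; ring
  set f₁ : Eucl d → ℝ := fun x => realRadon φ ψ t (fun y => p (y - (v + h))) x * q (x - u) with hf₁
  set f₂ : Eucl d → ℝ := fun x => realRadon φ ψ t (fun y => p (y - v)) x * q (x - u) with hf₂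
  -- Both integrands, after the change of variable `x ↦ x + w` in one of them, vanish outside this
  -- slab, which has thickness `O(δ)` in `m` directions.
  set S := {x ∈ Metric.closedBall u ((G + W) * ε) | ‖jointMap φ (x, v) - t‖ ≤ N * δ} with hS
  have hshift : ∫ x, f₁ x = ∫ x, f₁ (x + w) := (integral_add_right_eq_self f₁ w).symm
  have hqx : ∀ x, q x ≠ 0 → ‖x‖ ≤ G * ε := fun x hx => by
    by_contra! h1
    exact hx (hq.supp _ h1)
  have hoff : ∀ x, x ∉ S → f₁ (x + w) - f₂ x = 0 := by
    intro x hx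
    have h2 : f₂ x = 0 := by
      by_contra hne
      rw [hf₂] at hne
      simp only [mul_eq_zero, not_or] at hne
      obtain ⟨y, hy, hyt⟩ := exists_mem_of_realRadon_ne_zero hp hne.1
      have hxu := hqx _ hne.2
      refine hx ⟨by rw [mem_closedBall_iff_norm]; linarith, ?_⟩
      have h1 := hB.lip (x, v) (mem_closedBall_prod (by linarith) (by simp; linarith)) (x, y)
        (mem_closedBall_prod (by linarith) (by linarith))
      rw [hyt, Prod.mk_sub_mk, sub_self] at h1
      have h3 : ‖((0 : Eucl d), v - y)‖ ≤ (W + 2 * G) * δ :=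
        norm_pair_le (by simp; positivity) (by rw [norm_sub_rev]; nlinarith)
      calc _ ≤ M * ‖((0 : Eucl d), v - y)‖ := h1
        _ ≤ M * ((W + 2 * G) * δ) := by gcongr
        _ = _ := by rw [hN]; ring
    have h1 : f₁ (x + w) = 0 := by
      by_contra hne
      rw [hf₁] at hne
      simp only [mul_eq_zero, not_or] at hne
      obtain ⟨y, hy, hyt⟩ := exists_mem_of_realRadon_ne_zero hp hne.1
      have hxwu := hqx _ hne.2
      have hxu : ‖x - u‖ ≤ (G + W) * ε := by
        have := norm_sub_le (x + w - u) w
        rw [show x + w - u - w = x - u by abel] at this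
        linarith
      have hyv : ‖y - v‖ ≤ 2 * (G * δ) := by
        have := norm_add_le (y - (v + h)) h
        rw [show y - (v + h) + h = y - v by abel] at this
        linarith
      refine hx ⟨by rwa [mem_closedBall_iff_norm], ?_⟩
      have h1 := hB.lip (x, v) (mem_closedBall_prod (by linarith) (by simp; linarith)) (x + w, y)
        (mem_closedBall_prod (by linarith) (by linarith))
      rw [hyt, Prod.mk_sub_mk, sub_add_cancel_left] at h1
      have h3 : ‖(-w, v - y)‖ ≤ (W + 2 * G) * δ :=
        norm_pair_le (by rw [norm_neg]; nlinarith) (by rw [norm_sub_rev]; nlinarith)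
      calc _ ≤ M * ‖(-w, v - y)‖ := h1
        _ ≤ M * ((W + 2 * G) * δ) := by gcongr
        _ = _ := by rw [hN]; ring
    rw [h1, h2, sub_zero]
  set X := δ ^ (d - m) / δ ^ d with hX
  have hX0 : 0 ≤ X := by positivity
  have hbound : ∀ x ∈ S, ‖f₁ (x + w) - f₂ x‖ ≤ C₁ * G * W * (δ / ε + ε) * X / ε ^ d := by
    intro x hx
    have hxu := mem_closedBall_iff_norm.1 hx.1
    obtain ⟨k1, k2⟩ := H φ ψ u v D Rx Ry t hφ hψ hB hR hψ0 δ ε p w h x hδ hδε b0 hp hp0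
      (by rwa [← hW]) hh hDw (by rwa [← hW])
    have k3 := hq.bound (x + w - u)
    have k4 := hq.lip (x + w - u) (x - u)
    rw [show x + w - u - (x - u) = w by abel] at k4
    -- The change of the transform has relative size `ε`; the change of the test mollifier under a
    -- shift of size `δ` has relative size `δ / ε`.
    have e : f₁ (x + w) - f₂ x = (realRadon φ ψ t (fun y => p (y - (v + h))) (x + w) -
        realRadon φ ψ t (fun y => p (y - v)) x) * q (x + w - u) +
        realRadon φ ψ t (fun y => p (y - v)) x * (q (x + w - u) - q (x - u)) := by
      simp only [hf₁, hf₂]; ring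
    rw [e, Real.norm_eq_abs]
    refine (abs_add_le _ _).trans ?_
    rw [abs_mul, abs_mul]
    calc _ ≤ (C₁ * ε * X) * (G / ε ^ d) + (C₁ * X) * (G / ε ^ (d + 1) * (W * δ)) := by
          gcongr
          exact k4.trans (by gcongr)
      _ = C₁ * G * 1 * ε * X / ε ^ d + C₁ * G * W * (δ / ε) * X / ε ^ d := by
          rw [pow_succ]; field_simp
      _ ≤ C₁ * G * W * ε * X / ε ^ d + C₁ * G * W * (δ / ε) * X / ε ^ d := by gcongr
      _ = _ := by ring
  have hvol : volume S ≤ ENNReal.ofReal (V * (ε ^ d * (N * δ / ε) ^ m)) := by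
    rw [hV]
    refine volume_slab_le (A := D.comp (ContinuousLinearMap.inl ℝ _ _)) (R := Rx) (L := L)
      (η := M * (K * ε)) (ρ := K * ε) (f := fun x => jointMap φ (x, v) - t)
      (((continuous_jointMap hφ).comp (by fun_prop)).sub continuous_const) (by positivity)
      (by positivity) hε0 (by positivity) (fun y => by simpa using hR.left_eq y) hR.left_le b4
      (by rw [hKε]; linarith) ?_
    intro y hy y' hy'
    rw [mem_closedBall_iff_norm] at hy hy'
    simpa using hB.lin _ b1 (y, v) (mem_closedBall_prod hy (by simp; positivity)) (y', v)
      (mem_closedBall_prod hy' (by simp; positivity))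
  have hmeas : MeasurableSet S :=
    (Metric.isClosed_closedBall.inter (isClosed_le
      (((continuous_jointMap hφ).comp (by fun_prop : Continuous fun x : Eucl d => (x, v))).sub
        continuous_const).norm continuous_const)).measurableSet
  have hmd : m ≤ d := le_of_rightInverse (A := D.comp (ContinuousLinearMap.inl ℝ _ _)) (R := Rx)
    (fun y => by simpa using hR.left_eq y)
  rw [hshift, ← integral_sub (hi₁.comp_add_right w) hi₂, ← Real.norm_eq_abs,
    ← setIntegral_eq_integral_of_forall_compl_eq_zero hoff]
  refine (norm_setIntegral_le_of_norm_le_const (hvol.trans_lt ENNReal.ofReal_lt_top) hbound).trans ?_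
  have hvol' : volume.real S ≤ V * (ε ^ d * (N * δ / ε) ^ m) :=
    ENNReal.toReal_le_of_le_ofReal (by positivity) hvol
  -- The transform contributes `δ^(-m)` and the slab `ε^d (δ/ε)^m`; the test mollifier cancels
  -- `ε^d`, so only `ε^(-m)` is left.
  calc _ ≤ C₁ * G * W * (δ / ε + ε) * X / ε ^ d * (V * (ε ^ d * (N * δ / ε) ^ m)) := by gcongr
    _ = _ := by
      rw [hX, div_pow, mul_pow]
      have : δ ^ d = δ ^ (d - m) * δ ^ m := by rw [← pow_add, Nat.sub_add_cancel hmd]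
      rw [this]
      field_simp

end RadonTranslate

/-! ### Lower bound for the pairing near the level set -/

section RadonLower

variable {d m : ℕ}

theorem realRadon_mul_nonneg {φ : Fin m → Eucl d × Eucl d → ℝ} {ψ : Eucl d × Eucl d → ℝ}
    {u v : Eucl d} {ρ₀ G δ ε : ℝ} (hψ0 : ∀ p ∈ Metric.closedBall (u, v) ρ₀, 0 ≤ ψ p)
    {t : Fin m → ℝ} {p q : Eucl d → ℝ} (hδ : G * δ ≤ ρ₀) (hε : G * ε ≤ ρ₀)
    (hp : KernelBound p G δ) (hq : KernelBound q G ε) (hp0 : ∀ y, 0 ≤ p y) (hq0 : ∀ y, 0 ≤ q y)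
    (x : Eucl d) : 0 ≤ realRadon φ ψ t (fun y => p (y - v)) x * q (x - u) := by
  by_cases hx : ‖x - u‖ ≤ G * ε
  · refine mul_nonneg (integral_nonneg fun y => ?_) (hq0 _)
    by_cases hy : ‖y - v‖ ≤ G * δ
    · exact mul_nonneg (hp0 _) (hψ0 _ (mem_closedBall_prod (hx.trans hε) (hy.trans hδ)))
    · simp [hp.supp _ (not_le.1 hy)]
  · rw [hq.supp _ (not_le.1 hx), mul_zero]

/-- Lower bound for the pairing of two mollifiers centred near the level set. -/
theorem exists_le_integral_realRadon_mul (d m : ℕ) {ρ₀ M L G c₁ : ℝ} (hρ₀ : 0 < ρ₀) (hM : 1 ≤ M)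
    (hL : 1 ≤ L) (hG : 1 ≤ G) (hc₁ : 0 < c₁) : ∃ c c₀ r₀ : ℝ, 0 < c ∧ 0 < c₀ ∧ 0 < r₀ ∧
    ∀ (φ : Fin m → Eucl d × Eucl d → ℝ) (ψ : Eucl d × Eucl d → ℝ) (u v : Eucl d)
      (D : Eucl d × Eucl d →L[ℝ] (Fin m → ℝ)) (Rx Ry : (Fin m → ℝ) →L[ℝ] Eucl d) (t : Fin m → ℝ),
      (∀ l, Continuous (φ l)) → Continuous ψ →
      IsBoundedNear φ ψ u v ρ₀ M D → HasRightInverses D L Rx Ry →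
      (∀ p ∈ Metric.closedBall (u, v) ρ₀, 1 / 2 ≤ ψ p) →
      ∀ (δ : ℝ) (p : Eucl d → ℝ), 0 < δ → δ ≤ r₀ → KernelBound p G δ →
      (∀ y, 0 ≤ p y) → (∀ y, ‖y‖ ≤ δ → c₁ / δ ^ d ≤ p y) → ‖jointMap φ (u, v) - t‖ ≤ c₀ * δ →
      Integrable (fun x => realRadon φ ψ t (fun y => p (y - v)) x * p (x - u)) →
      c / δ ^ m ≤ ∫ x, realRadon φ ψ t (fun y => p (y - v)) x * p (x - u) := by
  obtain ⟨Cσ, hCσ, hσ⟩ := exists_level_measure_le d m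
  obtain ⟨cσ, hcσ, hσ'⟩ := exists_le_euclideanHausdorffMeasure_level d m
  -- For `‖x - u‖ ≤ c₂ δ`, this choice and `c₀ = 1 / (8L)` bound `L * ‖Φ(x, v) - t‖` by `δ/8 + δ/8`,
  -- the `δ/4` needed for the lower bound on the area.
  obtain ⟨c₂, hc₂⟩ : ∃ c₂, c₂ = 1 / (8 * L * M) := ⟨_, rfl⟩
  have hc₂0 : 0 < c₂ := by rw [hc₂]; positivity
  have hLM : 1 ≤ L * M := one_le_mul_of_one_le_of_one_le hL hM
  have hc₂1 : c₂ ≤ 1 := by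
    rw [hc₂, div_le_one (by positivity)]; linarith
  obtain ⟨V, hV⟩ : ∃ V, V = volume.real (Metric.ball (0 : Eucl d) 1) := ⟨_, rfl⟩
  have hV0 : 0 < V := by
    rw [hV]
    exact ENNReal.toReal_pos (Metric.measure_ball_pos _ _ one_pos).ne' measure_ball_lt_top.ne
  refine ⟨c₁ * (1 / 2) * cσ * c₁ * (c₂ ^ d * V), 1 / (8 * L),
    min (ρ₀ / G) (1 / (2 * L * M * G)), by positivity, by positivity, by positivity, ?_⟩
  intro φ ψ u v D Rx Ry t hφ hψ hB hR hψ0 δ p hδ hδr hp hp0 hpc ht hint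
  have b1 : G * δ ≤ ρ₀ := by
    rw [← le_div_iff₀' (by positivity)]
    exact hδr.trans (min_le_left _ _)
  have b4 : L * (M * (G * δ)) ≤ 1 / 2 := by
    have : δ ≤ 1 / (2 * L * M * G) := hδr.trans (min_le_right _ _)
    rw [le_div_iff₀' (by positivity)] at this
    linarith
  have hδG : δ ≤ G * δ := le_mul_of_one_le_left hδ.le hG
  have hmd : m ≤ d := le_of_rightInverse (A := D.comp (ContinuousLinearMap.inl ℝ _ _)) (R := Rx)
    (fun y => by simpa using hR.left_eq y)
  have hT : ∀ x ∈ Metric.closedBall u (c₂ * δ),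
      c₁ / δ ^ d * (1 / 2) * (cσ * δ ^ (d - m)) ≤ realRadon φ ψ t (fun y => p (y - v)) x := by
    intro x hx
    rw [mem_closedBall_iff_norm] at hx
    have hxδ : ‖x - u‖ ≤ δ := hx.trans (mul_le_of_le_one_left hδ.le hc₂1)
    have hxG : ‖x - u‖ ≤ G * δ := hxδ.trans hδG
    set a : Eucl d → Fin m → ℝ := fun y => jointMap φ (x, y) - t with ha
    have hac : Continuous a := ((continuous_jointMap hφ).comp (by fun_prop)).sub continuous_const
    have hmeas : MeasurableSet {y | a y = 0} := (isClosed_eq hac continuous_const).measurableSet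
    have hup := hσ φ ψ u v ρ₀ M L D Rx Ry t (G * δ) (G * δ) x hB hR (by positivity) b1 b4
      (by positivity) le_rfl hxG
    have hlow := hσ' (D.comp (ContinuousLinearMap.inr ℝ _ _)) Ry L (M * (G * δ)) a v δ (by positivity)
      (fun y => by simpa using hR.right_eq y) hR.right_le b4 hδ.le ?_ ?_
    · set S := {y | a y = 0} ∩ Metric.closedBall v δ with hS
      have hsub : S ⊆ {y | a y = 0} ∩ Metric.closedBall v (G * δ) :=
        Set.inter_subset_inter_right _ (Metric.closedBall_subset_closedBall hδG)
      have hfin : Measure.euclideanHausdorffMeasure (d - m) S < ⊤ :=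
        (measure_mono hsub).trans_lt (hup.trans_lt ENNReal.ofReal_lt_top)
      set F : Eucl d → ℝ := fun y => p (y - v) * ψ (x, y) with hF
      have hFc : Continuous F := (hp.continuous.comp (by fun_prop)).mul (hψ.comp (by fun_prop))
      have hF0 : ∀ y, 0 ≤ F y := by
        intro y
        by_cases hy : ‖y - v‖ ≤ G * δ
        · exact mul_nonneg (hp0 _) ((by norm_num : (0 : ℝ) ≤ 1 / 2).trans
            (hψ0 _ (mem_closedBall_prod (hxG.trans b1) (hy.trans b1))))
        · simp [hF, hp.supp _ (not_le.1 hy)]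
      have hFi : IntegrableOn F {y | a y = 0} (Measure.euclideanHausdorffMeasure (d - m)) :=
        integrableOn_of_continuous_of_eq_zero hmeas (isCompact_closedBall v (G * δ))
          (hup.trans_lt ENNReal.ofReal_lt_top).ne hFc fun y hy => by
            rw [mem_closedBall_iff_norm, not_le] at hy
            simp [hF, hp.supp _ hy]
      rw [realRadon, levelSet_eq]
      have h1 : c₁ / δ ^ d * (1 / 2) * (Measure.euclideanHausdorffMeasure (d - m)).real S ≤
          ∫ y in S, F y ∂(Measure.euclideanHausdorffMeasure (d - m)) := by
        refine setIntegral_ge_of_const_le_real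
          (hmeas.inter Metric.isClosed_closedBall.measurableSet) hfin.ne ?_
          (hFi.mono_set Set.inter_subset_left)
        intro y hy
        have hy' := mem_closedBall_iff_norm.1 hy.2
        exact mul_le_mul (hpc _ hy') (hψ0 _ (mem_closedBall_prod (hxG.trans b1)
          (hy'.trans (hδG.trans b1)))) (by norm_num) (hp0 _)
      have h2 : ∫ y in S, F y ∂(Measure.euclideanHausdorffMeasure (d - m)) ≤
          ∫ y in {y | a y = 0}, F y ∂(Measure.euclideanHausdorffMeasure (d - m)) :=
        setIntegral_mono_set hFi (Filter.Eventually.of_forall hF0)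
          (Filter.Eventually.of_forall Set.inter_subset_left)
      have h3 : cσ * δ ^ (d - m) ≤ (Measure.euclideanHausdorffMeasure (d - m)).real S := by
        rw [measureReal_def, ← ENNReal.ofReal_le_iff_le_toReal hfin.ne]
        exact hlow
      refine le_trans ?_ (h1.trans h2)
      gcongr
    · intro y hy y' hy'
      rw [mem_closedBall_iff_norm] at hy hy'
      simpa [ha] using hB.lin _ b1 (x, y) (mem_closedBall_prod hxG (hy.trans hδG)) (x, y')
        (mem_closedBall_prod hxG (hy'.trans hδG))
    · have h1 := hB.lip (x, v) (mem_closedBall_prod (hxG.trans b1) (by simp; positivity)) (u, v)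
        (Metric.mem_closedBall_self hρ₀.le)
      have e2 : ‖(x, v) - (u, v)‖ = ‖x - u‖ := by simp [Prod.norm_def]
      rw [e2] at h1
      have h2 := norm_add_le (jointMap φ (x, v) - jointMap φ (u, v)) (jointMap φ (u, v) - t)
      rw [sub_add_sub_cancel] at h2
      calc L * ‖a v‖ ≤ L * (M * (c₂ * δ) + 1 / (8 * L) * δ) := by
            gcongr
            exact h2.trans (add_le_add (h1.trans (by gcongr)) ht)
        _ = δ / 4 := by rw [hc₂]; field_simp; norm_num
  set f : Eucl d → ℝ := fun x => realRadon φ ψ t (fun y => p (y - v)) x * p (x - u) with hf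
  have hf0 : ∀ x, 0 ≤ f x := realRadon_mul_nonneg
    (fun p hp => (by norm_num : (0 : ℝ) ≤ 1 / 2).trans (hψ0 p hp)) b1 b1 hp hp hp0 hp0
  have h1 : c₁ / δ ^ d * (1 / 2) * (cσ * δ ^ (d - m)) * (c₁ / δ ^ d) *
      volume.real (Metric.closedBall u (c₂ * δ)) ≤ ∫ x in Metric.closedBall u (c₂ * δ), f x := by
    refine setIntegral_ge_of_const_le_real Metric.isClosed_closedBall.measurableSet
      measure_closedBall_lt_top.ne ?_ hint.integrableOn
    intro x hx
    have hx' := mem_closedBall_iff_norm.1 hx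
    exact mul_le_mul (hT x hx) (hpc _ (hx'.trans (mul_le_of_le_one_left hδ.le hc₂1)))
      (by positivity) (le_trans (by positivity) (hT x hx))
  have h2 : ∫ x in Metric.closedBall u (c₂ * δ), f x ≤ ∫ x, f x :=
    setIntegral_le_integral hint (Filter.Eventually.of_forall hf0)
  refine le_trans (le_of_eq ?_) (h1.trans h2)
  rw [measureReal_def, Measure.addHaar_closedBall _ _ (by positivity), finrank_euclideanSpace,
    Fintype.card_fin, ENNReal.toReal_mul, ENNReal.toReal_ofReal (by positivity), ← measureReal_def,
    ← hV]
  have : δ ^ d = δ ^ (d - m) * δ ^ m := by rw [← pow_add, Nat.sub_add_cancel hmd]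
  rw [mul_pow, this]
  field_simp

end RadonLower

/-! ### Uniform constants on compact sets -/

section Uniformity

variable {d m : ℕ}

theorem IsBoundedNear.mono {φ : Fin m → Eucl d × Eucl d → ℝ} {ψ : Eucl d × Eucl d → ℝ}
    {u v : Eucl d} {ρ₀ ρ₁ M : ℝ} {D : Eucl d × Eucl d →L[ℝ] (Fin m → ℝ)}
    (h : IsBoundedNear φ ψ u v ρ₀ M D) (hρ : ρ₁ ≤ ρ₀) : IsBoundedNear φ ψ u v ρ₁ M D := by
  have sub := Metric.closedBall_subset_closedBall (x := (u, v)) hρ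
  exact ⟨h.norm_le, fun p hp p' hp' => h.lip p (sub hp) p' (sub hp'),
    fun ρ hρ' => h.lin ρ (hρ'.trans hρ),
    fun p hp p' hp' e he he' => h.second p (sub hp) p' (sub hp') e (sub he) (sub he'),
    fun p hp => h.cutoff_le p (sub hp), fun p hp p' hp' => h.cutoff_lip p (sub hp) p' (sub hp')⟩

theorem contDiff_jointMap {φ : Fin m → Eucl d × Eucl d → ℝ} (hφ : ∀ l, ContDiff ℝ ∞ (φ l)) :
    ContDiff ℝ ∞ (jointMap φ) := contDiff_pi.2 hφ

/-- Uniform bounds near a compact set. -/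
theorem exists_isBoundedNear {φ : Fin m → Eucl d × Eucl d → ℝ} {ψ : Eucl d × Eucl d → ℝ}
    (hφ : ∀ l, ContDiff ℝ ∞ (φ l)) (hψ : ContDiff ℝ ∞ ψ) {E : Set (Eucl d)} (hE : IsCompact E) :
    ∃ M : ℝ, 1 ≤ M ∧ ∀ u ∈ E, ∀ v ∈ E,
      IsBoundedNear φ ψ u v 1 M (fderiv ℝ (jointMap φ) (u, v)) := by
  have hΦ := contDiff_jointMap hφ
  have hΦd : Differentiable ℝ (jointMap φ) := hΦ.differentiable (by simp)
  have hΦ' : ContDiff ℝ ∞ (fderiv ℝ (jointMap φ)) := hΦ.fderiv_right (m := ∞) (by simp)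
  have hΦ'd : Differentiable ℝ (fderiv ℝ (jointMap φ)) := hΦ'.differentiable (by simp)
  have hc1 : Continuous (fderiv ℝ (jointMap φ)) := hΦ.continuous_fderiv (by simp)
  have hc2 : Continuous (fderiv ℝ (fderiv ℝ (jointMap φ))) := hΦ'.continuous_fderiv (by simp)
  have hc3 : Continuous (fderiv ℝ ψ) := hψ.continuous_fderiv (by simp)
  have hψd : Differentiable ℝ ψ := hψ.differentiable (by simp)
  have hK : IsCompact (Metric.cthickening 1 (E ×ˢ E)) := (hE.prod hE).cthickening
  obtain ⟨M₁, hM₁⟩ := hK.exists_bound_of_continuousOn hc1.continuousOn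
  obtain ⟨M₂, hM₂⟩ : ∃ M₂, ∀ z ∈ Metric.cthickening 1 (E ×ˢ E),
      ‖fderiv ℝ (fderiv ℝ (jointMap φ)) z‖ ≤ M₂ := by
    obtain ⟨C, hC⟩ := hK.exists_bound_of_continuousOn
      (Continuous.norm (E := Eucl d × Eucl d →L[ℝ] Eucl d × Eucl d →L[ℝ] (Fin m → ℝ))
        hc2).continuousOn
    exact ⟨C, fun z hz => by simpa using hC z hz⟩
  obtain ⟨M₃, hM₃⟩ := hK.exists_bound_of_continuousOn hc3.continuousOn
  obtain ⟨M₄, hM₄⟩ := hK.exists_bound_of_continuousOn hψ.continuous.continuousOn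
  refine ⟨max 1 (max (max M₁ M₂) (max M₃ M₄)), le_max_left _ _, ?_⟩
  set M := max 1 (max (max M₁ M₂) (max M₃ M₄)) with hM
  have h1 : M₁ ≤ M := ((le_max_left _ _).trans (le_max_left _ _)).trans (le_max_right _ _)
  have h2 : M₂ ≤ M := ((le_max_right _ _).trans (le_max_left _ _)).trans (le_max_right _ _)
  have h3 : M₃ ≤ M := ((le_max_left _ _).trans (le_max_right _ _)).trans (le_max_right _ _)
  have h4 : M₄ ≤ M := ((le_max_right _ _).trans (le_max_right _ _)).trans (le_max_right _ _)
  have hM0 : 0 ≤ M := zero_le_one.trans (le_max_left _ _)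
  intro u hu v hv
  have hsub : Metric.closedBall (u, v) 1 ⊆ Metric.cthickening 1 (E ×ˢ E) :=
    Metric.closedBall_subset_cthickening (Set.mk_mem_prod hu hv) 1
  have hcv : Convex ℝ (Metric.closedBall (u, v) 1) := convex_closedBall _ _
  have hD2 : ∀ p ∈ Metric.closedBall (u, v) 1, ∀ p' ∈ Metric.closedBall (u, v) 1,
      ‖fderiv ℝ (jointMap φ) p - fderiv ℝ (jointMap φ) p'‖ ≤ M * ‖p - p'‖ := fun p hp p' hp' =>
    hcv.norm_image_sub_le_of_norm_fderiv_le (𝕜 := ℝ) (fun z _ => hΦ'd z)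
      (fun z hz => (hM₂ z (hsub hz)).trans h2) hp' hp
  have hmem : (u, v) ∈ Metric.closedBall (u, v) 1 := Metric.mem_closedBall_self zero_le_one
  refine ⟨?_, ?_, ?_, ?_, ?_, ?_⟩
  · intro e
    exact ((fderiv ℝ (jointMap φ) (u, v)).le_opNorm e).trans
      (mul_le_mul_of_nonneg_right ((hM₁ _ (hsub hmem)).trans h1) (norm_nonneg _))
  · intro p hp p' hp'
    exact hcv.norm_image_sub_le_of_norm_fderiv_le (𝕜 := ℝ) (fun z _ => hΦd z)
      (fun z hz => (hM₁ z (hsub hz)).trans h1) hp' hp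
  · intro ρ hρ p hp p' hp'
    refine (convex_closedBall (u, v) ρ).norm_image_sub_le_of_norm_fderiv_le' (𝕜 := ℝ)
      (fun z _ => hΦd z) (fun z hz => ?_) hp' hp
    refine (hD2 z (Metric.closedBall_subset_closedBall hρ hz) _ hmem).trans ?_
    exact mul_le_mul_of_nonneg_left (mem_closedBall_iff_norm.1 hz) hM0
  · intro p hp p' hp' e he he'
    -- The second difference is a first difference of `z ↦ Φ(z + e) - Φ(z)`, whose derivative is at
    -- most `M * ‖e‖` where both `z` and `z + e` lie in the ball; that set is convex.
    have hs : Convex ℝ (Metric.closedBall (u, v) 1 ∩ (fun z => e + z) ⁻¹' Metric.closedBall (u, v) 1) :=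
      hcv.inter (hcv.translate_preimage_right e)
    have hd : ∀ z, HasFDerivAt (fun z => jointMap φ (z + e) - jointMap φ z)
        (fderiv ℝ (jointMap φ) (z + e) - fderiv ℝ (jointMap φ) z) z := fun z =>
      ((hasFDerivAt_comp_add_right e).2 (hΦd (z + e)).hasFDerivAt).sub (hΦd z).hasFDerivAt
    have := hs.norm_image_sub_le_of_norm_hasFDerivWithin_le (𝕜 := ℝ)
      (fun z _ => (hd z).hasFDerivWithinAt) (C := M * ‖e‖) (fun z hz => ?_)
      (x := p') (y := p) ⟨hp', by simpa [add_comm] using he'⟩ ⟨hp, by simpa [add_comm] using he⟩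
    · rwa [show jointMap φ (p + e) - jointMap φ (p' + e) - (jointMap φ p - jointMap φ p') =
        jointMap φ (p + e) - jointMap φ p - (jointMap φ (p' + e) - jointMap φ p') by abel]
    · have := hD2 (z + e) (by have := hz.2; rwa [Set.mem_preimage, add_comm] at this) z hz.1
      simpa using this
  · intro p hp
    exact (hM₄ p (hsub hp)).trans h4
  · intro p hp p' hp'
    exact hcv.norm_image_sub_le_of_norm_fderiv_le (𝕜 := ℝ) (fun z _ => hψd z)
      (fun z hz => (hM₃ z (hsub hz)).trans h3) hp' hp

/-- Right inverses persist under small perturbations. -/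
theorem exists_rightInverse_of_near {X : Type*} [NormedAddCommGroup X] [NormedSpace ℝ X]
    {A₀ A : X →L[ℝ] (Fin m → ℝ)} {R₀ : (Fin m → ℝ) →L[ℝ] X} {L : ℝ} (hL : 0 ≤ L)
    (hAR : ∀ y, A₀ (R₀ y) = y) (hR : ∀ y, ‖R₀ y‖ ≤ L * ‖y‖) (h : ‖A - A₀‖ * L ≤ 1 / 2) :
    ∃ R : (Fin m → ℝ) →L[ℝ] X, (∀ y, A (R y) = y) ∧ ∀ y, ‖R y‖ ≤ 2 * L * ‖y‖ := by
  have hB : ∀ y, ‖A (R₀ y) - y‖ ≤ 1 / 2 * ‖y‖ := by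
    intro y
    have h1 : A (R₀ y) - y = (A - A₀) (R₀ y) := by simp [hAR]
    rw [h1]
    calc _ ≤ ‖A - A₀‖ * ‖R₀ y‖ := (A - A₀).le_opNorm _
      _ ≤ ‖A - A₀‖ * (L * ‖y‖) := by gcongr; exact hR y
      _ = (‖A - A₀‖ * L) * ‖y‖ := by ring
      _ ≤ _ := by gcongr
  -- `A R₀` is within `1/2` of the identity, so it is invertible and its inverse has norm at most 2.
  have hlow : ∀ y, ‖y‖ ≤ 2 * ‖A (R₀ y)‖ := by
    intro y
    have := norm_sub_le (A (R₀ y)) (A (R₀ y) - y)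
    rw [sub_sub_cancel] at this
    linarith [hB y]
  let B : (Fin m → ℝ) →ₗ[ℝ] (Fin m → ℝ) := (A.comp R₀ : (Fin m → ℝ) →L[ℝ] (Fin m → ℝ))
  have hinj : Function.Injective B := by
    rw [← LinearMap.ker_eq_bot, LinearMap.ker_eq_bot']
    intro y hy
    have h1 := hlow y
    have h2 : A (R₀ y) = 0 := hy
    rw [h2, norm_zero, mul_zero] at h1
    exact norm_le_zero_iff.1 h1
  let e := LinearEquiv.ofInjectiveEndo B hinj
  have he : ∀ y, A (R₀ (e.symm y)) = y := fun y => e.apply_symm_apply y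
  refine ⟨R₀.comp (LinearMap.toContinuousLinearMap (e.symm : (Fin m → ℝ) →ₗ[ℝ] (Fin m → ℝ))),
    fun y => he y, fun y => ?_⟩
  have h1 := hlow (e.symm y)
  rw [he] at h1
  calc _ ≤ L * ‖e.symm y‖ := hR _
    _ ≤ L * (2 * ‖y‖) := by gcongr
    _ = _ := by ring

/-- Linearly independent vectors give a surjection onto the coordinate space. -/
theorem exists_rightInverse_of_linearIndependent {g : Fin m → Eucl d} (hg : LinearIndependent ℝ g)
    {A : Eucl d →L[ℝ] (Fin m → ℝ)} (hA : ∀ e l, A e l = inner ℝ (g l) e) :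
    ∃ R : (Fin m → ℝ) →L[ℝ] Eucl d, ∀ y, A (R y) = y := by
  have hsurj : LinearMap.range (A : Eucl d →ₗ[ℝ] (Fin m → ℝ)) = ⊤ := by
    by_contra hne
    -- A nonzero functional vanishing on the range of `A` is a linear relation between the vectors
    -- `g l`.
    obtain ⟨f, hf0, hf⟩ := Submodule.exists_le_ker_of_lt_top _ (lt_top_iff_ne_top.2 hne)
    have hsum : ∀ y, f y = ∑ l, y l * f (Pi.single l 1) := by
      intro y
      conv_lhs => rw [pi_eq_sum_univ' y]
      simp
    have hz : ∑ l, f (Pi.single l 1) • g l = 0 := by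
      refine ext_inner_right ℝ fun e => ?_
      have h1 : f (A e) = 0 := hf ⟨e, rfl⟩
      rw [hsum] at h1
      rw [sum_inner, inner_zero_left, ← h1]
      refine Finset.sum_congr rfl fun l _ => ?_
      rw [inner_smul_left, hA]
      simp [mul_comm]
    have hall := Fintype.linearIndependent_iff.1 hg _ hz
    refine hf0 (LinearMap.ext fun y => ?_)
    rw [hsum]
    simp [hall]
  obtain ⟨R, hR⟩ := (A : Eucl d →ₗ[ℝ] (Fin m → ℝ)).exists_rightInverse_of_surjective hsurj
  exact ⟨LinearMap.toContinuousLinearMap R, fun y => LinearMap.congr_fun hR y⟩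

theorem NondegenerateOn.exists_rightInverses {φ : Fin m → Eucl d × Eucl d → ℝ}
    (hφ : ∀ l, ContDiff ℝ ∞ (φ l)) {T : Set (Fin m → ℝ)} (hdeg : NondegenerateOn φ T)
    {t : Fin m → ℝ} (ht : t ∈ T) {u v : Eucl d} (huv : jointMap φ (u, v) = t) :
    ∃ Rx Ry : (Fin m → ℝ) →L[ℝ] Eucl d, (∀ y, fderiv ℝ (jointMap φ) (u, v) (Rx y, 0) = y) ∧
      ∀ y, fderiv ℝ (jointMap φ) (u, v) (0, Ry y) = y := by
  obtain ⟨h1, h2⟩ := hdeg t ht u v fun l => congrFun huv l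
  have hd : ∀ l, DifferentiableAt ℝ (φ l) (u, v) := fun l => (hφ l).differentiable (by simp) _
  have hD : ∀ e l, fderiv ℝ (jointMap φ) (u, v) e l = fderiv ℝ (φ l) (u, v) e := by
    intro e l
    have : HasFDerivAt (jointMap φ) (ContinuousLinearMap.pi fun l => fderiv ℝ (φ l) (u, v)) (u, v) :=
      hasFDerivAt_pi.2 fun l => (hd l).hasFDerivAt
    rw [this.fderiv]
    rfl
  obtain ⟨Rx, hRx⟩ := exists_rightInverse_of_linearIndependent h1
    (A := (fderiv ℝ (jointMap φ) (u, v)).comp (ContinuousLinearMap.inl ℝ _ _)) (by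
      intro e l
      have hc : HasFDerivAt (fun x' => φ l (x', v))
          ((fderiv ℝ (φ l) (u, v)).comp (ContinuousLinearMap.inl ℝ _ _)) u :=
        (hd l).hasFDerivAt.comp u (hasFDerivAt_prodMk_left u v)
      rw [gradient, InnerProductSpace.toDual_symm_apply, hc.fderiv]
      exact hD _ l)
  obtain ⟨Ry, hRy⟩ := exists_rightInverse_of_linearIndependent h2
    (A := (fderiv ℝ (jointMap φ) (u, v)).comp (ContinuousLinearMap.inr ℝ _ _)) (by
      intro e l
      have hc : HasFDerivAt (fun y' => φ l (u, y'))
          ((fderiv ℝ (φ l) (u, v)).comp (ContinuousLinearMap.inr ℝ _ _)) v :=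
        (hd l).hasFDerivAt.comp v (hasFDerivAt_prodMk_right u v)
      rw [gradient, InnerProductSpace.toDual_symm_apply, hc.fderiv]
      exact hD _ l)
  exact ⟨Rx, Ry, fun y => by simpa using hRx y, fun y => by simpa using hRy y⟩

/-- Uniform right inverses near the level sets, on compact sets. -/
theorem NondegenerateOn.exists_hasRightInverses {φ : Fin m → Eucl d × Eucl d → ℝ}
    (hφ : ∀ l, ContDiff ℝ ∞ (φ l)) {T : Set (Fin m → ℝ)} (hdeg : NondegenerateOn φ T)
    {E : Set (Eucl d)} (hE : IsCompact E) {K : Set (Fin m → ℝ)} (hK : IsCompact K) (hKT : K ⊆ T) :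
    ∃ L c : ℝ, 1 ≤ L ∧ 0 < c ∧ ∀ u ∈ E, ∀ v ∈ E, ∀ t ∈ K, ‖jointMap φ (u, v) - t‖ ≤ c →
      ∃ Rx Ry, HasRightInverses (fderiv ℝ (jointMap φ) (u, v)) L Rx Ry := by
  have hΦ := contDiff_jointMap hφ
  have hc1 : Continuous (fderiv ℝ (jointMap φ)) := hΦ.continuous_fderiv (by simp)
  have key : ∃ L c : ℝ, 1 ≤ L ∧ 0 < c ∧ ∀ z ∈ (E ×ˢ E) ×ˢ K, ‖jointMap φ z.1 - z.2‖ ≤ c →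
      ∃ Rx Ry, HasRightInverses (fderiv ℝ (jointMap φ) z.1) L Rx Ry := by
    refine ((hE.prod hE).prod hK).induction_on (p := fun s => ∃ L c : ℝ, 1 ≤ L ∧ 0 < c ∧
      ∀ z ∈ s, ‖jointMap φ z.1 - z.2‖ ≤ c →
        ∃ Rx Ry, HasRightInverses (fderiv ℝ (jointMap φ) z.1) L Rx Ry) ?_ ?_ ?_ ?_
    · exact ⟨1, 1, le_rfl, one_pos, by simp⟩
    · rintro s s' hss' ⟨L, c, hL, hc, h⟩
      exact ⟨L, c, hL, hc, fun z hz => h z (hss' hz)⟩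
    · rintro s s' ⟨L, c, hL, hc, h⟩ ⟨L', c', hL', hc', h'⟩
      refine ⟨max L L', min c c', hL.trans (le_max_left _ _), lt_min hc hc', ?_⟩
      rintro z (hz | hz) hzc
      · obtain ⟨Rx, Ry, h1⟩ := h z hz (hzc.trans (min_le_left _ _))
        exact ⟨Rx, Ry, h1.1, h1.2,
          fun y => (h1.3 y).trans (mul_le_mul_of_nonneg_right (le_max_left _ _) (norm_nonneg _)),
          fun y => (h1.4 y).trans (mul_le_mul_of_nonneg_right (le_max_left _ _) (norm_nonneg _))⟩
      · obtain ⟨Rx, Ry, h1⟩ := h' z hz (hzc.trans (min_le_right _ _))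
        exact ⟨Rx, Ry, h1.1, h1.2,
          fun y => (h1.3 y).trans (mul_le_mul_of_nonneg_right (le_max_right _ _) (norm_nonneg _)),
          fun y => (h1.4 y).trans (mul_le_mul_of_nonneg_right (le_max_right _ _) (norm_nonneg _))⟩
    · rintro ⟨⟨u, v⟩, t⟩ hz
      have hcont : Continuous fun z : (Eucl d × Eucl d) × (Fin m → ℝ) => ‖jointMap φ z.1 - z.2‖ :=
        ((hΦ.continuous.comp continuous_fst).sub continuous_snd).norm
      -- At a point of the level set the right inverses persist nearby, with twice the bound. At any
      -- other point the premise fails nearby, once `c` is half the distance of `Φ(u, v)` to `t`.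
      by_cases huv : jointMap φ (u, v) = t
      · obtain ⟨Rx, Ry, hRx, hRy⟩ := hdeg.exists_rightInverses hφ (hKT hz.2) huv
        set L := max 1 (max ‖Rx‖ ‖Ry‖) with hL
        have hL1 : 1 ≤ L := le_max_left _ _
        have hev : ∀ᶠ z in nhdsWithin ((u, v), t) ((E ×ˢ E) ×ˢ K),
            ‖fderiv ℝ (jointMap φ) z.1 - fderiv ℝ (jointMap φ) (u, v)‖ < 1 / (2 * L) := by
          refine mem_nhdsWithin_of_mem_nhds ?_
          have hc : Continuous fun z : (Eucl d × Eucl d) × (Fin m → ℝ) =>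
              ‖fderiv ℝ (jointMap φ) z.1 - fderiv ℝ (jointMap φ) (u, v)‖ :=
            ((hc1.comp continuous_fst).sub continuous_const).norm
          exact hc.continuousAt.eventually (gt_mem_nhds (by simp; positivity))
        refine ⟨_, hev, 2 * L, 1, by linarith, one_pos, ?_⟩
        intro z hz' _
        have hz'' : ‖fderiv ℝ (jointMap φ) z.1 - fderiv ℝ (jointMap φ) (u, v)‖ * L ≤ 1 / 2 := by
          have : ‖fderiv ℝ (jointMap φ) z.1 - fderiv ℝ (jointMap φ) (u, v)‖ < 1 / (2 * L) := hz'
          rw [lt_div_iff₀ (by positivity)] at this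
          linarith
        have hnorm : ∀ S : Eucl d →L[ℝ] Eucl d × Eucl d, ‖S‖ ≤ 1 →
            ‖(fderiv ℝ (jointMap φ) z.1).comp S - (fderiv ℝ (jointMap φ) (u, v)).comp S‖ * L ≤
              1 / 2 := by
          intro S hS
          rw [← ContinuousLinearMap.sub_comp]
          refine le_trans ?_ hz''
          gcongr
          exact (ContinuousLinearMap.opNorm_comp_le _ _).trans (mul_le_of_le_one_right (norm_nonneg _) hS)
        obtain ⟨Rx', h1, h2⟩ := exists_rightInverse_of_near (L := L) (by positivity)
          (A₀ := (fderiv ℝ (jointMap φ) (u, v)).comp (ContinuousLinearMap.inl ℝ _ _))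
          (A := (fderiv ℝ (jointMap φ) z.1).comp (ContinuousLinearMap.inl ℝ _ _))
          (R₀ := Rx) (fun y => by simpa using hRx y)
          (fun y => (Rx.le_opNorm y).trans (mul_le_mul_of_nonneg_right
            ((le_max_left _ _).trans (le_max_right _ _)) (norm_nonneg _)))
          (hnorm _ (ContinuousLinearMap.norm_inl_le_one ℝ _ _))
        obtain ⟨Ry', h3, h4⟩ := exists_rightInverse_of_near (L := L) (by positivity)
          (A₀ := (fderiv ℝ (jointMap φ) (u, v)).comp (ContinuousLinearMap.inr ℝ _ _))
          (A := (fderiv ℝ (jointMap φ) z.1).comp (ContinuousLinearMap.inr ℝ _ _))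
          (R₀ := Ry) (fun y => by simpa using hRy y)
          (fun y => (Ry.le_opNorm y).trans (mul_le_mul_of_nonneg_right
            ((le_max_right _ _).trans (le_max_right _ _)) (norm_nonneg _)))
          (hnorm _ (ContinuousLinearMap.norm_inr_le_one ℝ _ _))
        exact ⟨Rx', Ry', fun y => by simpa using h1 y, fun y => by simpa using h3 y, h2, h4⟩
      · have hpos : 0 < ‖jointMap φ (u, v) - t‖ := norm_pos_iff.2 (sub_ne_zero.2 huv)
        have hev : ∀ᶠ z in nhdsWithin ((u, v), t) ((E ×ˢ E) ×ˢ K),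
            ‖jointMap φ (u, v) - t‖ / 2 < ‖jointMap φ z.1 - z.2‖ :=
          mem_nhdsWithin_of_mem_nhds (hcont.continuousAt.eventually
            (lt_mem_nhds (half_lt_self hpos)))
        exact ⟨_, hev, 1, ‖jointMap φ (u, v) - t‖ / 2, le_rfl, half_pos hpos,
          fun z hz' h => absurd h (not_le.2 hz')⟩
  obtain ⟨L, c, hL, hc, h⟩ := key
  exact ⟨L, c, hL, hc, fun u hu v hv t ht => h ((u, v), t) ⟨⟨hu, hv⟩, ht⟩⟩

end Uniformity

/-! ### Test functions and mollified measures -/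

section TestFunctions

variable {d : ℕ}

/-- Real test functions on `ℝᵈ`. -/
structure IsTest (q : Eucl d → ℝ) : Prop where
  smooth : ContDiff ℝ ∞ q
  compact : HasCompactSupport q

/-- A real test function as a complex Schwartz function. -/
noncomputable def IsTest.toSchwartz {q : Eucl d → ℝ} (hq : IsTest q) : 𝓢(Eucl d, ℂ) :=
  HasCompactSupport.toSchwartzMap (f := fun x => (q x : ℂ))
    (hq.compact.comp_left (g := fun r : ℝ => (r : ℂ)) Complex.ofReal_zero)
    (Complex.ofRealCLM.contDiff.comp hq.smooth)

theorem IsTest.coe_toSchwartz {q : Eucl d → ℝ} (hq : IsTest q) :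
    (hq.toSchwartz : Eucl d → ℂ) = fun x => (q x : ℂ) := rfl

theorem IsTest.continuous {q : Eucl d → ℝ} (hq : IsTest q) : Continuous q := hq.smooth.continuous

theorem IsTest.integrable {q : Eucl d → ℝ} (hq : IsTest q) : Integrable q :=
  hq.continuous.integrable_of_hasCompactSupport hq.compact

theorem IsTest.memLp {q : Eucl d → ℝ} (hq : IsTest q) (p : ℝ≥0∞) : MemLp q p volume :=
  hq.continuous.memLp_of_hasCompactSupport hq.compact

theorem IsTest.sub {q q' : Eucl d → ℝ} (hq : IsTest q) (hq' : IsTest q') :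
    IsTest fun x => q x - q' x :=
  ⟨hq.smooth.sub hq'.smooth, hq.compact.sub hq'.compact⟩

theorem IsTest.translate {q : Eucl d → ℝ} (hq : IsTest q) (v : Eucl d) :
    IsTest fun x => q (x - v) :=
  ⟨hq.smooth.comp (by fun_prop), hq.compact.comp_homeomorph (Homeomorph.subRight v)⟩

/-- Convolution of a function with a measure. -/
noncomputable def mollify (q : Eucl d → ℝ) (μ : Measure (Eucl d)) (x : Eucl d) : ℝ :=
  ∫ u, q (x - u) ∂μ

open scoped Pointwise in
theorem isTest_mollify {q : Eucl d → ℝ} (hq : IsTest q) {μ : Measure (Eucl d)} [IsFiniteMeasure μ]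
    {E : Set (Eucl d)} (hE : IsCompact E) (hμ : μ Eᶜ = 0) : IsTest (mollify q μ) := by
  constructor
  · have h := hq.compact.contDiff_convolution_right (n := ⊤) (ContinuousLinearMap.lsmul ℝ ℝ) (μ := μ)
      (f := fun _ : Eucl d => (1 : ℝ)) (locallyIntegrable_const 1) hq.smooth
    have e : mollify q μ = convolution (fun _ : Eucl d => (1 : ℝ)) q
        (ContinuousLinearMap.lsmul ℝ ℝ) μ := by
      ext x
      simp [mollify, convolution]
    rw [e]
    exact h
  · refine HasCompactSupport.intro (K := E + tsupport q) (hE.add hq.compact) fun x hx => ?_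
    refine integral_eq_zero_of_ae ?_
    have hE' : ∀ᵐ u ∂μ, u ∈ E := by rwa [ae_iff]
    filter_upwards [hE'] with u hu
    by_contra hne
    exact hx ⟨u, hu, x - u, subset_tsupport _ hne, by simp⟩

theorem IsTest.integrable_mul {𝕜 : Type*} [RCLike 𝕜] {q : Eucl d → ℝ} (hq : IsTest q)
    {k : Eucl d → 𝕜} (hk : LocallyIntegrable k) : Integrable fun y => k y * (q y : 𝕜) := by
  have := hk.integrable_smul_left_of_hasCompactSupport (RCLike.continuous_ofReal (K := 𝕜) |>.comp hq.continuous)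
    (hq.compact.comp_left (g := fun r : ℝ => (r : 𝕜)) (by simp))
  simpa [mul_comm] using this

/-- `k` need not be integrable: a bound uniform in the translation, together with the finiteness of
`ν`, is enough for Fubini. This covers both `k ∈ L²`, by Cauchy–Schwarz, and characters, which give
the Fourier transform of a mollified measure. -/
theorem integrable_mul_sub_prod {𝕜 : Type*} [RCLike 𝕜] {q : Eucl d → ℝ} (hq : IsTest q)
    {k : Eucl d → 𝕜} (hk : LocallyIntegrable k) {C : ℝ}
    (hC : ∀ v, ∫ y, ‖k y * (q (y - v) : 𝕜)‖ ≤ C) (ν : Measure (Eucl d)) [IsFiniteMeasure ν] :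
    Integrable (fun z : Eucl d × Eucl d => k z.1 * (q (z.1 - z.2) : 𝕜)) (volume.prod ν) := by
  have hmeas : AEStronglyMeasurable (fun z : Eucl d × Eucl d => k z.1 * (q (z.1 - z.2) : 𝕜))
      (volume.prod ν) := by
    refine hk.aestronglyMeasurable.comp_fst.mul ?_
    refine Continuous.aestronglyMeasurable ?_
    exact RCLike.continuous_ofReal.comp (hq.continuous.comp (by fun_prop))
  rw [integrable_prod_iff' hmeas]
  refine ⟨Filter.Eventually.of_forall fun v => (hq.translate v).integrable_mul hk, ?_⟩
  refine Integrable.of_bound (hmeas.norm.prod_swap.integral_prod_right') C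
    (Filter.Eventually.of_forall fun v => ?_)
  rw [Real.norm_of_nonneg (integral_nonneg fun _ => norm_nonneg _)]
  exact hC v

/-- Fubini's theorem for the pairing of a function with a mollified measure. -/
theorem integral_mul_mollify {𝕜 : Type*} [RCLike 𝕜] {q : Eucl d → ℝ} (hq : IsTest q)
    {k : Eucl d → 𝕜} (hk : LocallyIntegrable k) {C : ℝ}
    (hC : ∀ v, ∫ y, ‖k y * (q (y - v) : 𝕜)‖ ≤ C) (ν : Measure (Eucl d)) [IsFiniteMeasure ν] :
    Integrable (fun v => ∫ y, k y * (q (y - v) : 𝕜)) ν ∧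
      ∫ y, k y * (mollify q ν y : 𝕜) = ∫ v, (∫ y, k y * (q (y - v) : 𝕜)) ∂ν := by
  have h := integrable_mul_sub_prod hq hk hC ν
  refine ⟨h.integral_prod_right, ?_⟩
  have h1 := (integral_prod _ h).symm.trans (integral_prod_symm _ h)
  refine Eq.trans ?_ h1
  refine integral_congr_ae (Filter.Eventually.of_forall fun y => ?_)
  simp only [mollify]
  rw [integral_const_mul, integral_ofReal]

theorem integral_norm_mul_le {k : Eucl d → ℝ} (hk : MemLp k 2) {q : Eucl d → ℝ} (hq : IsTest q)
    (v : Eucl d) : ∫ y, ‖k y * q (y - v)‖ ≤ (eLpNorm k 2 volume).toReal * (eLpNorm q 2 volume).toReal := by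
  have h1 : eLpNorm (fun y => k y * q (y - v)) 1 volume ≤
      eLpNorm k 2 volume * eLpNorm (fun y => q (y - v)) 2 volume := by
    have h := eLpNorm_smul_le_mul_eLpNorm (p := 2) (q := 2) (r := 1)
      ((hq.translate v).memLp 2).aestronglyMeasurable hk.aestronglyMeasurable
    exact h
  have h2 : eLpNorm (fun y => q (y - v)) 2 volume = eLpNorm q 2 volume :=
    eLpNorm_comp_measurePreserving hq.continuous.aestronglyMeasurable
      (measurePreserving_sub_right volume v)
  rw [h2] at h1
  have hm : AEStronglyMeasurable (fun y => k y * q (y - v)) volume :=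
    hk.aestronglyMeasurable.mul (hq.translate v).continuous.aestronglyMeasurable
  rw [integral_norm_eq_lintegral_enorm hm, ← eLpNorm_one_eq_lintegral_enorm,
    ← ENNReal.toReal_mul]
  exact ENNReal.toReal_mono (ENNReal.mul_ne_top hk.eLpNorm_lt_top.ne (hq.memLp 2).eLpNorm_lt_top.ne) h1

theorem integral_mul_mollify_of_memLp {q : Eucl d → ℝ} (hq : IsTest q) {k : Eucl d → ℝ}
    (hk : MemLp k 2) (ν : Measure (Eucl d)) [IsFiniteMeasure ν] :
    Integrable (fun v => ∫ y, k y * q (y - v)) ν ∧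
      ∫ y, k y * mollify q ν y = ∫ v, (∫ y, k y * q (y - v)) ∂ν :=
  integral_mul_mollify (𝕜 := ℝ) hq (hk.locallyIntegrable (by norm_num))
    (integral_norm_mul_le hk hq) ν

/-- The Fourier transform of a measure. -/
noncomputable def fourierMeasure (ν : Measure (Eucl d)) (ξ : Eucl d) : ℂ :=
  ∫ u, (Real.fourierChar (-inner ℝ u ξ) : ℂ) ∂ν

theorem norm_fourierMeasure_le (ν : Measure (Eucl d)) [IsProbabilityMeasure ν] (ξ : Eucl d) :
    ‖fourierMeasure ν ξ‖ ≤ 1 := by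
  refine (norm_integral_le_of_norm_le_const (C := 1)
    (Filter.Eventually.of_forall fun u => (Circle.norm_coe _).le)).trans ?_
  simp

theorem fourier_mollify {q : Eucl d → ℝ} (hq : IsTest q) (ν : Measure (Eucl d)) [IsFiniteMeasure ν]
    (ξ : Eucl d) : 𝓕 (fun x => (mollify q ν x : ℂ)) ξ =
      𝓕 (fun x => (q x : ℂ)) ξ * fourierMeasure ν ξ := by
  have hk : LocallyIntegrable (fun y : Eucl d => (Real.fourierChar (-inner ℝ y ξ) : ℂ)) := by
    refine Continuous.locallyIntegrable ?_
    fun_prop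
  have hC : ∀ v, ∫ y, ‖(Real.fourierChar (-inner ℝ y ξ) : ℂ) * ((q (y - v) : ℝ) : ℂ)‖ ≤ ∫ y, |q y| := by
    intro v
    rw [← integral_sub_right_eq_self (fun y => |q y|) v]
    refine le_of_eq (integral_congr_ae (Filter.Eventually.of_forall fun y => ?_))
    simp only [norm_mul]
    rw [Circle.norm_coe, one_mul, Complex.norm_real, Real.norm_eq_abs]
  have h := (integral_mul_mollify (𝕜 := ℂ) hq hk hC ν).2
  have key : ∀ v, ∫ y, (Real.fourierChar (-inner ℝ y ξ) : ℂ) * ((q (y - v) : ℝ) : ℂ) =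
      𝓕 (fun x => (q x : ℂ)) ξ * (Real.fourierChar (-inner ℝ v ξ) : ℂ) := by
    intro v
    rw [← integral_add_right_eq_self (fun y => (Real.fourierChar (-inner ℝ y ξ) : ℂ) *
      ((q (y - v) : ℝ) : ℂ)) v, Real.fourier_eq, ← integral_mul_const]
    refine integral_congr_ae (Filter.Eventually.of_forall fun y => ?_)
    simp only [add_sub_cancel_right, inner_add_left, neg_add, AddChar.map_add_eq_mul,
      Circle.smul_def, Circle.coe_mul, smul_eq_mul]
    ring
  have e : 𝓕 (fun x => (mollify q ν x : ℂ)) ξ =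
      ∫ y, (Real.fourierChar (-inner ℝ y ξ) : ℂ) * ((mollify q ν y : ℝ) : ℂ) := by
    rw [Real.fourier_eq]
    rfl
  rw [e, fourierMeasure, ← integral_const_mul]
  exact h.trans (integral_congr_ae (Filter.Eventually.of_forall fun v => key v))

end TestFunctions

/-! ### Mollifiers at a given scale and flat kernels -/

section Kernels

variable {d : ℕ}

theorem IsTest.add {q q' : Eucl d → ℝ} (hq : IsTest q) (hq' : IsTest q') :
    IsTest fun x => q x + q' x :=
  ⟨hq.smooth.add hq'.smooth, hq.compact.add hq'.compact⟩

/-- The `L¹`-normalized dilation of a function to scale `ε`. -/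
noncomputable def dilate (q : Eucl d → ℝ) (ε : ℝ) (x : Eucl d) : ℝ := (ε ^ d)⁻¹ * q (ε⁻¹ • x)

theorem IsTest.dilate {q : Eucl d → ℝ} (hq : IsTest q) {ε : ℝ} (hε : 0 < ε) :
    IsTest (dilate q ε) := by
  constructor
  · have : ContDiff ℝ ∞ fun x : Eucl d => ε⁻¹ • x := by fun_prop
    exact contDiff_const.mul (hq.smooth.comp this)
  · exact HasCompactSupport.mul_left
      (hq.compact.comp_homeomorph (Homeomorph.smulOfNeZero ε⁻¹ (inv_ne_zero hε.ne')))

theorem IsTest.exists_kernelBound {q : Eucl d → ℝ} (hq : IsTest q) :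
    ∃ G : ℝ, 1 ≤ G ∧ ∀ ε, 0 < ε → KernelBound (_root_.dilate q ε) G ε := by
  obtain ⟨C, hC⟩ := hq.continuous.bounded_above_of_compact_support hq.compact
  obtain ⟨K, hK⟩ := ContDiff.lipschitzWith_of_hasCompactSupport hq.compact hq.smooth (by simp)
  obtain ⟨R, hR⟩ := hq.compact.isCompact.isBounded.exists_norm_le
  refine ⟨max 1 (max C (max K R)), le_max_left _ _, fun ε hε => ⟨fun x => ?_, fun x y => ?_,
    fun x hx => ?_⟩⟩
  · rw [_root_.dilate, abs_mul, abs_of_pos (by positivity : 0 < (ε ^ d)⁻¹), div_eq_inv_mul]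
    gcongr
    exact (hC _).trans ((le_max_left _ _).trans (le_max_right _ _))
  · rw [_root_.dilate, _root_.dilate, ← mul_sub, abs_mul,
      abs_of_pos (by positivity : 0 < (ε ^ d)⁻¹)]
    have h := hK.dist_le_mul (ε⁻¹ • x) (ε⁻¹ • y)
    rw [Real.dist_eq, dist_eq_norm, ← smul_sub, norm_smul, norm_inv, Real.norm_of_nonneg hε.le] at h
    calc (ε ^ d)⁻¹ * |q (ε⁻¹ • x) - q (ε⁻¹ • y)| ≤ (ε ^ d)⁻¹ * (K * (ε⁻¹ * ‖x - y‖)) := by gcongr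
      _ = K / ε ^ (d + 1) * ‖x - y‖ := by rw [pow_succ]; field_simp
      _ ≤ _ := by
        gcongr
        exact (le_max_left _ _).trans ((le_max_right _ _).trans (le_max_right _ _))
  · rw [_root_.dilate]
    by_contra hne
    have h1 : ‖ε⁻¹ • x‖ ≤ R := hR _ (subset_tsupport _ (right_ne_zero_of_mul hne))
    rw [norm_smul, norm_inv, Real.norm_of_nonneg hε.le, inv_mul_le_iff₀ hε] at h1
    have h2 : R ≤ max 1 (max C (max K R)) :=
      (le_max_right _ _).trans ((le_max_right _ _).trans (le_max_right _ _))
    nlinarith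

theorem KernelBound.mono {q : Eucl d → ℝ} {G G' ε : ℝ} (hq : KernelBound q G ε) (hε : 0 < ε)
    (hG : G ≤ G') : KernelBound q G' ε where
  bound x := (hq.bound x).trans (by gcongr)
  lip x y := (hq.lip x y).trans (by gcongr)
  supp x hx := hq.supp x (lt_of_le_of_lt (by gcongr) hx)

theorem KernelBound.integrable_sub {q : Eucl d → ℝ} {G ε : ℝ} (hq : KernelBound q G ε)
    (ν : Measure (Eucl d)) [IsFiniteMeasure ν] (x : Eucl d) : Integrable (fun u => q (x - u)) ν :=
  Integrable.of_bound (hq.continuous.comp (by fun_prop)).aestronglyMeasurable (G / ε ^ d)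
    (Filter.Eventually.of_forall fun _ => hq.bound _)

/-- Averaging over shifts preserves the size and Lipschitz bounds; shifts by at most `G * ε` at most
double the radius of the support, whence `2 * G`. -/
theorem KernelBound.mollify {q : Eucl d → ℝ} {G ε δ : ℝ} (hq : KernelBound q G ε) (hG : 0 ≤ G)
    (hδε : δ ≤ ε) (hε : 0 < ε) {ν : Measure (Eucl d)} [IsProbabilityMeasure ν]
    (hν : ∀ᵐ u ∂ν, ‖u‖ ≤ G * δ) : KernelBound (mollify q ν) (2 * G) ε where
  bound x := by
    have h : |_root_.mollify q ν x| ≤ G / ε ^ d := by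
      have := norm_integral_le_of_norm_le_const (μ := ν) (f := fun u => q (x - u))
        (Filter.Eventually.of_forall fun u => hq.bound (x - u))
      simpa [_root_.mollify] using this
    refine h.trans ?_
    gcongr
    linarith
  lip x y := by
    have h : |_root_.mollify q ν x - _root_.mollify q ν y| ≤ G / ε ^ (d + 1) * ‖x - y‖ := by
      rw [_root_.mollify, _root_.mollify,
        ← integral_sub (hq.integrable_sub ν x) (hq.integrable_sub ν y)]
      have := norm_integral_le_of_norm_le_const (μ := ν) (f := fun u => q (x - u) - q (y - u))
        (C := G / ε ^ (d + 1) * ‖x - y‖) (Filter.Eventually.of_forall fun u => by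
          have := hq.lip (x - u) (y - u)
          rwa [sub_sub_sub_cancel_right] at this)
      simpa using this
    refine h.trans ?_
    gcongr
    linarith
  supp x hx := by
    refine integral_eq_zero_of_ae ?_
    filter_upwards [hν] with u hu
    refine hq.supp _ ?_
    have h1 := norm_sub_norm_le x u
    have h2 : G * δ ≤ G * ε := by gcongr
    linarith

/-- The measure with density `p`. -/
noncomputable def densityMeasure (p : Eucl d → ℝ) : Measure (Eucl d) :=
  volume.withDensity fun x => ENNReal.ofReal (p x)

/-- Smooth compactly supported probability densities. -/
structure IsBump (p : Eucl d → ℝ) : Prop extends IsTest p where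
  nonneg : ∀ x, 0 ≤ p x
  integral_eq : ∫ x, p x = 1

theorem IsBump.isProbabilityMeasure {p : Eucl d → ℝ} (hp : IsBump p) :
    IsProbabilityMeasure (densityMeasure p) := by
  constructor
  rw [densityMeasure, withDensity_apply _ MeasurableSet.univ, Measure.restrict_univ,
    ← ofReal_integral_eq_lintegral_ofReal hp.integrable (Filter.Eventually.of_forall hp.nonneg),
    hp.integral_eq, ENNReal.ofReal_one]

theorem IsBump.integral_densityMeasure {F : Type*} [NormedAddCommGroup F] [NormedSpace ℝ F]
    {p : Eucl d → ℝ} (hp : IsBump p) (f : Eucl d → F) :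
    ∫ x, f x ∂(densityMeasure p) = ∫ x, p x • f x := by
  rw [densityMeasure, integral_withDensity_eq_integral_toReal_smul₀
    hp.continuous.measurable.ennreal_ofReal.aemeasurable (by simp)]
  simp [ENNReal.toReal_ofReal (hp.nonneg _)]

theorem IsBump.ae_norm_le {p : Eucl d → ℝ} (hp : IsBump p) {G δ : ℝ} (h : KernelBound p G δ) :
    ∀ᵐ u ∂(densityMeasure p), ‖u‖ ≤ G * δ := by
  rw [densityMeasure, ae_withDensity_iff hp.continuous.measurable.ennreal_ofReal]
  refine Filter.Eventually.of_forall fun u hu => ?_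
  by_contra! hlt
  exact hu (by simp [h.supp u hlt])

/-- Lets mollifiers at two scales be compared through their common convolution, each being averaged
over translations of the size of the other. -/
theorem IsBump.mollify_densityMeasure_comm {p q : Eucl d → ℝ} (hp : IsBump p) (hq : IsBump q) :
    mollify p (densityMeasure q) = mollify q (densityMeasure p) := by
  ext x
  rw [mollify, mollify, hp.integral_densityMeasure, hq.integral_densityMeasure,
    ← integral_sub_left_eq_self _ volume x]
  simp [mul_comm]

theorem IsBump.fourierMeasure_densityMeasure {p : Eucl d → ℝ} (hp : IsBump p) (ξ : Eucl d) :
    fourierMeasure (densityMeasure p) ξ = 𝓕 (fun x => (p x : ℂ)) ξ := by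
  rw [fourierMeasure, hp.integral_densityMeasure, Real.fourier_eq]
  refine integral_congr_ae (Filter.Eventually.of_forall fun x => ?_)
  simp [Circle.smul_def, mul_comm]

theorem fourier_dilate (q : Eucl d → ℝ) {ε : ℝ} (hε : 0 < ε) (ξ : Eucl d) :
    𝓕 (fun x => (dilate q ε x : ℂ)) ξ = 𝓕 (fun x => (q x : ℂ)) (ε • ξ) := by
  have h := Measure.integral_comp_inv_smul_of_nonneg (volume : Measure (Eucl d))
    (fun y => Real.fourierChar (-inner ℝ y (ε • ξ)) • (q y : ℂ)) hε.le
  simp only [finrank_euclideanSpace, Fintype.card_fin] at h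
  rw [Real.fourier_eq, Real.fourier_eq, ← inv_smul_eq_iff₀ (by positivity : ε ^ d ≠ 0)] at *
  rw [← h, ← integral_smul]
  refine integral_congr_ae (Filter.Eventually.of_forall fun x => ?_)
  have e : inner ℝ (ε⁻¹ • x) (ε • ξ) = inner ℝ x ξ := by
    rw [real_inner_smul_left, real_inner_smul_right, inv_mul_cancel_left₀ hε.ne']
  simp only [dilate, e, Circle.smul_def, smul_eq_mul, Complex.real_smul]
  push_cast
  ring

theorem IsBump.dilate {p : Eucl d → ℝ} (hp : IsBump p) {ε : ℝ} (hε : 0 < ε) :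
    IsBump (dilate p ε) where
  toIsTest := hp.toIsTest.dilate hε
  nonneg x := mul_nonneg (by positivity) (hp.nonneg _)
  integral_eq := by
    simp only [_root_.dilate]
    rw [integral_const_mul, Measure.integral_comp_inv_smul_of_nonneg _ p hε.le, hp.integral_eq]
    simp [hε.ne']

theorem exists_isBump (d : ℕ) : ∃ p : Eucl d → ℝ, IsBump p ∧ ∃ c, 0 < c ∧ ∀ x, ‖x‖ ≤ 1 → c ≤ p x := by
  let f : ContDiffBump (0 : Eucl d) := ⟨1, 2, by norm_num, by norm_num⟩
  refine ⟨f.normed volume, ⟨⟨f.contDiff_normed, f.hasCompactSupport_normed⟩, f.nonneg_normed,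
    f.integral_normed⟩, (∫ x, f x)⁻¹, inv_pos.2 f.integral_pos, fun x hx => ?_⟩
  rw [ContDiffBump.normed_def, f.one_of_mem_closedBall (by simpa using hx), one_div]

theorem IsTest.norm_fourier_le {q : Eucl d → ℝ} (ξ : Eucl d) :
    ‖𝓕 (fun x => (q x : ℂ)) ξ‖ ≤ ∫ x, |q x| := by
  rw [Real.fourier_eq]
  refine (norm_integral_le_integral_norm _).trans (le_of_eq ?_)
  refine integral_congr_ae (Filter.Eventually.of_forall fun x => ?_)
  simp [Circle.norm_smul]

theorem IsBump.exists_norm_one_sub_fourier_le {p : Eucl d → ℝ} (hp : IsBump p) :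
    ∃ C, 0 ≤ C ∧ ∀ ξ, ‖1 - 𝓕 (fun x => (p x : ℂ)) ξ‖ ≤ C * ‖ξ‖ := by
  obtain ⟨G, hG, h⟩ := hp.exists_kernelBound
  have h1 : KernelBound p G 1 := by
    have := h 1 one_pos
    rwa [show _root_.dilate p 1 = p by ext; simp [_root_.dilate]] at this
  have := hp.isProbabilityMeasure
  refine ⟨2 * Real.pi * G, by positivity, fun ξ => ?_⟩
  rw [← hp.fourierMeasure_densityMeasure, fourierMeasure]
  have hint : Integrable (fun u : Eucl d => (Real.fourierChar (-inner ℝ u ξ) : ℂ))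
      (densityMeasure p) := by
    refine Integrable.of_bound (C := 1) (Continuous.aestronglyMeasurable (by fun_prop))
      (Filter.Eventually.of_forall fun u => (Circle.norm_coe _).le)
  have e : (1 : ℂ) = ∫ _u, (1 : ℂ) ∂(densityMeasure p) := by simp
  rw [e, ← integral_sub (integrable_const _) hint]
  refine (norm_integral_le_of_norm_le_const (C := 2 * Real.pi * G * ‖ξ‖) ?_).trans (by simp)
  filter_upwards [hp.ae_norm_le h1] with u hu
  rw [norm_sub_rev, Real.fourierChar_apply, mul_comm _ Complex.I]
  refine Real.norm_exp_I_mul_ofReal_sub_one_le.trans ?_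
  rw [Real.norm_eq_abs, abs_mul, abs_neg, abs_of_pos (by positivity), mul_assoc (2 * Real.pi)]
  gcongr
  refine (abs_real_inner_le_norm u ξ).trans ?_
  gcongr
  linarith

/-- Test functions whose Fourier transform is flat at the origin to any given order. -/
theorem exists_isTest_flat (d N : ℕ) : ∃ q : Eucl d → ℝ, IsTest q ∧
    ∃ C, 0 ≤ C ∧ ∀ ξ, ‖1 - 𝓕 (fun x => (q x : ℂ)) ξ‖ ≤ C * ‖ξ‖ ^ (N + 1) := by
  obtain ⟨p, hp, -⟩ := exists_isBump d
  obtain ⟨C₁, hC₁, h₁⟩ := hp.exists_norm_one_sub_fourier_le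
  have := hp.isProbabilityMeasure
  obtain ⟨G, hG, hk⟩ := hp.exists_kernelBound
  have hk1 : KernelBound p G 1 := by
    have := hk 1 one_pos
    rwa [show dilate p 1 = p by ext; simp [dilate]] at this
  have hcar : densityMeasure p (Metric.closedBall 0 (G * 1))ᶜ = 0 := by
    have := hp.ae_norm_le hk1
    rw [ae_iff] at this
    convert this using 2
    ext; simp
  induction N with
  | zero => exact ⟨p, hp.toIsTest, C₁, hC₁, by simpa using h₁⟩
  | succ N ih =>
    obtain ⟨q, hq, C, hC, h⟩ := ih
    have hm : IsTest (mollify q (densityMeasure p)) :=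
      isTest_mollify hq (isCompact_closedBall 0 (G * 1)) hcar
    -- For this combination `1 - q̂ - p̂ + q̂ p̂ = (1 - q̂)(1 - p̂)`, so each step gains one order
    -- of vanishing at the origin.
    refine ⟨fun x => (q x + p x) - mollify q (densityMeasure p) x,
      (hq.add hp.toIsTest).sub hm, C * C₁, by positivity, fun ξ => ?_⟩
    have e : 𝓕 (fun x => (((q x + p x) - mollify q (densityMeasure p) x : ℝ) : ℂ)) ξ =
        𝓕 (fun x => (q x : ℂ)) ξ + 𝓕 (fun x => (p x : ℂ)) ξ -
          𝓕 (fun x => (q x : ℂ)) ξ * 𝓕 (fun x => (p x : ℂ)) ξ := by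
      rw [← hp.fourierMeasure_densityMeasure, ← fourier_mollify hq, hp.fourierMeasure_densityMeasure]
      have e1 : (fun x => (((q x + p x) - mollify q (densityMeasure p) x : ℝ) : ℂ)) =
          (hq.toSchwartz + hp.toSchwartz - hm.toSchwartz : 𝓢(Eucl d, ℂ)) := by
        ext x
        simp [IsTest.coe_toSchwartz]
      rw [e1, ← SchwartzMap.fourier_coe, sub_eq_add_neg, FourierAdd.fourier_add,
        FourierAdd.fourier_add, FourierTransform.fourier_neg]
      rfl
    rw [e, show (1 : ℂ) - (𝓕 (fun x => (q x : ℂ)) ξ + 𝓕 (fun x => (p x : ℂ)) ξ -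
          𝓕 (fun x => (q x : ℂ)) ξ * 𝓕 (fun x => (p x : ℂ)) ξ) =
        (1 - 𝓕 (fun x => (q x : ℂ)) ξ) * (1 - 𝓕 (fun x => (p x : ℂ)) ξ) by ring, norm_mul,
      pow_succ, mul_mul_mul_comm]
    gcongr
    · exact h ξ
    · exact h₁ ξ

end Kernels

/-! ### Energy estimates for Frostman measures -/

section Energy

variable {d : ℕ}

theorem IsFrostman.exists_closedBall_le {μ : Measure (Eucl d)} [IsProbabilityMeasure μ]
    {E : Set (Eucl d)} {α : ℝ≥0} (h : IsFrostman μ E α) :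
    ∃ C : ℝ, 0 ≤ C ∧ ∀ x r, 0 < r → μ.real (Metric.closedBall x r) ≤ C * r ^ (α : ℝ) := by
  obtain ⟨h0, C, hC⟩ := h
  refine ⟨C * 3 ^ (α : ℝ), by positivity, fun x r hr => ?_⟩
  by_cases hne : (E ∩ Metric.closedBall x r).Nonempty
  · obtain ⟨e, he, hex⟩ := hne
    -- The Frostman bound is given at centres in `E` only; recentring at a point of `E` triples the
    -- radius.
    have hsub : Metric.closedBall x r ⊆ Metric.ball e (3 * r) := by
      intro y hy
      rw [Metric.mem_closedBall] at hy hex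
      rw [Metric.mem_ball]
      have := dist_triangle_right y e x
      linarith
    have h1 := (measure_mono hsub).trans (hC e he (3 * r) (by positivity))
    rw [measureReal_def]
    refine (ENNReal.toReal_mono (ENNReal.mul_ne_top ENNReal.coe_ne_top ENNReal.ofReal_ne_top)
      h1).trans (le_of_eq ?_)
    rw [ENNReal.toReal_mul, ENNReal.coe_toReal, ENNReal.toReal_ofReal (by positivity),
      Real.mul_rpow (by norm_num) hr.le, mul_assoc]
  · have : Metric.closedBall x r ⊆ Eᶜ := fun y hy hyE => hne ⟨y, hyE, hy⟩
    have h2 : μ (Metric.closedBall x r) = 0 := measure_mono_null this h0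
    rw [measureReal_def, h2]
    simp only [ENNReal.toReal_zero]
    positivity

theorem mollify_nonneg {p : Eucl d → ℝ} (hp : ∀ x, 0 ≤ p x) (μ : Measure (Eucl d)) (x : Eucl d) :
    0 ≤ mollify p μ x := integral_nonneg fun _ => hp _

theorem IsFrostman.exists_mollify_le {μ : Measure (Eucl d)} [IsProbabilityMeasure μ]
    {E : Set (Eucl d)} {α : ℝ≥0} (h : IsFrostman μ E α) {p : Eucl d → ℝ} (hp : IsBump p) :
    ∃ C : ℝ, 0 ≤ C ∧ ∀ δ, 0 < δ → ∀ x, mollify (dilate p δ) μ x ≤ C * δ ^ (-((d : ℝ) - α)) := by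
  obtain ⟨C, hC, hball⟩ := h.exists_closedBall_le
  obtain ⟨G, hG, hk⟩ := hp.exists_kernelBound
  refine ⟨G * (C * G ^ (α : ℝ)), by positivity, fun δ hδ x => ?_⟩
  have hk := hk δ hδ
  have h1 : mollify (dilate p δ) μ x ≤
      ∫ u, (Metric.closedBall x (G * δ)).indicator (fun _ => G / δ ^ d) u ∂μ := by
    refine integral_mono (hk.integrable_sub μ x)
      ((integrable_const _).indicator Metric.isClosed_closedBall.measurableSet) fun u => ?_
    by_cases hu : u ∈ Metric.closedBall x (G * δ)
    · simp only [Set.indicator_of_mem hu]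
      exact (le_abs_self _).trans (hk.bound _)
    · simp only [Set.indicator_of_notMem hu]
      rw [hk.supp]
      rw [Metric.mem_closedBall, dist_comm, dist_eq_norm] at hu
      linarith
  rw [integral_indicator_const _ Metric.isClosed_closedBall.measurableSet, smul_eq_mul] at h1
  refine h1.trans ?_
  calc μ.real (Metric.closedBall x (G * δ)) * (G / δ ^ d)
      ≤ (C * (G * δ) ^ (α : ℝ)) * (G / δ ^ d) := by
        gcongr
        exact hball _ _ (by positivity)
    _ = G * (C * G ^ (α : ℝ)) * δ ^ (-((d : ℝ) - α)) := by
        rw [Real.mul_rpow (by positivity) hδ.le, neg_sub, Real.rpow_sub hδ, Real.rpow_natCast]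
        ring

theorem eLpNorm_two_eq {F : Type*} [NormedAddCommGroup F] (f : Eucl d → F) :
    eLpNorm f 2 volume = (∫⁻ x, ‖f x‖ₑ ^ 2) ^ (1 / 2 : ℝ) := by
  rw [eLpNorm_eq_lintegral_rpow_enorm_toReal (by norm_num) (by norm_num)]
  simp

/-- In `∫ f²` one factor is bounded by the supremum of `f` and the other has integral one. So the
square of the `L²` norm obeys the same bound as the supremum. -/
theorem IsFrostman.exists_lintegral_mollify_le {μ : Measure (Eucl d)} [IsProbabilityMeasure μ]
    {E : Set (Eucl d)} (hE : IsCompact E) {α : ℝ≥0} (h : IsFrostman μ E α) {p : Eucl d → ℝ}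
    (hp : IsBump p) : ∃ C : ℝ, 0 ≤ C ∧ ∀ δ, 0 < δ →
      ∫⁻ x, ‖mollify (dilate p δ) μ x‖ₑ ^ 2 ≤ ENNReal.ofReal (C * δ ^ (-((d : ℝ) - α))) := by
  obtain ⟨C, hC, hle⟩ := h.exists_mollify_le hp
  refine ⟨C, hC, fun δ hδ => ?_⟩
  have hpd := hp.dilate hδ
  set f := mollify (dilate p δ) μ with hf
  have hft : IsTest f := isTest_mollify hpd.toIsTest hE h.1
  have hf0 : ∀ x, 0 ≤ f x := mollify_nonneg hpd.nonneg μ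
  have h1 := integral_mul_mollify_of_memLp hpd.toIsTest (hft.memLp 2) μ
  have h2 : ∫ y, f y * f y ≤ C * δ ^ (-((d : ℝ) - α)) := by
    rw [hf, h1.2]
    have h3 : ∀ v, ∫ y, f y * dilate p δ (y - v) ≤ C * δ ^ (-((d : ℝ) - α)) := by
      intro v
      have h4 : ∫ y, f y * dilate p δ (y - v) ≤
          ∫ y, C * δ ^ (-((d : ℝ) - α)) * dilate p δ (y - v) := by
        refine integral_mono ?_ (((hpd.toIsTest.translate v).integrable).const_mul _) fun y => ?_
        · exact (hpd.toIsTest.translate v).integrable_mul (𝕜 := ℝ)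
            hft.continuous.locallyIntegrable
        · exact mul_le_mul_of_nonneg_right (hle δ hδ y) (hpd.nonneg _)
      rw [integral_const_mul, integral_sub_right_eq_self (fun y => dilate p δ y) v,
        hpd.integral_eq, mul_one] at h4
      exact h4
    refine (integral_mono h1.1 (integrable_const _) h3).trans (by simp)
  have h5 : ∫⁻ x, ‖f x‖ₑ ^ 2 = ENNReal.ofReal (∫ y, f y * f y) := by
    have hi : Integrable (fun y => f y * f y) volume :=
      hft.integrable_mul (𝕜 := ℝ) hft.continuous.locallyIntegrable
    rw [ofReal_integral_eq_lintegral_ofReal hi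
      (Filter.Eventually.of_forall fun x => mul_nonneg (hf0 x) (hf0 x))]
    refine lintegral_congr fun x => ?_
    rw [Real.enorm_eq_ofReal (hf0 x), ← ENNReal.ofReal_pow (hf0 x), sq]
  rw [h5]
  exact ENNReal.ofReal_le_ofReal h2

theorem IsTest.fourier_toLp {g : Eucl d → ℝ} (hg : IsTest g) :
    (𝓕 (hg.toSchwartz.toLp 2) : Lp ℂ 2 (volume : Measure (Eucl d))) =ᵐ[volume]
      𝓕 (fun x => (g x : ℂ)) := by
  rw [SchwartzMap.toLp_fourier_eq]
  exact SchwartzMap.coeFn_toLp _ _ _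

theorem IsTest.lintegral_fourier {g : Eucl d → ℝ} (hg : IsTest g) :
    ∫⁻ ξ, ‖𝓕 (fun x => (g x : ℂ)) ξ‖ₑ ^ 2 = ∫⁻ x, ‖g x‖ₑ ^ 2 := by
  have h := Lp.norm_fourier_eq (hg.toSchwartz.toLp 2)
  rw [Lp.norm_def, Lp.norm_def, ENNReal.toReal_eq_toReal_iff' (Lp.eLpNorm_ne_top _)
    (Lp.eLpNorm_ne_top _), eLpNorm_congr_ae hg.fourier_toLp,
    eLpNorm_congr_ae (SchwartzMap.coeFn_toLp _ _ _), eLpNorm_two_eq, eLpNorm_two_eq] at h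
  have h2 := ENNReal.rpow_left_injective (by norm_num : (1 / 2 : ℝ) ≠ 0) h
  rw [h2]
  refine lintegral_congr fun x => ?_
  rw [hg.coe_toSchwartz, ← ofReal_norm, Complex.norm_real, ofReal_norm]

/-- The energy of a Frostman measure at frequencies at most `R`. -/
theorem IsFrostman.exists_lintegral_fourierMeasure_le {μ : Measure (Eucl d)}
    [IsProbabilityMeasure μ] {E : Set (Eucl d)} (hE : IsCompact E) {α : ℝ≥0}
    (h : IsFrostman μ E α) : ∃ C : ℝ, 0 ≤ C ∧ ∀ R, 0 < R →
      ∫⁻ ξ in Metric.closedBall 0 R, ‖fourierMeasure μ ξ‖ₑ ^ 2 ≤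
        ENNReal.ofReal (C * R ^ ((d : ℝ) - α)) := by
  obtain ⟨p, hp, -⟩ := exists_isBump d
  obtain ⟨C₁, hC₁, h₁⟩ := hp.exists_norm_one_sub_fourier_le
  obtain ⟨C, hC, hle⟩ := h.exists_lintegral_mollify_le hE hp
  -- The choice gives `C₁ * r ≤ 1/2`, so `|p̂| ≥ 1/2` on the ball of radius `r`. Mollifying at scale
  -- `r / R` therefore loses at most a factor 2 at frequencies up to `R`.
  set r := 1 / (2 * (C₁ + 1)) with hr
  have hr0 : 0 < r := by positivity
  refine ⟨4 * (C * r ^ (-((d : ℝ) - α))), by positivity, fun R hR => ?_⟩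
  have hδ : 0 < r / R := by positivity
  have hpd := hp.dilate hδ
  have hF : ∀ ξ, 𝓕 (fun x => (mollify (dilate p (r / R)) μ x : ℂ)) ξ =
      𝓕 (fun x => (p x : ℂ)) ((r / R) • ξ) * fourierMeasure μ ξ := fun ξ => by
    rw [fourier_mollify hpd.toIsTest, fourier_dilate _ hδ]
  have hpt : ∀ ξ ∈ Metric.closedBall (0 : Eucl d) R, ‖fourierMeasure μ ξ‖ₑ ^ 2 ≤
      ENNReal.ofReal 4 * ‖𝓕 (fun x => (mollify (dilate p (r / R)) μ x : ℂ)) ξ‖ₑ ^ 2 := by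
    intro ξ hξ
    rw [mem_closedBall_zero_iff] at hξ
    have h2 : ‖(r / R) • ξ‖ ≤ r := by
      rw [norm_smul, Real.norm_of_nonneg hδ.le, div_mul_eq_mul_div, div_le_iff₀ hR]
      gcongr
    have h3 : (1 / 2 : ℝ) ≤ ‖𝓕 (fun x => (p x : ℂ)) ((r / R) • ξ)‖ := by
      have h4 := (h₁ ((r / R) • ξ)).trans (mul_le_mul_of_nonneg_left h2 hC₁)
      have h5 := norm_sub_norm_le (1 : ℂ) (𝓕 (fun x => (p x : ℂ)) ((r / R) • ξ))
      have h6 : C₁ * r ≤ 1 / 2 := by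
        rw [hr, mul_one_div, div_le_iff₀ (by positivity)]
        linarith
      rw [norm_one] at h5
      linarith
    have h7 : ‖fourierMeasure μ ξ‖ ^ 2 ≤
        4 * ‖𝓕 (fun x => (mollify (dilate p (r / R)) μ x : ℂ)) ξ‖ ^ 2 := by
      rw [hF, norm_mul, mul_pow, ← mul_assoc]
      refine le_mul_of_one_le_left (by positivity) ?_
      nlinarith
    rw [← ofReal_norm, ← ofReal_norm, ← ENNReal.ofReal_pow (norm_nonneg _),
      ← ENNReal.ofReal_pow (norm_nonneg _), ← ENNReal.ofReal_mul (by norm_num)]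
    exact ENNReal.ofReal_le_ofReal h7
  have hft : IsTest (mollify (dilate p (r / R)) μ) := isTest_mollify hpd.toIsTest hE h.1
  calc ∫⁻ ξ in Metric.closedBall 0 R, ‖fourierMeasure μ ξ‖ₑ ^ 2
      ≤ ∫⁻ ξ in Metric.closedBall 0 R, ENNReal.ofReal 4 *
          ‖𝓕 (fun x => (mollify (dilate p (r / R)) μ x : ℂ)) ξ‖ₑ ^ 2 :=
        setLIntegral_mono' Metric.isClosed_closedBall.measurableSet hpt
    _ ≤ ∫⁻ ξ, ENNReal.ofReal 4 *
          ‖𝓕 (fun x => (mollify (dilate p (r / R)) μ x : ℂ)) ξ‖ₑ ^ 2 := setLIntegral_le_lintegral _ _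
    _ = ENNReal.ofReal 4 * ∫⁻ x, ‖mollify (dilate p (r / R)) μ x‖ₑ ^ 2 := by
        rw [lintegral_const_mul' _ _ ENNReal.ofReal_ne_top, hft.lintegral_fourier]
    _ ≤ ENNReal.ofReal 4 * ENNReal.ofReal (C * (r / R) ^ (-((d : ℝ) - α))) := by
        gcongr
        exact hle _ hδ
    _ = ENNReal.ofReal (4 * (C * r ^ (-((d : ℝ) - α))) * R ^ ((d : ℝ) - α)) := by
        rw [← ENNReal.ofReal_mul (by norm_num), Real.div_rpow hr0.le hR.le,
          Real.rpow_neg hR.le ((d : ℝ) - α), div_inv_eq_mul]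
        ring_nf

/-- The `L²_{-s}` norm of a test function. -/
noncomputable def dualNorm (s : ℝ) (g : Eucl d → ℝ) : ℝ≥0∞ :=
  eLpNorm (fun ξ => (((1 + ‖ξ‖ ^ 2) ^ (-(s / 2)) : ℝ) : ℂ) * 𝓕 (fun x => (g x : ℂ)) ξ) 2 volume

/-- The index `j` is that of the dyadic shell `2^j ≤ ετ < 2^(j+1)`, where the Sobolev weight decays.
All `ετ < 1` are put into `j = 0`; there the weight may be much larger than `ε^(2s)`, and the
vanishing of order `N ≥ s` compensates. -/
theorem weight_le {s τ ε : ℝ} (hs : 0 < s) {N : ℕ} (hN : s ≤ N) (hτ : 0 ≤ τ) (hε : 0 < ε) :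
    ∃ j : ℕ, τ ≤ 2 ^ (j + 1) / ε ∧
      (1 + τ ^ 2) ^ (-s) * min 1 ((ε * τ) ^ N) ^ 2 ≤ ε ^ (2 * s) * (2 ^ (-(2 * s))) ^ j := by
  rcases hτ.eq_or_lt with rfl | hτ
  · have hN0 : N ≠ 0 := by
      rintro rfl
      norm_num at hN
      linarith
    refine ⟨0, by positivity, ?_⟩
    rw [mul_zero, zero_pow hN0]
    simp only [zero_le_one, inf_of_le_right]
    rw [zero_pow two_ne_zero, mul_zero]
    positivity
  have hw : (1 + τ ^ 2) ^ (-s) ≤ ε ^ (2 * s) * (ε * τ) ^ (-(2 * s)) := by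
    calc (1 + τ ^ 2) ^ (-s) ≤ (τ ^ 2) ^ (-s) :=
          Real.rpow_le_rpow_of_nonpos (by positivity) (by linarith) (by linarith)
      _ = ε ^ (2 * s) * (ε * τ) ^ (-(2 * s)) := by
          rw [← Real.rpow_natCast, ← Real.rpow_mul hτ.le, Real.mul_rpow hε.le hτ.le, ← mul_assoc,
            ← Real.rpow_add hε, add_neg_cancel, Real.rpow_zero, one_mul]
          congr 1
          push_cast
          ring
  have hετ : 0 < ε * τ := by positivity
  rcases le_or_gt 1 (ε * τ) with h1 | h1
  · obtain ⟨j, hj1, hj2⟩ := exists_nat_pow_near h1 (one_lt_two)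
    refine ⟨j, ?_, ?_⟩
    · rw [le_div_iff₀ hε, mul_comm]
      exact hj2.le
    · have h2 : (ε * τ) ^ (-(2 * s)) ≤ (2 ^ (-(2 * s))) ^ j := by
        rw [← Real.rpow_natCast, ← Real.rpow_mul (by norm_num), mul_comm (-(2 * s)),
          Real.rpow_mul (by norm_num), Real.rpow_natCast]
        exact Real.rpow_le_rpow_of_nonpos (by positivity) hj1 (by linarith)
      have h3 : min 1 ((ε * τ) ^ N) ^ 2 ≤ 1 :=
        pow_le_one₀ (le_min zero_le_one (by positivity)) (min_le_left _ _)
      calc (1 + τ ^ 2) ^ (-s) * min 1 ((ε * τ) ^ N) ^ 2 ≤ (1 + τ ^ 2) ^ (-s) * 1 := by gcongr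
        _ ≤ ε ^ (2 * s) * (ε * τ) ^ (-(2 * s)) := by rw [mul_one]; exact hw
        _ ≤ _ := by gcongr
  · refine ⟨0, ?_, ?_⟩
    · rw [le_div_iff₀ hε, mul_comm]
      norm_num
      linarith
    · have h3 : min 1 ((ε * τ) ^ N) ^ 2 ≤ (ε * τ) ^ (2 * s) := by
        calc min 1 ((ε * τ) ^ N) ^ 2 ≤ ((ε * τ) ^ N) ^ 2 := by
              gcongr
              exact min_le_right _ _
          _ = (ε * τ) ^ (2 * (N : ℝ)) := by
              rw [← pow_mul, ← Real.rpow_natCast]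
              congr 1
              push_cast
              ring
          _ ≤ _ := Real.rpow_le_rpow_of_exponent_ge hετ h1.le (by linarith)
      calc (1 + τ ^ 2) ^ (-s) * min 1 ((ε * τ) ^ N) ^ 2
          ≤ (ε ^ (2 * s) * (ε * τ) ^ (-(2 * s))) * (ε * τ) ^ (2 * s) := by gcongr
        _ = _ := by
          rw [mul_assoc, ← Real.rpow_add hετ, neg_add_cancel, Real.rpow_zero, pow_zero]

/-- The shell `j` has weight `ε^(2s) 2^(-2sj)` and energy at most a constant times `(2^(j+1)/ε)^β`.
The resulting series is geometric with ratio `2^(β - 2s) < 1` and sums to a multiple of `ε^(2s -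
β)`, of which the square root is taken. -/
theorem IsFrostman.exists_dualNorm_le {μ : Measure (Eucl d)} [IsProbabilityMeasure μ]
    {E : Set (Eucl d)} (hE : IsCompact E) {α : ℝ≥0} (h : IsFrostman μ E α) {s : ℝ} {N : ℕ}
    (hα : (α : ℝ) < d) (hs : (d : ℝ) - α < 2 * s) (hN : s ≤ N) : ∃ C : ℝ, 0 ≤ C ∧
      ∀ ε A (g : Eucl d → ℝ), 0 < ε → 0 ≤ A →
        (∀ ξ, ‖𝓕 (fun x => (g x : ℂ)) ξ‖ ≤ A * min 1 ((ε * ‖ξ‖) ^ N) * ‖fourierMeasure μ ξ‖) →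
        dualNorm s g ≤ ENNReal.ofReal (C * A * ε ^ (s - ((d : ℝ) - α) / 2)) := by
  obtain ⟨C, hC, hle⟩ := h.exists_lintegral_fourierMeasure_le hE
  set β := (d : ℝ) - α with hβ
  have hβ0 : 0 < β := by rw [hβ]; linarith
  have hs0 : 0 < s := by linarith
  set θ : ℝ := 2 ^ (β - 2 * s) with hθ
  have hθ0 : 0 < θ := by positivity
  have hθ1 : θ < 1 := Real.rpow_lt_one_of_one_lt_of_neg one_lt_two (by linarith)
  have hθ2 : 0 < 1 - θ := by linarith
  refine ⟨Real.sqrt (C * 2 ^ β * (1 - θ)⁻¹), by positivity, fun ε A g hε hA hg => ?_⟩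
  -- Each `ξ` is estimated by one term of the series, so balls can be used in place of disjoint
  -- shells.
  have hpt : ∀ ξ, ‖(((1 + ‖ξ‖ ^ 2) ^ (-(s / 2)) : ℝ) : ℂ) * 𝓕 (fun x => (g x : ℂ)) ξ‖ₑ ^ 2 ≤
      ∑' j : ℕ, ENNReal.ofReal (A ^ 2 * ε ^ (2 * s) * (2 ^ (-(2 * s))) ^ j) *
        (Metric.closedBall 0 (2 ^ (j + 1) / ε)).indicator (fun ξ => ‖fourierMeasure μ ξ‖ₑ ^ 2) ξ := by
    intro ξ
    obtain ⟨j, hj1, hj2⟩ := weight_le hs0 hN (norm_nonneg ξ) hε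
    refine le_trans ?_ (ENNReal.le_tsum j)
    rw [Set.indicator_of_mem (by simpa using hj1)]
    rw [← ofReal_norm, ← ofReal_norm, ← ENNReal.ofReal_pow (norm_nonneg _),
      ← ENNReal.ofReal_pow (norm_nonneg _), ← ENNReal.ofReal_mul (by positivity)]
    refine ENNReal.ofReal_le_ofReal ?_
    rw [norm_mul, Complex.norm_real, Real.norm_of_nonneg (by positivity), mul_pow,
      ← Real.rpow_natCast ((1 + ‖ξ‖ ^ 2) ^ (-(s / 2))), ← Real.rpow_mul (by positivity)]
    have e : -(s / 2) * ((2 : ℕ) : ℝ) = -s := by push_cast; ring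
    rw [e]
    have hm : 0 ≤ min 1 ((ε * ‖ξ‖) ^ N) := le_min zero_le_one (by positivity)
    calc (1 + ‖ξ‖ ^ 2) ^ (-s) * ‖𝓕 (fun x => (g x : ℂ)) ξ‖ ^ 2
        ≤ (1 + ‖ξ‖ ^ 2) ^ (-s) * (A * min 1 ((ε * ‖ξ‖) ^ N) * ‖fourierMeasure μ ξ‖) ^ 2 := by
          gcongr
          exact hg ξ
      _ = ((1 + ‖ξ‖ ^ 2) ^ (-s) * min 1 ((ε * ‖ξ‖) ^ N) ^ 2) *
          (A ^ 2 * ‖fourierMeasure μ ξ‖ ^ 2) := by ring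
      _ ≤ (ε ^ (2 * s) * (2 ^ (-(2 * s))) ^ j) * (A ^ 2 * ‖fourierMeasure μ ξ‖ ^ 2) := by gcongr
      _ = _ := by ring
  have hmeas : Measurable fun ξ => ‖fourierMeasure μ ξ‖ₑ ^ 2 := by
    have hc : Continuous (fourierMeasure μ) := by
      refine continuous_of_dominated (bound := fun _ => 1)
        (fun ξ => Continuous.aestronglyMeasurable (by fun_prop))
        (fun ξ => Filter.Eventually.of_forall fun u => (Circle.norm_coe _).le)
        (integrable_const _) (Filter.Eventually.of_forall fun u => by fun_prop)
    exact hc.measurable.enorm.pow_const 2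
  have hint : ∫⁻ ξ, ‖(((1 + ‖ξ‖ ^ 2) ^ (-(s / 2)) : ℝ) : ℂ) * 𝓕 (fun x => (g x : ℂ)) ξ‖ₑ ^ 2 ≤
      ENNReal.ofReal (A ^ 2 * ε ^ (2 * s - β) * (C * 2 ^ β * (1 - θ)⁻¹)) := by
    refine (lintegral_mono hpt).trans ?_
    rw [lintegral_tsum fun j => ((hmeas.indicator
      Metric.isClosed_closedBall.measurableSet).const_mul _).aemeasurable]
    calc ∑' j : ℕ, ∫⁻ ξ, ENNReal.ofReal (A ^ 2 * ε ^ (2 * s) * (2 ^ (-(2 * s))) ^ j) *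
          (Metric.closedBall 0 (2 ^ (j + 1) / ε)).indicator
            (fun ξ => ‖fourierMeasure μ ξ‖ₑ ^ 2) ξ
        ≤ ∑' j : ℕ, ENNReal.ofReal (A ^ 2 * ε ^ (2 * s - β) * (C * 2 ^ β) * θ ^ j) := by
          refine ENNReal.tsum_le_tsum fun j => ?_
          rw [lintegral_const_mul' _ _ ENNReal.ofReal_ne_top,
            lintegral_indicator Metric.isClosed_closedBall.measurableSet]
          refine (mul_le_mul_right (hle (2 ^ (j + 1) / ε) (by positivity)) _).trans ?_
          rw [← ENNReal.ofReal_mul (by positivity)]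
          refine ENNReal.ofReal_le_ofReal (le_of_eq ?_)
          have e1 : ((2 : ℝ) ^ (j + 1)) ^ β = 2 ^ β * 2 ^ (j * β) := by
            rw [← Real.rpow_add (by norm_num), ← Real.rpow_natCast, ← Real.rpow_mul (by norm_num)]
            congr 1
            push_cast
            ring
          have e2 : θ ^ j = 2 ^ (j * β) * (2 ^ (-(2 * s))) ^ j := by
            rw [hθ, ← Real.rpow_natCast, ← Real.rpow_natCast _ j, ← Real.rpow_mul (by norm_num),
              ← Real.rpow_mul (by norm_num), ← Real.rpow_add (by norm_num)]
            congr 1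
            ring
          rw [Real.div_rpow (by positivity) hε.le, Real.rpow_sub hε (2 * s) β, e1, e2]
          ring
      _ = ENNReal.ofReal (A ^ 2 * ε ^ (2 * s - β) * (C * 2 ^ β * (1 - θ)⁻¹)) := by
          rw [← ENNReal.ofReal_tsum_of_nonneg (fun j => by positivity)
            ((summable_geometric_of_lt_one hθ0.le hθ1).mul_left _), tsum_mul_left,
            tsum_geometric_of_lt_one hθ0.le hθ1]
          congr 1
          ring
  rw [dualNorm, eLpNorm_two_eq]
  refine (ENNReal.rpow_le_rpow hint (by norm_num)).trans (le_of_eq ?_)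
  rw [ENNReal.ofReal_rpow_of_nonneg (by positivity) (by norm_num), ← Real.sqrt_eq_rpow,
    Real.sqrt_mul (by positivity), Real.sqrt_mul (by positivity), Real.sqrt_sq hA,
    Real.sqrt_eq_rpow (ε ^ _), ← Real.rpow_mul hε.le]
  congr 1
  rw [show (2 * s - β) * (1 / 2) = s - β / 2 by ring]
  ring

end Energy

/-! ### Sobolev duality and adjoints -/

section Duality

variable {d : ℕ}

theorem dualNorm_le {s : ℝ} (hs : 0 ≤ s) {g : Eucl d → ℝ} (hg : IsTest g) :
    dualNorm s g ≤ eLpNorm g 2 volume := by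
  rw [dualNorm, eLpNorm_two_eq, eLpNorm_two_eq g, ← hg.lintegral_fourier]
  refine ENNReal.rpow_le_rpow (lintegral_mono fun ξ => ?_) (by norm_num)
  gcongr
  rw [← ofReal_norm, ← ofReal_norm]
  refine ENNReal.ofReal_le_ofReal ?_
  rw [norm_mul, Complex.norm_real, Real.norm_of_nonneg (by positivity)]
  refine mul_le_of_le_one_left (norm_nonneg _) ?_
  exact Real.rpow_le_one_of_one_le_of_nonpos (by nlinarith [norm_nonneg ξ]) (by linarith)

/-- Duality of the Sobolev spaces `L²_s` and `L²_{-s}`. -/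
theorem enorm_integral_mul_le_sobolevNorm {s : ℝ} (F : Lp ℂ 2 (volume : Measure (Eucl d)))
    {g : Eucl d → ℝ} (hg : IsTest g) :
    ‖∫ x, F x * (g x : ℂ)‖ₑ ≤ dualNorm s g * sobolevNorm s F := by
  have h1 : ∫ x, F x * (g x : ℂ) = inner ℂ (hg.toSchwartz.toLp 2) F := by
    rw [L2.inner_def]
    refine integral_congr_ae ?_
    filter_upwards [SchwartzMap.coeFn_toLp hg.toSchwartz 2 volume] with x hx
    rw [hx, hg.coe_toSchwartz]
    simp [RCLike.inner_apply]
  rw [h1, ← Lp.inner_fourier_eq, L2.inner_def]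
  refine (enorm_integral_le_lintegral_enorm _).trans ?_
  have h2 : ∫⁻ ξ, ‖inner ℂ ((𝓕 (hg.toSchwartz.toLp 2) : Lp ℂ 2 (volume : Measure (Eucl d))) ξ)
        ((𝓕 F : Lp ℂ 2 (volume : Measure (Eucl d))) ξ)‖ₑ =
      eLpNorm (fun ξ => ((((1 + ‖ξ‖ ^ 2) ^ (-(s / 2)) : ℝ) : ℂ) * 𝓕 (fun x => (g x : ℂ)) ξ) *
        ((((1 + ‖ξ‖ ^ 2) ^ (s / 2) : ℝ) : ℂ) *
          (𝓕 F : Lp ℂ 2 (volume : Measure (Eucl d))) ξ)) 1 volume := by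
    rw [eLpNorm_one_eq_lintegral_enorm]
    refine lintegral_congr_ae ?_
    filter_upwards [hg.fourier_toLp] with ξ hξ
    rw [hξ, ← ofReal_norm, ← ofReal_norm]
    congr 1
    have h3 : (1 + ‖ξ‖ ^ 2) ^ (-(s / 2)) * (1 + ‖ξ‖ ^ 2) ^ (s / 2) = 1 := by
      rw [← Real.rpow_add (by positivity), neg_add_cancel, Real.rpow_zero]
    simp only [RCLike.inner_apply, norm_mul, RCLike.norm_conj, Complex.norm_real]
    rw [Real.norm_of_nonneg (by positivity), Real.norm_of_nonneg (by positivity)]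
    linear_combination (-‖𝓕 (fun x => (g x : ℂ)) ξ‖ *
      ‖(𝓕 F : Lp ℂ 2 (volume : Measure (Eucl d))) ξ‖) * h3
  rw [h2]
  have hc : ∀ r : ℝ, Continuous fun ξ : Eucl d => (((1 + ‖ξ‖ ^ 2) ^ r : ℝ) : ℂ) := by
    intro r
    refine Complex.continuous_ofReal.comp (Continuous.rpow_const (by fun_prop) fun ξ => Or.inl ?_)
    positivity
  have h4 : Continuous (𝓕 (fun x => (g x : ℂ)) : Eucl d → ℂ) := by
    rw [← hg.coe_toSchwartz, ← SchwartzMap.fourier_coe]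
    exact (𝓕 hg.toSchwartz).continuous
  have h5 := eLpNorm_smul_le_mul_eLpNorm (p := 2) (q := 2) (r := 1)
    (f := fun ξ => (((1 + ‖ξ‖ ^ 2) ^ (s / 2) : ℝ) : ℂ) *
          (𝓕 F : Lp ℂ 2 (volume : Measure (Eucl d))) ξ)
    (φ := fun ξ => (((1 + ‖ξ‖ ^ 2) ^ (-(s / 2)) : ℝ) : ℂ) * 𝓕 (fun x => (g x : ℂ)) ξ)
    (((hc _).aestronglyMeasurable).mul (Lp.aestronglyMeasurable _))
    (((hc _).mul h4).aestronglyMeasurable (μ := volume))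
  exact h5

variable {A : (Eucl d → ℂ) → Eucl d → ℂ} {s : ℝ} {B : ℝ≥0}

theorem BoundedToSobolev.enorm_integral_le (hA : BoundedToSobolev A s B) (f : 𝓢(Eucl d, ℂ))
    {g : Eucl d → ℝ} (hg : IsTest g) :
    ‖∫ x, A f x * (g x : ℂ)‖ₑ ≤ dualNorm s g * (B * eLpNorm f 2 volume) := by
  obtain ⟨h, hb⟩ := hA f
  have e : ∫ x, A f x * (g x : ℂ) = ∫ x, (h.toLp (A f)) x * (g x : ℂ) := by
    refine integral_congr_ae ?_
    filter_upwards [h.coeFn_toLp] with x hx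
    rw [hx]
  rw [e]
  refine (enorm_integral_mul_le_sobolevNorm (s := s) _ hg).trans ?_
  gcongr

theorem MemLp.integrable_mul_isTest {k : Eucl d → ℂ} (hk : MemLp k 2) {g : Eucl d → ℝ}
    (hg : IsTest g) : Integrable fun x => k x * (g x : ℂ) :=
  hg.integrable_mul (𝕜 := ℂ) (hk.locallyIntegrable (by norm_num))

/-- The adjoint of a bounded operator, applied to a test function. -/
theorem BoundedToSobolev.exists_adjoint (hA : BoundedToSobolev A s B) (hs : 0 ≤ s)
    (hadd : ∀ f f' : 𝓢(Eucl d, ℂ), A (f + f' : 𝓢(Eucl d, ℂ)) = A f + A f')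
    (hsmul : ∀ (c : ℂ) (f : 𝓢(Eucl d, ℂ)), A (c • f : 𝓢(Eucl d, ℂ)) = c • A f)
    {g : Eucl d → ℝ} (hg : IsTest g) :
    ∃ k : Eucl d → ℂ, MemLp k 2 ∧ ∀ f : 𝓢(Eucl d, ℂ),
      ∫ x, A f x * (g x : ℂ) = ∫ y, k y * f y := by
  have hint : ∀ f : 𝓢(Eucl d, ℂ), Integrable fun x => A f x * (g x : ℂ) := fun f =>
    MemLp.integrable_mul_isTest (hA f).1 hg
  let ℓ : 𝓢(Eucl d, ℂ) →ₗ[ℂ] ℂ :=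
    { toFun := fun f => ∫ x, A f x * (g x : ℂ)
      map_add' := fun f f' => by
        rw [← integral_add (hint f) (hint f'), hadd]
        simp [add_mul]
      map_smul' := fun c f => by
        rw [hsmul, RingHom.id_apply, smul_eq_mul, ← integral_const_mul]
        simp [mul_assoc] }
  have hℓ : ∀ f, ℓ f = ∫ x, A f x * (g x : ℂ) := fun f => rfl
  let e : 𝓢(Eucl d, ℂ) →ₗ[ℂ] Lp ℂ 2 (volume : Measure (Eucl d)) :=
    (SchwartzMap.toLpCLM ℂ ℂ 2 (volume : Measure (Eucl d))).toLinearMap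
  have he : ∀ f, e f = f.toLp 2 := fun f => rfl
  have hdense : DenseRange e := SchwartzMap.denseRange_toLpCLM ENNReal.ofNat_ne_top
  have hfin : dualNorm s g ≠ ⊤ := ((dualNorm_le hs hg).trans_lt (hg.memLp 2).eLpNorm_lt_top).ne
  have hnorm : ∃ C, ∀ f, ‖ℓ f‖ ≤ C * ‖e f‖ := by
    refine ⟨(dualNorm s g * B).toReal, fun f => ?_⟩
    have h1 := hA.enorm_integral_le f hg
    rw [he, Lp.norm_def, ← ENNReal.toReal_mul, eLpNorm_congr_ae (SchwartzMap.coeFn_toLp f 2 volume),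
      ← toReal_enorm, hℓ, mul_assoc]
    exact ENNReal.toReal_mono (ENNReal.mul_ne_top hfin (ENNReal.mul_ne_top ENNReal.coe_ne_top
      (f.memLp 2 volume).eLpNorm_lt_top.ne)) h1
  -- The functional is bounded in the `L²` norm on the dense class of Schwartz functions (here `s ≥
  -- 0` makes the dual norm of `g` finite). It therefore extends to `L²` and is represented by
  -- Riesz.
  let L := ℓ.extendOfNorm e
  have hL : ∀ f, L (e f) = ℓ f := fun f => LinearMap.extendOfNorm_eq hdense hnorm f
  let K := (InnerProductSpace.toDual ℂ (Lp ℂ 2 (volume : Measure (Eucl d)))).symm L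
  refine ⟨fun y => (starRingEnd ℂ) (K y), (Lp.memLp K).star, fun f => ?_⟩
  rw [← hℓ, ← hL, ← InnerProductSpace.toDual_symm_apply, L2.inner_def]
  refine integral_congr_ae ?_
  filter_upwards [SchwartzMap.coeFn_toLp f 2 volume] with y hy
  rw [he, hy, RCLike.inner_apply, mul_comm]

end Duality

/-! ### Linearity of the Radon transform on test functions -/

section Linearity

variable {d m : ℕ}

/-- Level sets have locally finite surface measure. -/
theorem NondegenerateOn.levelSet_inter_ne_top {φ : Fin m → Eucl d × Eucl d → ℝ}
    (hφ : ∀ l, ContDiff ℝ ∞ (φ l)) {T : Set (Fin m → ℝ)} (hdeg : NondegenerateOn φ T)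
    {t : Fin m → ℝ} (ht : t ∈ T) (x : Eucl d) {B : Set (Eucl d)} (hB : IsCompact B) :
    Measure.euclideanHausdorffMeasure (d - m) (levelSet φ t x ∩ B) ≠ ⊤ := by
  have hE : IsCompact (B ∪ {x}) := hB.union isCompact_singleton
  obtain ⟨M, hM, hbd⟩ := exists_isBoundedNear (ψ := fun _ => (0 : ℝ)) hφ contDiff_const hE
  obtain ⟨L, c, hL, hc, hR⟩ := hdeg.exists_hasRightInverses hφ hE
    (isCompact_singleton (x := t)) (by simpa using ht)
  obtain ⟨C, hC, hlev⟩ := exists_level_measure_le d m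
  rw [levelSet_eq]
  have hcont : Continuous fun y => jointMap φ (x, y) - t :=
    ((continuous_jointMap fun l => (hφ l).continuous).comp (by fun_prop)).sub continuous_const
  refine hB.induction_on (p := fun S => Measure.euclideanHausdorffMeasure (d - m)
    ({y | jointMap φ (x, y) - t = 0} ∩ S) ≠ ⊤) (by simp) ?_ ?_ ?_
  · intro S S' hSS h
    exact ne_top_of_le_ne_top h (measure_mono (Set.inter_subset_inter_right _ hSS))
  · intro S S' h h'
    rw [Set.inter_union_distrib_left]
    exact ne_top_of_le_ne_top (ENNReal.add_ne_top.2 ⟨h, h'⟩) (measure_union_le _ _)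
  · intro v hv
    by_cases hv0 : jointMap φ (x, v) - t = 0
    · obtain ⟨Rx, Ry, hRR⟩ := hR x (by simp) v (by simp [hv]) t rfl (by rw [hv0]; simpa using hc.le)
      set ρ := min 1 (1 / (2 * (L * M))) with hρ
      have hρ0 : 0 < ρ := by positivity
      have hρ1 : L * (M * ρ) ≤ 1 / 2 := by
        have : ρ ≤ 1 / (2 * (L * M)) := min_le_right _ _
        calc L * (M * ρ) = (L * M) * ρ := by ring
          _ ≤ (L * M) * (1 / (2 * (L * M))) := by gcongr
          _ = 1 / 2 := by field_simp
      refine ⟨Metric.closedBall v ρ, mem_nhdsWithin_of_mem_nhds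
        (Metric.closedBall_mem_nhds v hρ0), ?_⟩
      exact ne_top_of_le_ne_top ENNReal.ofReal_ne_top
        (hlev φ _ x v 1 M L _ Rx Ry t ρ ρ x (hbd x (by simp) v (by simp [hv])) hRR (by linarith)
          (min_le_left _ _) hρ1 hρ0.le le_rfl (by simpa using hρ0.le))
    · refine ⟨{y | jointMap φ (x, y) - t = 0}ᶜ, mem_nhdsWithin_of_mem_nhds
        ((isClosed_singleton.preimage hcont).isOpen_compl.mem_nhds hv0), ?_⟩
      simp

variable {φ : Fin m → Eucl d × Eucl d → ℝ} {ψ : Eucl d × Eucl d → ℝ} {T : Set (Fin m → ℝ)}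
  {t : Fin m → ℝ}

theorem NondegenerateOn.integrableOn_levelSet (hφ : ∀ l, ContDiff ℝ ∞ (φ l))
    (hdeg : NondegenerateOn φ T) (ht : t ∈ T) (hψ : Continuous ψ) (hψc : HasCompactSupport ψ)
    {f : Eucl d → ℂ} (hf : Continuous f) (x : Eucl d) :
    IntegrableOn (fun y => f y * (ψ (x, y) : ℂ)) (levelSet φ t x)
      (Measure.euclideanHausdorffMeasure (d - m)) := by
  have hcont : Continuous fun y => f y * (ψ (x, y) : ℂ) :=
    hf.mul (Complex.continuous_ofReal.comp (hψ.comp (by fun_prop)))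
  have hB : IsCompact (Prod.snd '' tsupport ψ) := hψc.isCompact.image continuous_snd
  have hS : MeasurableSet (levelSet φ t x) := by
    rw [levelSet_eq]
    exact (isClosed_singleton.preimage (((continuous_jointMap fun l => (hφ l).continuous).comp
      (by fun_prop)).sub continuous_const)).measurableSet
  have h := integrableOn_of_continuous_of_eq_zero hS hB
    (hdeg.levelSet_inter_ne_top hφ ht x hB) hcont.norm (fun y hy => by
      have : ψ (x, y) = 0 := by
        by_contra hne
        exact hy ⟨(x, y), subset_tsupport _ hne, rfl⟩
      simp [this])
  exact h.mono' hcont.aestronglyMeasurable (Filter.Eventually.of_forall fun y => le_rfl)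

/-- Additivity needs integrability on the level set, hence locally finite surface measure; this is
where nondegeneracy on `T` is used. -/
theorem NondegenerateOn.radonTransform_add (hφ : ∀ l, ContDiff ℝ ∞ (φ l))
    (hdeg : NondegenerateOn φ T) (ht : t ∈ T) (hψ : Continuous ψ) (hψc : HasCompactSupport ψ)
    {f f' : Eucl d → ℂ} (hf : Continuous f) (hf' : Continuous f') :
    radonTransform φ ψ t (f + f') = radonTransform φ ψ t f + radonTransform φ ψ t f' := by
  ext x
  rw [Pi.add_apply, radonTransform, radonTransform, radonTransform,
    ← integral_add (hdeg.integrableOn_levelSet hφ ht hψ hψc hf x)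
      (hdeg.integrableOn_levelSet hφ ht hψ hψc hf' x)]
  simp only [Pi.add_apply, add_mul]

theorem radonTransform_smul (c : ℂ) (f : Eucl d → ℂ) :
    radonTransform φ ψ t (c • f) = c • radonTransform φ ψ t f := by
  ext x
  rw [Pi.smul_apply, radonTransform, radonTransform, smul_eq_mul, ← integral_const_mul]
  simp only [Pi.smul_apply, smul_eq_mul, mul_assoc]

variable {s : ℝ} {B : ℝ≥0}

theorem BoundedToSobolev.memLp_realRadon (hA : BoundedToSobolev (radonTransform φ ψ t) s B)
    {f : Eucl d → ℝ} (hf : IsTest f) : MemLp (realRadon φ ψ t f) 2 := by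
  have h := (hA hf.toSchwartz).1.re
  have e : (fun x => RCLike.re (radonTransform φ ψ t hf.toSchwartz x)) = realRadon φ ψ t f := by
    ext x
    rw [hf.coe_toSchwartz, radonTransform_ofReal]
    simp
  rwa [e] at h

theorem integral_radonTransform_mul_ofReal {f : Eucl d → ℝ} (hf : IsTest f) (g : Eucl d → ℝ) :
    ∫ x, radonTransform φ ψ t hf.toSchwartz x * (g x : ℂ) =
      ((∫ x, realRadon φ ψ t f x * g x : ℝ) : ℂ) := by
  rw [← integral_complex_ofReal]
  refine integral_congr_ae (Filter.Eventually.of_forall fun x => ?_)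
  simp only [hf.coe_toSchwartz, radonTransform_ofReal, Complex.ofReal_mul]

theorem BoundedToSobolev.enorm_integral_realRadon_le
    (hA : BoundedToSobolev (radonTransform φ ψ t) s B) {f g : Eucl d → ℝ} (hf : IsTest f)
    (hg : IsTest g) : ‖∫ x, realRadon φ ψ t f x * g x‖ₑ ≤
      dualNorm s g * (B * eLpNorm f 2 volume) := by
  have h := hA.enorm_integral_le hf.toSchwartz hg
  have e2 : eLpNorm hf.toSchwartz 2 volume = eLpNorm f 2 volume := by
    refine eLpNorm_congr_norm_ae (Filter.Eventually.of_forall fun x => ?_)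
    rw [hf.coe_toSchwartz, Complex.norm_real]
  rw [integral_radonTransform_mul_ofReal hf g, e2, ← ofReal_norm, Complex.norm_real, ofReal_norm] at h
  exact h

theorem BoundedToSobolev.exists_real_adjoint
    (hA : BoundedToSobolev (radonTransform φ ψ t) s B) (hs : 0 ≤ s)
    (hφ : ∀ l, ContDiff ℝ ∞ (φ l)) (hdeg : NondegenerateOn φ T) (ht : t ∈ T) (hψ : Continuous ψ)
    (hψc : HasCompactSupport ψ) {g : Eucl d → ℝ} (hg : IsTest g) :
    ∃ k : Eucl d → ℝ, MemLp k 2 ∧ ∀ f : Eucl d → ℝ, IsTest f →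
      ∫ x, realRadon φ ψ t f x * g x = ∫ y, k y * f y := by
  obtain ⟨k, hk, h⟩ := hA.exists_adjoint hs
    (fun f f' => hdeg.radonTransform_add hφ ht hψ hψc f.continuous f'.continuous)
    (fun c f => radonTransform_smul c f) hg
  refine ⟨fun y => (k y).re, hk.re, fun f hf => ?_⟩
  have h1 := h hf.toSchwartz
  have h2 := congrArg Complex.re ((integral_radonTransform_mul_ofReal hf g).symm.trans h1)
  rw [Complex.ofReal_re] at h2
  have h3 := integral_re (MemLp.integrable_mul_isTest hk hf)
  rw [h2, hf.coe_toSchwartz]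
  refine Eq.trans h3.symm ?_
  refine integral_congr_ae (Filter.Eventually.of_forall fun x => ?_)
  simp

end Linearity

/-! ### Pairings with mollified measures -/

section Pairing

variable {d : ℕ}

/-- What is used of the smoothing property of a linear operator on test functions. -/
structure IsSmoothing (R : (Eucl d → ℝ) → Eucl d → ℝ) (s : ℝ) (B : ℝ≥0) : Prop where
  memLp : ∀ f, IsTest f → MemLp (R f) 2
  adjoint : ∀ g, IsTest g → ∃ k : Eucl d → ℝ, MemLp k 2 ∧
    ∀ f, IsTest f → ∫ x, R f x * g x = ∫ y, k y * f y
  bound : ∀ f g, IsTest f → IsTest g →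
    ‖∫ x, R f x * g x‖ₑ ≤ dualNorm s g * (B * eLpNorm f 2 volume)

variable {R : (Eucl d → ℝ) → Eucl d → ℝ} {s : ℝ} {B : ℝ≥0}

theorem IsSmoothing.integrable (hR : IsSmoothing R s B) {f g : Eucl d → ℝ} (hf : IsTest f)
    (hg : IsTest g) : Integrable fun x => R f x * g x :=
  hg.integrable_mul (𝕜 := ℝ) ((hR.memLp f hf).locallyIntegrable (by norm_num))

theorem IsSmoothing.pair_mollify_left (hR : IsSmoothing R s B) {f q : Eucl d → ℝ} (hf : IsTest f)
    (hq : IsTest q) (ν : Measure (Eucl d)) [IsFiniteMeasure ν] :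
    Integrable (fun u => ∫ x, R f x * q (x - u)) ν ∧
      ∫ x, R f x * mollify q ν x = ∫ u, (∫ x, R f x * q (x - u)) ∂ν :=
  integral_mul_mollify_of_memLp hq (hR.memLp f hf) ν

/-- The average over `v` must be taken out of the argument of `R`. The adjoint replaces `R` by a
fixed `k ∈ L²`, so Fubini is needed only for translates of `p` against `k`, not for surface
measures. -/
theorem IsSmoothing.pair_mollify_right (hR : IsSmoothing R s B) {g p : Eucl d → ℝ}
    (hg : IsTest g) (hp : IsTest p) {ν : Measure (Eucl d)} [IsFiniteMeasure ν]
    {E : Set (Eucl d)} (hE : IsCompact E) (hν : ν Eᶜ = 0) :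
    Integrable (fun v => ∫ x, R (fun y => p (y - v)) x * g x) ν ∧
      ∫ x, R (mollify p ν) x * g x = ∫ v, (∫ x, R (fun y => p (y - v)) x * g x) ∂ν := by
  obtain ⟨k, hk, h⟩ := hR.adjoint g hg
  simp_rw [h _ (hp.translate _), h _ (isTest_mollify hp hE hν)]
  exact integral_mul_mollify_of_memLp hp hk ν

theorem mollify_sub (p : Eucl d → ℝ) (ν : Measure (Eucl d)) (v : Eucl d) :
    mollify (fun y => p (y - v)) ν = fun y => mollify p ν (y - v) := by
  ext y
  simp only [mollify, sub_right_comm]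

/-- Averaging a bound over translations. -/
theorem IsSmoothing.abs_pair_average_sub_le (hR : IsSmoothing R s B) {g p : Eucl d → ℝ}
    (hg : IsTest g) (hp : IsTest p) {ν : Measure (Eucl d)} [IsProbabilityMeasure ν] {r e : ℝ}
    (hν : ∀ᵐ h ∂ν, ‖h‖ ≤ r) (v : Eucl d)
    (H : ∀ h, ‖h‖ ≤ r → |(∫ x, R (fun y => p (y - (v + h))) x * g x) -
      ∫ x, R (fun y => p (y - v)) x * g x| ≤ e) :
    |(∫ x, R (fun y => mollify p ν (y - v)) x * g x) -
      ∫ x, R (fun y => p (y - v)) x * g x| ≤ e := by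
  have hν' : ν (Metric.closedBall 0 r)ᶜ = 0 := by
    rw [ae_iff] at hν
    convert hν using 2
    ext
    simp
  have h := hR.pair_mollify_right hg (hp.translate v) (isCompact_closedBall 0 r) hν'
  rw [mollify_sub] at h
  have e1 : ∫ x, R (fun y => p (y - v)) x * g x =
      ∫ _h, (∫ x, R (fun y => p (y - v)) x * g x) ∂ν := by simp
  rw [h.2, e1, ← integral_sub h.1 (integrable_const _)]
  have h2 := norm_integral_le_of_norm_le_const (μ := ν) (C := e)
    (f := fun w => (∫ x, R (fun y => p (y - w - v)) x * g x) - ∫ x, R (fun y => p (y - v)) x * g x)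
    (by
      filter_upwards [hν] with w hw
      have := H w hw
      simp only [sub_sub, add_comm w, Real.norm_eq_abs]
      simpa only [sub_sub] using this)
  simpa using h2

variable {μ : Measure (Eucl d)} [IsProbabilityMeasure μ] {E : Set (Eucl d)}

theorem integral_indicator_prod {S : Set (Eucl d × Eucl d)} (hS : MeasurableSet S) (e : ℝ) :
    (∀ v, Integrable (fun u => S.indicator (fun _ => e) (u, v)) μ) ∧
      Integrable (fun v => ∫ u, S.indicator (fun _ => e) (u, v) ∂μ) μ ∧
      ∫ v, ∫ u, S.indicator (fun _ => e) (u, v) ∂μ ∂μ = e * (μ.prod μ).real S := by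
  have h : Integrable (S.indicator fun _ => e) (μ.prod μ) := (integrable_const e).indicator hS
  refine ⟨fun v => ?_, h.integral_prod_right, ?_⟩
  · refine Integrable.of_bound (C := |e|) ?_ (Filter.Eventually.of_forall fun u => ?_)
    · exact ((measurable_const.indicator hS).comp (by fun_prop)).aestronglyMeasurable
    · rw [Set.indicator]
      split_ifs <;> simp
  · rw [← integral_prod_symm _ h, integral_indicator_const _ hS, smul_eq_mul, mul_comm]

/-- Comparison of the pairings of mollified measures. -/
theorem IsSmoothing.abs_pair_mollify_sub_le (hR : IsSmoothing R s B) (hE : IsCompact E)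
    (hμ : μ Eᶜ = 0) {q p p' : Eucl d → ℝ} (hq : IsTest q) (hp : IsTest p) (hp' : IsTest p')
    {S : Set (Eucl d × Eucl d)} (hS : MeasurableSet S) {e : ℝ}
    (H : ∀ u ∈ E, ∀ v ∈ E, |(∫ x, R (fun y => p (y - v)) x * q (x - u)) -
      ∫ x, R (fun y => p' (y - v)) x * q (x - u)| ≤ S.indicator (fun _ => e) (u, v)) :
    |(∫ x, R (mollify p μ) x * mollify q μ x) - ∫ x, R (mollify p' μ) x * mollify q μ x| ≤
      e * (μ.prod μ).real S := by
  have hg := isTest_mollify hq hE hμ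
  have h1 := hR.pair_mollify_right hg hp hE hμ
  have h2 := hR.pair_mollify_right hg hp' hE hμ
  obtain ⟨i1, i2, i3⟩ := integral_indicator_prod (μ := μ) hS e
  have hE' : ∀ᵐ u ∂μ, u ∈ E := by rwa [ae_iff]
  rw [h1.2, h2.2, ← integral_sub h1.1 h2.1, ← i3, ← Real.norm_eq_abs]
  refine norm_integral_le_of_norm_le i2 ?_
  filter_upwards [hE'] with v hv
  have h3 := hR.pair_mollify_left (hp.translate v) hq μ
  have h4 := hR.pair_mollify_left (hp'.translate v) hq μ
  rw [h3.2, h4.2, ← integral_sub h3.1 h4.1]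
  refine norm_integral_le_of_norm_le (i1 v) ?_
  filter_upwards [hE'] with u hu
  exact H u hu v hv

theorem IsSmoothing.le_pair_mollify (hR : IsSmoothing R s B) (hE : IsCompact E)
    (hμ : μ Eᶜ = 0) {q p : Eucl d → ℝ} (hq : IsTest q) (hp : IsTest p)
    {S : Set (Eucl d × Eucl d)} (hS : MeasurableSet S) {e : ℝ}
    (H : ∀ u ∈ E, ∀ v ∈ E, S.indicator (fun _ => e) (u, v) ≤
      ∫ x, R (fun y => p (y - v)) x * q (x - u)) :
    e * (μ.prod μ).real S ≤ ∫ x, R (mollify p μ) x * mollify q μ x := by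
  have hg := isTest_mollify hq hE hμ
  have h1 := hR.pair_mollify_right hg hp hE hμ
  obtain ⟨i1, i2, i3⟩ := integral_indicator_prod (μ := μ) hS e
  have hE' : ∀ᵐ u ∂μ, u ∈ E := by rwa [ae_iff]
  rw [h1.2, ← i3]
  refine integral_mono_ae i2 h1.1 ?_
  filter_upwards [hE'] with v hv
  have h3 := hR.pair_mollify_left (hp.translate v) hq μ
  rw [h3.2]
  refine integral_mono_ae (i1 v) h3.1 ?_
  filter_upwards [hE'] with u hu
  exact H u hu v hv

theorem IsSmoothing.abs_pair_le (hR : IsSmoothing R s B) {f g : Eucl d → ℝ} (hf : IsTest f)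
    (hg : IsTest g) {a b : ℝ} (ha : 0 ≤ a) (hb : 0 ≤ b) (h1 : dualNorm s g ≤ ENNReal.ofReal a)
    (h2 : eLpNorm f 2 volume ≤ ENNReal.ofReal b) : |∫ x, R f x * g x| ≤ a * (B * b) := by
  have h := hR.bound f g hf hg
  have h3 : dualNorm s g * (B * eLpNorm f 2 volume) ≤ ENNReal.ofReal (a * (B * b)) := by
    rw [ENNReal.ofReal_mul ha, ENNReal.ofReal_mul (NNReal.coe_nonneg B), ENNReal.ofReal_coe_nnreal]
    gcongr
  rw [← Real.norm_eq_abs]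
  rw [← ofReal_norm] at h
  exact (ENNReal.ofReal_le_ofReal_iff (by positivity)).1 (h.trans h3)

theorem eLpNorm_le_of_fourier_le {g g' : Eucl d → ℝ} (hg : IsTest g) (hg' : IsTest g')
    (h : ∀ ξ, ‖𝓕 (fun x => (g x : ℂ)) ξ‖ ≤ ‖𝓕 (fun x => (g' x : ℂ)) ξ‖) :
    eLpNorm g 2 volume ≤ eLpNorm g' 2 volume := by
  rw [eLpNorm_two_eq, eLpNorm_two_eq g', ← hg.lintegral_fourier, ← hg'.lintegral_fourier]
  refine ENNReal.rpow_le_rpow (lintegral_mono fun ξ => ?_) (by norm_num)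
  gcongr
  rw [← ofReal_norm, ← ofReal_norm]
  exact ENNReal.ofReal_le_ofReal (h ξ)

end Pairing

/-! ### The self-improving recursion -/

theorem exists_near_half_pow {τ : ℝ} (h0 : 0 < τ) (h1 : τ ≤ 1) :
    ∃ j : ℕ, (1 / 2 : ℝ) ^ (j + 1) < τ ∧ τ ≤ (1 / 2) ^ j := 
  exists_nat_pow_near_of_lt_one h0 h1 (by norm_num) (by norm_num)

/-- A self-improving bound for a distribution function. -/
theorem exists_le_mul_pow_of_recursion (m : ℕ) {c C' l θ C₂ : ℝ} (k₀ : ℕ) (Ck : ℕ → ℝ) (hc : 0 < c)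
    (hc1 : c ≤ 1) (hC' : 1 ≤ C') (hl : 1 / 2 ≤ l) (hθ : 0 ≤ θ) (hθ1 : θ < 1) (hC₂ : 0 ≤ C₂) :
    ∃ A : ℝ, 0 ≤ A ∧ ∀ N : ℝ → ℝ, Monotone N → (∀ r, N r ≤ 1) →
      (∀ k ≥ k₀, ∀ n ≥ k, N (c * (1 / 2) ^ n) ≤ ((1 / 2) ^ n) ^ m * (Ck k +
        C₂ * ∑ i ∈ Finset.Ico k n, θ ^ i * (N (C' * l ^ i) / (l ^ i) ^ m))) →
      ∀ r, 0 < r → N r ≤ A * r ^ m := by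
  have hl0 : 0 < l := by linarith
  have hθ2 : 0 < 1 - θ := by linarith
  set D := C₂ * (2 * C' / c) ^ m with hD
  have hD0 : 0 ≤ D := by positivity
  -- Starting the sum this late leaves a total coefficient at most `1/2` in front of the constant
  -- `A` being sought.
  obtain ⟨k₁, hk₁⟩ : ∃ k₁ : ℕ, k₀ ≤ k₁ ∧ D * (θ ^ k₁ / (1 - θ)) ≤ 1 / 2 := by
    have ht : Filter.Tendsto (fun k : ℕ => D * (θ ^ k / (1 - θ))) Filter.atTop (nhds (D * (0 / (1 - θ)))) :=
      ((tendsto_pow_atTop_nhds_zero_of_lt_one hθ hθ1).div_const _).const_mul _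
    rw [zero_div, mul_zero] at ht
    obtain ⟨k₁, h1, h2⟩ := ((ht.eventually_le_const (by norm_num : (0 : ℝ) < 1 / 2)).and
      (Filter.eventually_ge_atTop k₀)).exists
    exact ⟨k₁, h2, h1⟩
  -- The first entry absorbs the fixed term as `|Ck k₁| ≤ A / 2`; the second makes the trivial bound
  -- `N ≤ 1` sufficient for the scales `n < k₁`.
  set A := max (2 * |Ck k₁|) (((2 : ℝ) ^ k₁) ^ m) with hA
  have hA1 : 1 ≤ A := (one_le_pow₀ (one_le_pow₀ (by norm_num))).trans (le_max_right _ _)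
  have hA0 : 0 < A := by linarith
  refine ⟨A * (2 / c) ^ m, by positivity, fun N hN hN1 hrec => ?_⟩
  -- from the scales `c * 2 ^ (-j)` with `j ≤ n` to all radii above
  have hall : ∀ n : ℕ, (∀ j ≤ n, N (c * (1 / 2) ^ j) ≤ A * ((1 / 2) ^ j) ^ m) → ∀ r,
      c * (1 / 2) ^ n ≤ r → N r ≤ A * (2 * r / c) ^ m := by
    intro n hn r hr
    have hr0 : 0 < r := lt_of_lt_of_le (by positivity) hr
    rcases le_or_gt c r with h | h
    · refine (hN1 r).trans (one_le_mul_of_one_le_of_one_le hA1 (one_le_pow₀ ?_))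
      rw [le_div_iff₀ hc]
      linarith
    · obtain ⟨j, hj1, hj2⟩ := exists_near_half_pow (τ := r / c) (by positivity)
        ((div_le_one hc).2 h.le)
      have hjn : j ≤ n := by
        by_contra! hlt
        have h1 : (1 / 2 : ℝ) ^ j ≤ (1 / 2) ^ (n + 1) :=
          pow_le_pow_of_le_one (by norm_num) (by norm_num) hlt
        have h2 : (1 / 2 : ℝ) ^ n ≤ r / c := by
          rw [le_div_iff₀ hc]
          linarith
        rw [pow_succ] at h1
        have h3 : (0 : ℝ) < (1 / 2) ^ n := by positivity
        linarith
      have h4 : r ≤ c * (1 / 2) ^ j := by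
        rw [div_le_iff₀ hc] at hj2
        linarith
      refine (hN h4).trans ((hn j hjn).trans ?_)
      gcongr
      rw [pow_succ] at hj1
      rw [mul_div_assoc]
      linarith
  have hmain : ∀ n : ℕ, N (c * (1 / 2) ^ n) ≤ A * ((1 / 2) ^ n) ^ m := by
    intro n
    induction n using Nat.strong_induction_on with
    | _ n ih =>
      rcases lt_or_ge n k₁ with hlt | hge
      · refine (hN1 _).trans ?_
        have h1 : (((2 : ℝ) ^ k₁) ^ m) * ((1 / 2) ^ n) ^ m ≤ A * ((1 / 2) ^ n) ^ m := by
          gcongr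
          exact le_max_right _ _
        refine le_trans ?_ h1
        rw [← mul_pow]
        refine one_le_pow₀ ?_
        rw [one_div, inv_pow, ← div_eq_mul_inv, one_le_div (by positivity)]
        exact pow_le_pow_right₀ (by norm_num) hlt.le
      · refine (hrec k₁ hk₁.1 n hge).trans ?_
        rw [mul_comm A]
        gcongr
        have hterm : ∀ i ∈ Finset.Ico k₁ n,
            θ ^ i * (N (C' * l ^ i) / (l ^ i) ^ m) ≤ θ ^ i * (A * (2 * C' / c) ^ m) := by
          intro i hi
          rw [Finset.mem_Ico] at hi
          gcongr
          rw [div_le_iff₀ (by positivity), mul_assoc, ← mul_pow]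
          -- Since `c ≤ 1 ≤ C'` and `l ≥ 1/2`, the radius `C' * l ^ i` is not below the scale of
          -- index `i < n`, so the induction hypothesis covers it.
          have h2 : c * (1 / 2) ^ i ≤ C' * l ^ i := by gcongr; linarith
          have h3 := hall i (fun j hj => ih j (by omega)) _ h2
          rwa [show 2 * C' / c * l ^ i = 2 * (C' * l ^ i) / c by ring]
        have hsum : ∑ i ∈ Finset.Ico k₁ n, θ ^ i ≤ θ ^ k₁ / (1 - θ) := by
          exact geom_sum_Ico_le_of_lt_one hθ hθ1
        calc Ck k₁ + C₂ * ∑ i ∈ Finset.Ico k₁ n, θ ^ i * (N (C' * l ^ i) / (l ^ i) ^ m)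
            ≤ |Ck k₁| + C₂ * ∑ i ∈ Finset.Ico k₁ n, θ ^ i * (A * (2 * C' / c) ^ m) := by
              exact add_le_add (le_abs_self _)
                (mul_le_mul_of_nonneg_left (Finset.sum_le_sum hterm) hC₂)
          _ = |Ck k₁| + A * (D * ∑ i ∈ Finset.Ico k₁ n, θ ^ i) := by
              rw [← Finset.sum_mul, hD]
              ring
          _ ≤ |Ck k₁| + A * (D * (θ ^ k₁ / (1 - θ))) := by gcongr
          _ ≤ |Ck k₁| + A * (1 / 2) := by
              gcongr
              exact hk₁.2
          _ ≤ A := by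
              have : 2 * |Ck k₁| ≤ A := le_max_left _ _
              linarith
  intro r hr
  obtain ⟨n, hn⟩ := exists_pow_lt_of_lt_one (div_pos hr hc) (by norm_num : (1 / 2 : ℝ) < 1)
  rw [lt_div_iff₀ hc] at hn
  have := hall n (fun j _ => hmain j) r (by linarith)
  rwa [show 2 * r / c = 2 / c * r by ring, mul_pow, ← mul_assoc] at this

/-! ### Uniform bounds for pairings of mollifiers -/

section Bounds

variable {d m : ℕ} {φ : Fin m → Eucl d × Eucl d → ℝ} {ψ : Eucl d × Eucl d → ℝ}
  {T : Set (Fin m → ℝ)} {E : Set (Eucl d)} {K : Set (Fin m → ℝ)}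

theorem exists_half_le_of_eq_one (hψ : ContDiff ℝ ∞ ψ) (hψc : HasCompactSupport ψ)
    (hψE : ∀ x ∈ E, ∀ y ∈ E, ψ (x, y) = 1) : ∃ ρ, 0 < ρ ∧ ρ ≤ 1 ∧
      ∀ u ∈ E, ∀ v ∈ E, ∀ p ∈ Metric.closedBall (u, v) ρ, 1 / 2 ≤ ψ p := by
  obtain ⟨k, hk⟩ := ContDiff.lipschitzWith_of_hasCompactSupport hψc hψ (by simp)
  refine ⟨min 1 (1 / (2 * (k + 1))), by positivity, min_le_left _ _, fun u hu v hv p hp => ?_⟩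
  have h1 := hk.dist_le_mul p (u, v)
  rw [Real.dist_eq, hψE u hu v hv] at h1
  have h2 : dist p (u, v) ≤ 1 / (2 * (k + 1)) := (Metric.mem_closedBall.1 hp).trans (min_le_right _ _)
  have h3 : (k : ℝ) * dist p (u, v) ≤ 1 / 2 := by
    calc (k : ℝ) * dist p (u, v) ≤ (k + 1) * (1 / (2 * (k + 1))) := by gcongr; linarith
      _ = 1 / 2 := by field_simp
  have := (abs_le.1 (h1.trans h3)).1
  linarith

/-- Bounds for pairings of mollifiers that are uniform over the base points and the parameter. -/
theorem exists_pairing_bounds (hφ : ∀ l, ContDiff ℝ ∞ (φ l)) (hdeg : NondegenerateOn φ T)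
    (hψ : ContDiff ℝ ∞ ψ) (hψc : HasCompactSupport ψ) (hE : IsCompact E)
    (hψE : ∀ x ∈ E, ∀ y ∈ E, ψ (x, y) = 1) (hK : IsCompact K) (hKT : K ⊆ T) {G c₁ : ℝ}
    (hG : 1 ≤ G) (hc₁ : 0 < c₁) : ∃ C C' c c₀ r₀ : ℝ, 0 ≤ C ∧ 1 ≤ C' ∧ 0 < c ∧ 0 < c₀ ∧ c₀ ≤ 1 ∧
      0 < r₀ ∧ ∀ t ∈ K, ∀ (s : ℝ) (B : ℝ≥0), IsSmoothing (realRadon φ ψ t) s B →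
      (∀ (δ ε : ℝ) (p q : Eucl d → ℝ) (h : Eucl d), 0 < δ → δ ≤ ε → ε ≤ r₀ → IsTest p → IsTest q →
        KernelBound p G δ → KernelBound q G ε → (∀ y, 0 ≤ p y) → ‖h‖ ≤ G * δ →
        ∀ u ∈ E, ∀ v ∈ E,
        |(∫ x, realRadon φ ψ t (fun y => p (y - (v + h))) x * q (x - u)) -
          ∫ x, realRadon φ ψ t (fun y => p (y - v)) x * q (x - u)| ≤
          {z : Eucl d × Eucl d | ‖jointMap φ z - t‖ ≤ C' * ε}.indicator
            (fun _ => C * (δ / ε + ε) / ε ^ m) (u, v)) ∧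
      (∀ (δ : ℝ) (p : Eucl d → ℝ), 0 < δ → δ ≤ r₀ → IsTest p → KernelBound p G δ →
        (∀ y, 0 ≤ p y) → (∀ y, ‖y‖ ≤ δ → c₁ / δ ^ d ≤ p y) → ∀ u ∈ E, ∀ v ∈ E,
        {z : Eucl d × Eucl d | ‖jointMap φ z - t‖ ≤ c₀ * δ}.indicator
            (fun _ => c / δ ^ m) (u, v) ≤
          ∫ x, realRadon φ ψ t (fun y => p (y - v)) x * p (x - u)) := by
  obtain ⟨ρ₀, hρ₀, hρ₀1, hψ2⟩ := exists_half_le_of_eq_one hψ hψc hψE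
  obtain ⟨M, hM, hbd⟩ := exists_isBoundedNear hφ hψ hE
  obtain ⟨L, b, hL, hb, hR⟩ := hdeg.exists_hasRightInverses hφ hE hK hKT
  obtain ⟨C, r₁, hC, hr₁, hup⟩ := exists_abs_integral_translate_sub_le d m hρ₀ hM hL hG
  obtain ⟨c, c₀, r₂, hc, hc₀, hr₂, hlow⟩ := exists_le_integral_realRadon_mul d m hρ₀ hM hL hG hc₁
  have hφc : ∀ l, Continuous (φ l) := fun l => (hφ l).continuous
  have hMG : 1 ≤ M * G := one_le_mul_of_one_le_of_one_le hM hG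
  -- The radius is small enough that all supports stay where the bounds hold, and that points in the
  -- indicated neighbourhoods of the level set are within `b` of it, where right inverses exist.
  -- Farther than `C' * ε` from the level set both pairings vanish by support considerations.
  refine ⟨C, 2 * M * G, c, min c₀ 1, min (min r₁ r₂) (min (ρ₀ / (2 * G)) (min (b / (2 * M * G)) b)),
    hC, by linarith, hc, by positivity, min_le_right _ _, by positivity,
    fun t ht s B hS => ⟨?_, ?_⟩⟩
  · intro δ ε p q h hδ hδε hε hp hq hpk hqk hp0 hh u hu v hv
    have hε0 : 0 < ε := by linarith
    have hε1 : ε ≤ r₁ := hε.trans ((min_le_left _ _).trans (min_le_left _ _))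
    have hε2 : 2 * G * ε ≤ ρ₀ := by
      have : ε ≤ ρ₀ / (2 * G) := hε.trans ((min_le_right _ _).trans (min_le_left _ _))
      rw [le_div_iff₀ (by positivity)] at this
      linarith
    have hε3 : 2 * M * G * ε ≤ b := by
      have : ε ≤ b / (2 * M * G) :=
        hε.trans ((min_le_right _ _).trans ((min_le_right _ _).trans (min_le_left _ _)))
      rw [le_div_iff₀ (by positivity)] at this
      linarith
    have hB := (hbd u hu v hv).mono hρ₀1
    have hqt := hq.translate u
    by_cases hnear : ‖jointMap φ (u, v) - t‖ ≤ 2 * M * G * ε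
    · rw [Set.indicator_of_mem (by exact hnear)]
      obtain ⟨Rx, Ry, hRR⟩ := hR u hu v hv t ht (hnear.trans hε3)
      exact hup φ ψ u v _ Rx Ry t hφc hψ.continuous hB hRR
        (fun z hz => (by norm_num : (0 : ℝ) ≤ 1 / 2).trans (hψ2 u hu v hv z hz)) δ ε p q h hδ hδε
        hε1 hpk hqk hp0 hh (hS.integrable (hp.translate _) hqt) (hS.integrable (hp.translate _) hqt)
    · rw [Set.indicator_of_notMem (by exact hnear)]
      have hfar := not_le.1 hnear
      have h0 : ∀ w : Eucl d, ‖w‖ ≤ G * δ →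
          ∫ x, realRadon φ ψ t (fun y => p (y - (v + w))) x * q (x - u) = 0 := fun w hw =>
        integral_eq_zero_of_ae (Filter.Eventually.of_forall fun x =>
          realRadon_mul_eq_zero hB (by linarith) (by linarith) hδε hε0.le hε2 hpk hqk hw hfar x)
      have h1 := h0 0 (by rw [norm_zero]; positivity)
      rw [add_zero] at h1
      rw [h0 h hh, h1, sub_zero, abs_zero]
  · intro δ p hδ hδr hp hpk hp0 hpc u hu v hv
    have hδ2 : δ ≤ r₂ := hδr.trans ((min_le_left _ _).trans (min_le_right _ _))
    have hδ3 : G * δ ≤ ρ₀ := by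
      have : δ ≤ ρ₀ / (2 * G) := hδr.trans ((min_le_right _ _).trans (min_le_left _ _))
      rw [le_div_iff₀ (by positivity)] at this
      nlinarith
    have hδ4 : δ ≤ b :=
      hδr.trans ((min_le_right _ _).trans ((min_le_right _ _).trans (min_le_right _ _)))
    have hB := (hbd u hu v hv).mono hρ₀1
    by_cases hnear : ‖jointMap φ (u, v) - t‖ ≤ min c₀ 1 * δ
    · rw [Set.indicator_of_mem (by exact hnear)]
      have h1 : ‖jointMap φ (u, v) - t‖ ≤ b := hnear.trans <| by
        calc min c₀ 1 * δ ≤ 1 * δ := by gcongr; exact min_le_right _ _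
          _ ≤ b := by linarith
      have h2 : ‖jointMap φ (u, v) - t‖ ≤ c₀ * δ := hnear.trans <| by
        gcongr
        exact min_le_left _ _
      obtain ⟨Rx, Ry, hRR⟩ := hR u hu v hv t ht h1
      exact hlow φ ψ u v _ Rx Ry t hφc hψ.continuous hB hRR (hψ2 u hu v hv) δ p hδ hδ2 hpk hp0 hpc
        h2 (hS.integrable (hp.translate _) (hp.translate u))
    · rw [Set.indicator_of_notMem (by exact hnear)]
      exact integral_nonneg (realRadon_mul_nonneg (fun z hz =>
        (by norm_num : (0 : ℝ) ≤ 1 / 2).trans (hψ2 u hu v hv z hz)) hδ3 hδ3 hpk hpk hp0 hp0)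

end Bounds

/-! ### Comparison of adjacent scales -/

section Scales

variable {d : ℕ}

/-- The convolution of `dilate ρ δ` and `dilate χ ε`. -/
noncomputable def smoothKernel (ρ χ : Eucl d → ℝ) (δ ε : ℝ) : Eucl d → ℝ :=
  mollify (dilate χ ε) (densityMeasure (dilate ρ δ))

theorem IsBump.densityMeasure_compl_closedBall {p : Eucl d → ℝ} (hp : IsBump p) {G δ : ℝ}
    (h : KernelBound p G δ) : densityMeasure p (Metric.closedBall 0 (G * δ))ᶜ = 0 := by
  have := hp.ae_norm_le h
  rw [ae_iff] at this
  convert this using 2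
  ext
  simp

variable {ρ χ : Eucl d → ℝ}

theorem isTest_smoothKernel (hρ : IsBump ρ) (hχ : IsTest χ) {δ ε : ℝ} (hδ : 0 < δ) (hε : 0 < ε) :
    IsTest (smoothKernel ρ χ δ ε) := by
  obtain ⟨G, -, hG⟩ := hρ.exists_kernelBound
  have := (hρ.dilate hδ).isProbabilityMeasure
  exact isTest_mollify (hχ.dilate hε) (isCompact_closedBall 0 (G * δ))
    ((hρ.dilate hδ).densityMeasure_compl_closedBall (hG δ hδ))

theorem fourier_smoothKernel (hρ : IsBump ρ) (hχ : IsTest χ) {δ ε : ℝ} (hδ : 0 < δ) (hε : 0 < ε)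
    (ξ : Eucl d) : 𝓕 (fun x => (smoothKernel ρ χ δ ε x : ℂ)) ξ =
      𝓕 (fun x => (χ x : ℂ)) (ε • ξ) * 𝓕 (fun x => (ρ x : ℂ)) (δ • ξ) := by
  have := (hρ.dilate hδ).isProbabilityMeasure
  rw [smoothKernel, fourier_mollify (hχ.dilate hε), (hρ.dilate hδ).fourierMeasure_densityMeasure,
    fourier_dilate _ hε, fourier_dilate _ hδ]

theorem IsBump.norm_fourier_le_one (hρ : IsBump ρ) (ξ : Eucl d) :
    ‖𝓕 (fun x => (ρ x : ℂ)) ξ‖ ≤ 1 := by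
  have := hρ.isProbabilityMeasure
  rw [← hρ.fourierMeasure_densityMeasure]
  exact norm_fourierMeasure_le _ _

theorem fourier_sub_ofReal {g g' : Eucl d → ℝ} (hg : IsTest g) (hg' : IsTest g') (ξ : Eucl d) :
    𝓕 (fun x => ((g x - g' x : ℝ) : ℂ)) ξ =
      𝓕 (fun x => (g x : ℂ)) ξ - 𝓕 (fun x => (g' x : ℂ)) ξ := by
  have e1 : (fun x => ((g x - g' x : ℝ) : ℂ)) =
      (hg.toSchwartz + -hg'.toSchwartz : 𝓢(Eucl d, ℂ)) := by
    ext x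
    simp [IsTest.coe_toSchwartz, sub_eq_add_neg]
  rw [e1, ← SchwartzMap.fourier_coe, FourierAdd.fourier_add, FourierTransform.fourier_neg,
    sub_eq_add_neg]
  rfl

/-- The two bounds for `1 - 𝓕 χ` in one. -/
theorem exists_norm_one_sub_fourier_le_min {N : ℕ} {C : ℝ} (hC : 0 ≤ C)
    (h : ∀ ξ, ‖1 - 𝓕 (fun x => (χ x : ℂ)) ξ‖ ≤ C * ‖ξ‖ ^ N) : ∃ C₀ : ℝ, 0 ≤ C₀ ∧
      ∀ ξ, ‖1 - 𝓕 (fun x => (χ x : ℂ)) ξ‖ ≤ C₀ * min 1 (‖ξ‖ ^ N) := by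
  have h0 : 0 ≤ ∫ x, |χ x| := integral_nonneg fun _ => abs_nonneg _
  refine ⟨max C (1 + ∫ x, |χ x|), le_max_of_le_left hC, fun ξ => ?_⟩
  rw [mul_min_of_nonneg _ _ (le_max_of_le_left hC), mul_one]
  refine le_min ?_ ((h ξ).trans (by gcongr; exact le_max_left _ _))
  refine (norm_sub_le _ _).trans (le_trans ?_ (le_max_right _ _))
  rw [norm_one]
  gcongr
  exact IsTest.norm_fourier_le ξ

/-- At `l = 1/2` the product is `2^(β - s) < 1`, and continuity leaves room for a larger `l`. With
`l > 1/2` the scale `l^k` is much coarser than `2^(-k)`, which the geometric comparison needs, while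
the smoothing bound still decays. -/
theorem exists_ratio {s β : ℝ} (hs : β < s) :
    ∃ l : ℝ, 1 / 2 < l ∧ l < 1 ∧ l ^ (s - β / 2) * 2 ^ (β / 2) < 1 := by
  have hc : ContinuousAt (fun l : ℝ => l ^ (s - β / 2) * 2 ^ (β / 2)) (1 / 2) :=
    (Real.continuousAt_rpow_const _ _ (Or.inl (by norm_num))).mul continuousAt_const
  have h0 : (1 / 2 : ℝ) ^ (s - β / 2) * 2 ^ (β / 2) < 1 := by
    rw [one_div, Real.inv_rpow (by norm_num), ← Real.rpow_neg (by norm_num),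
      ← Real.rpow_add (by norm_num)]
    exact Real.rpow_lt_one_of_one_lt_of_neg one_lt_two (by linarith)
  have h1 := hc.eventually_lt continuousAt_const h0
  have h2 : ∀ᶠ l in nhdsWithin (1 / 2 : ℝ) (Set.Ioi (1 / 2)), 1 / 2 < l ∧ l < 1 :=
    Ioo_mem_nhdsGT (by norm_num)
  obtain ⟨l, hl1, hl2⟩ := ((h1.filter_mono nhdsWithin_le_nhds).and h2).exists
  exact ⟨l, hl2.1, hl2.2, hl1⟩

variable {R : (Eucl d → ℝ) → Eucl d → ℝ} {s : ℝ} {B : ℝ≥0}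
  {μ : Measure (Eucl d)} [IsProbabilityMeasure μ] {E : Set (Eucl d)} {α : ℝ≥0}

/-- Smoothing of the pairing of a mollified Frostman measure with an oscillating test function. -/
theorem IsFrostman.exists_abs_pair_le (hμ : IsFrostman μ E α) (hE : IsCompact E)
    (hρ : IsBump ρ) {N : ℕ} (hα : (α : ℝ) < d) (hs : (d : ℝ) - α < 2 * s) (hN : s ≤ N) (B : ℝ≥0) :
    ∃ C : ℝ, 0 ≤ C ∧ ∀ R, IsSmoothing R s B → ∀ (δ ε A : ℝ) (g : Eucl d → ℝ), 0 < δ → 0 < ε →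
      0 ≤ A → IsTest g →
      (∀ ξ, ‖𝓕 (fun x => (g x : ℂ)) ξ‖ ≤ A * min 1 ((ε * ‖ξ‖) ^ N) * ‖fourierMeasure μ ξ‖) →
      |∫ x, R (mollify (dilate ρ δ) μ) x * g x| ≤
        C * A * (ε ^ (s - ((d : ℝ) - α) / 2) * δ ^ (-(((d : ℝ) - α) / 2))) := by
  obtain ⟨C₁, hC₁, h₁⟩ := hμ.exists_dualNorm_le hE hα hs hN
  obtain ⟨C₂, hC₂, h₂⟩ := hμ.exists_lintegral_mollify_le hE hρ
  refine ⟨C₁ * (B * Real.sqrt C₂), by positivity, fun R hR δ ε A g hδ hε hA hg hF => ?_⟩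
  have h3 : eLpNorm (mollify (dilate ρ δ) μ) 2 volume ≤
      ENNReal.ofReal (Real.sqrt C₂ * δ ^ (-(((d : ℝ) - α) / 2))) := by
    rw [eLpNorm_two_eq]
    refine (ENNReal.rpow_le_rpow (h₂ δ hδ) (by norm_num)).trans (le_of_eq ?_)
    rw [ENNReal.ofReal_rpow_of_nonneg (by positivity) (by norm_num), ← Real.sqrt_eq_rpow,
      Real.sqrt_mul hC₂, Real.sqrt_eq_rpow (δ ^ _), ← Real.rpow_mul hδ.le]
    congr 3
    ring
  have h4 := hR.abs_pair_le (isTest_mollify (hρ.dilate hδ).toIsTest hE hμ.1) hg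
    (by positivity) (by positivity) (h₁ ε A g hε hA hF) h3
  refine h4.trans (le_of_eq ?_)
  ring

/-- Comparison of the pairings of a measure mollified at two comparable scales. -/
theorem IsSmoothing.abs_pair_dilate_sub_le (hR : IsSmoothing R s B) (hE : IsCompact E)
    (hμ : μ Eᶜ = 0) (hρ : IsBump ρ) {G : ℝ} (hG : ∀ δ, 0 < δ → KernelBound (dilate ρ δ) G δ)
    (hG0 : 0 ≤ G)
    {q : Eucl d → ℝ} (hq : IsTest q) {δ : ℝ} (hδ : 0 < δ) {S : Set (Eucl d × Eucl d)}
    (hS : MeasurableSet S) {e : ℝ}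
    (H : ∀ δ', 0 < δ' → δ' ≤ δ → ∀ h, ‖h‖ ≤ 2 * G * δ' → ∀ u ∈ E, ∀ v ∈ E,
      |(∫ x, R (fun y => dilate ρ δ' (y - (v + h))) x * q (x - u)) -
        ∫ x, R (fun y => dilate ρ δ' (y - v)) x * q (x - u)| ≤ S.indicator (fun _ => e) (u, v)) :
    |(∫ x, R (mollify (dilate ρ δ) μ) x * mollify q μ x) -
      ∫ x, R (mollify (dilate ρ (δ / 2)) μ) x * mollify q μ x| ≤ 2 * e * (μ.prod μ).real S := by
  have hδ2 : 0 < δ / 2 := by positivity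
  have b1 := hρ.dilate hδ
  have b2 := hρ.dilate hδ2
  have := b1.isProbabilityMeasure
  have := b2.isProbabilityMeasure
  refine hR.abs_pair_mollify_sub_le hE hμ hq b1.toIsTest b2.toIsTest hS fun u hu v hv => ?_
  -- Both mollifiers are compared with the convolution of the two. The one at scale `δ / 2` is then
  -- shifted by up to `G * δ = 2 * G * (δ / 2)`, which is why shifts up to `2 * G * δ'` are allowed.
  have h1 := hR.abs_pair_average_sub_le (hq.translate u) b1.toIsTest
    (r := 2 * G * δ) (e := S.indicator (fun _ => e) (u, v))
    (ν := densityMeasure (dilate ρ (δ / 2)))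
    (by
      filter_upwards [b2.ae_norm_le (hG _ hδ2)] with h hh
      nlinarith [mul_nonneg hG0 hδ.le]) v
    (fun h hh => H δ hδ le_rfl h hh u hu v hv)
  have h2 := hR.abs_pair_average_sub_le (hq.translate u) b2.toIsTest
    (r := 2 * G * (δ / 2)) (e := S.indicator (fun _ => e) (u, v)) (ν := densityMeasure (dilate ρ δ))
    (by
      filter_upwards [b1.ae_norm_le (hG _ hδ)] with h hh
      linarith) v
    (fun h hh => H (δ / 2) hδ2 (by linarith) h hh u hu v hv)
  rw [b2.mollify_densityMeasure_comm b1] at h2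
  have h3 : S.indicator (fun _ => 2 * e) (u, v) =
      S.indicator (fun _ => e) (u, v) + S.indicator (fun _ => e) (u, v) := by
    by_cases h : (u, v) ∈ S <;> simp [h, two_mul]
  rw [h3]
  rw [abs_sub_comm] at h1
  exact (abs_sub_le _ _ _).trans (add_le_add h1 h2)

end Scales

/-! ### The multiscale argument -/

section Main

variable {d m : ℕ}

theorem rpow_scale {l : ℝ} (hl : 0 < l) (a b : ℝ) (k j : ℕ) :
    (l ^ k) ^ a * ((1 / 2 : ℝ) ^ j) ^ (-b) = (l ^ a) ^ k * ((2 : ℝ) ^ b) ^ j := by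
  rw [one_div, inv_pow, Real.inv_rpow (by positivity), Real.rpow_neg (by positivity), inv_inv,
    ← Real.rpow_natCast, ← Real.rpow_natCast, ← Real.rpow_natCast, ← Real.rpow_natCast,
    ← Real.rpow_mul hl.le, ← Real.rpow_mul hl.le, ← Real.rpow_mul (by norm_num),
    ← Real.rpow_mul (by norm_num), mul_comm a, mul_comm b]

theorem BoundedToSobolev.isSmoothing {φ : Fin m → Eucl d × Eucl d → ℝ}
    {ψ : Eucl d × Eucl d → ℝ} {T : Set (Fin m → ℝ)} {t : Fin m → ℝ} {s : ℝ} {B : ℝ≥0}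
    (hA : BoundedToSobolev (radonTransform φ ψ t) s B) (hs : 0 ≤ s)
    (hφ : ∀ l, ContDiff ℝ ∞ (φ l)) (hdeg : NondegenerateOn φ T) (ht : t ∈ T) (hψ : Continuous ψ)
    (hψc : HasCompactSupport ψ) : IsSmoothing (realRadon φ ψ t) s B where
  memLp _ hf := hA.memLp_realRadon hf
  adjoint _ hg := hA.exists_real_adjoint hs hφ hdeg ht hψ hψc hg
  bound _ _ hf hg := hA.enorm_integral_realRadon_le hf hg

theorem norm_fourier_le_of_flat {ρ χ : Eucl d → ℝ} (hρ : IsBump ρ) {N : ℕ} {C₀ : ℝ} (hC₀ : 0 ≤ C₀)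
    (h : ∀ ξ, ‖1 - 𝓕 (fun x => (χ x : ℂ)) ξ‖ ≤ C₀ * min 1 (‖ξ‖ ^ N)) {ε ε' : ℝ} (hε : 0 ≤ ε)
    (hεε : ε ≤ ε') (δ : ℝ) (z : ℂ) (ξ : Eucl d) :
    ‖(1 - 𝓕 (fun x => (χ x : ℂ)) (ε • ξ)) * 𝓕 (fun x => (ρ x : ℂ)) (δ • ξ) * z‖ ≤
      C₀ * min 1 ((ε' * ‖ξ‖) ^ N) * ‖z‖ := by
  rw [norm_mul, norm_mul]
  have h1 := h (ε • ξ)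
  rw [norm_smul, Real.norm_of_nonneg hε] at h1
  have h2 := hρ.norm_fourier_le_one (δ • ξ)
  refine mul_le_mul_of_nonneg_right ?_ (norm_nonneg z)
  calc ‖1 - 𝓕 (fun x => (χ x : ℂ)) (ε • ξ)‖ * ‖𝓕 (fun x => (ρ x : ℂ)) (δ • ξ)‖
      ≤ (C₀ * min 1 ((ε * ‖ξ‖) ^ N)) * 1 := by gcongr
    _ ≤ C₀ * min 1 ((ε' * ‖ξ‖) ^ N) := by
      rw [mul_one]
      gcongr

/-- The telescoping of the pairings is carried out for each `t`. All constants, including those of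
the recursion, are fixed before `t` is chosen, which gives the uniformity. -/
theorem exists_measureReal_le (φ : Fin m → Eucl d × Eucl d → ℝ)
    (hφ : ∀ l, ContDiff ℝ ∞ (φ l)) {T K : Set (Fin m → ℝ)} (hdeg : NondegenerateOn φ T)
    (hK : IsCompact K) (hKT : K ⊆ T) {E : Set (Eucl d)} (hE : IsCompact E) {α : ℝ≥0}
    {μ : Measure (Eucl d)} [IsProbabilityMeasure μ] (hμ : IsFrostman μ E α)
    {ψ : Eucl d × Eucl d → ℝ} (hψ : ContDiff ℝ ∞ ψ) (hψc : HasCompactSupport ψ)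
    (hψE : ∀ x ∈ E, ∀ y ∈ E, ψ (x, y) = 1) {s : ℝ} {B : ℝ≥0}
    (hB : ∀ t ∈ T, BoundedToSobolev (radonTransform φ ψ t) s B)
    (hs : (d : ℝ) - s < α) (hα : (α : ℝ) < d) :
    ∃ A : ℝ, 0 ≤ A ∧ ∀ t ∈ K, ∀ r, 0 < r →
      (μ.prod μ).real {z | ‖jointMap φ z - t‖ ≤ r} ≤ A * r ^ m := by
  obtain ⟨β, hβ⟩ : ∃ β : ℝ, β = (d : ℝ) - α := ⟨_, rfl⟩
  have hβ0 : 0 < β := by linarith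
  have hβs : β < s := by linarith
  obtain ⟨N, hN⟩ := exists_nat_ge s
  have hN : s ≤ ((N + 1 : ℕ) : ℝ) := by push_cast; linarith
  obtain ⟨χ, hχ, Cχ, hCχ, hflat⟩ := exists_isTest_flat d N
  obtain ⟨C₀, hC₀, hflat⟩ := exists_norm_one_sub_fourier_le_min hCχ hflat
  obtain ⟨ρ, hρ, c₁, hc₁, hρc⟩ := exists_isBump d
  obtain ⟨Gρ, hGρ, hkρ⟩ := hρ.exists_kernelBound
  obtain ⟨Gχ, hGχ, hkχ⟩ := hχ.exists_kernelBound
  obtain ⟨G', hG'⟩ : ∃ G', G' = max Gρ Gχ := ⟨_, rfl⟩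
  have hG'1 : 1 ≤ G' := by rw [hG']; exact le_max_of_le_left hGρ
  have hkρ : ∀ δ, 0 < δ → KernelBound (dilate ρ δ) G' δ := fun δ hδ =>
    (hkρ δ hδ).mono hδ (by rw [hG']; exact le_max_left _ _)
  have hkχ : ∀ δ, 0 < δ → KernelBound (dilate χ δ) G' δ := fun δ hδ =>
    (hkχ δ hδ).mono hδ (by rw [hG']; exact le_max_right _ _)
  -- The doubled constant covers both the supports of the kernels `q n k` and the shifts up to `2 *
  -- G' * δ'`.
  obtain ⟨C, C', c, c₀, r₀, hC, hC', hc, hc₀, hc₀1, hr₀, hbd⟩ :=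
    exists_pairing_bounds hφ hdeg hψ hψc hE hψE hK hKT (G := 2 * G') (by linarith) hc₁
  obtain ⟨l, hl, hl1, hθ₁⟩ := exists_ratio hβs
  have hl0 : 0 < l := by linarith
  obtain ⟨Cs, hCs, hpair⟩ := hμ.exists_abs_pair_le hE hρ hα (by linarith : (d : ℝ) - α < 2 * s) hN B
  rw [← hβ] at hpair
  obtain ⟨θ₁, hθ₁d⟩ : ∃ θ₁, θ₁ = l ^ (s - β / 2) * 2 ^ (β / 2) := ⟨_, rfl⟩
  rw [← hθ₁d] at hθ₁
  have hθ₁0 : 0 ≤ θ₁ := by rw [hθ₁d]; positivity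
  obtain ⟨θ, hθ⟩ : ∃ θ, θ = max (1 / (2 * l)) l := ⟨_, rfl⟩
  have hθ1 : θ < 1 := by
    rw [hθ]
    refine max_lt ?_ hl1
    rw [div_lt_one (by positivity)]
    linarith
  have hθ0 : 0 ≤ θ := by rw [hθ]; exact le_max_of_le_right hl0.le
  obtain ⟨k₀, hk₀⟩ := exists_pow_lt_of_lt_one hr₀ hl1
  have hδ0 : ∀ k : ℕ, (0 : ℝ) < (1 / 2) ^ k := fun k => by positivity
  have hε0 : ∀ k : ℕ, 0 < l ^ k := fun k => by positivity
  have hδε : ∀ k : ℕ, (1 / 2 : ℝ) ^ k ≤ l ^ k := fun k => by gcongr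
  -- Every `g n k` keeps the finest mollifier, so that the Fourier transforms of `f n - g n n` and
  -- of `g n i - g n (i + 1)` carry factors `1 - χ̂` that are flat at the origin.
  let f : ℕ → Eucl d → ℝ := fun k => mollify (dilate ρ ((1 / 2) ^ k)) μ
  let q : ℕ → ℕ → Eucl d → ℝ := fun n k => smoothKernel ρ χ ((1 / 2) ^ n) (l ^ k)
  let g : ℕ → ℕ → Eucl d → ℝ := fun n k => mollify (q n k) μ
  have hf : ∀ k, IsTest (f k) := fun k => isTest_mollify (hρ.dilate (hδ0 k)).toIsTest hE hμ.1
  have hq : ∀ n k, IsTest (q n k) := fun n k => isTest_smoothKernel hρ hχ (hδ0 n) (hε0 k)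
  have hg : ∀ n k, IsTest (g n k) := fun n k => isTest_mollify (hq n k) hE hμ.1
  have hqk : ∀ n k, k ≤ n → KernelBound (q n k) (2 * G') (l ^ k) := fun n k hkn => by
    have := (hρ.dilate (hδ0 n)).isProbabilityMeasure
    refine (hkχ _ (hε0 k)).mollify (by linarith) ?_ (hε0 k)
      ((hρ.dilate (hδ0 n)).ae_norm_le (hkρ _ (hδ0 n)))
    exact (pow_le_pow_of_le_one (by norm_num) (by norm_num) hkn).trans (hδε k)
  have hfg : ∀ n k ξ, 𝓕 (fun x => (g n k x : ℂ)) ξ = 𝓕 (fun x => (χ x : ℂ)) (l ^ k • ξ) *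
      𝓕 (fun x => (ρ x : ℂ)) ((1 / 2 : ℝ) ^ n • ξ) * fourierMeasure μ ξ := fun n k ξ => by
    rw [fourier_mollify (hq n k), fourier_smoothKernel hρ hχ (hδ0 n) (hε0 k)]
  have hff : ∀ n ξ, 𝓕 (fun x => (f n x : ℂ)) ξ =
      𝓕 (fun x => (ρ x : ℂ)) ((1 / 2 : ℝ) ^ n • ξ) * fourierMeasure μ ξ := fun n ξ => by
    rw [fourier_mollify (hρ.dilate (hδ0 n)).toIsTest, fourier_dilate _ (hδ0 n)]
  -- The bound for the terminal pairing must not depend on `n`; dropping the finest mollifier, whose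
  -- Fourier transform is at most 1, achieves this.
  let b : ℕ → ℝ := fun k => (eLpNorm (mollify (dilate χ (l ^ k)) μ) 2 volume).toReal *
    (B * (eLpNorm (f k) 2 volume).toReal)
  obtain ⟨Cx, hCx⟩ : ∃ Cx, Cx = Cs * (2 * C₀) * 2 ^ (β / 2) := ⟨_, rfl⟩
  have hCx0 : 0 ≤ Cx := by rw [hCx]; positivity
  obtain ⟨A, hA, hAbound⟩ := exists_le_mul_pow_of_recursion m (c := c₀) (C' := C') (l := l) (θ := θ)
    (C₂ := c⁻¹ * (4 * C)) k₀ (fun k => c⁻¹ * (Cs * C₀ + b k + Cx / (1 - θ₁))) hc₀ hc₀1 hC' hl.le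
    hθ0 hθ1 (by positivity)
  refine ⟨A, hA, fun t ht => ?_⟩
  have hR := (hB t (hKT ht)).isSmoothing (by linarith) hφ hdeg (hKT ht) hψ.continuous hψc
  obtain ⟨hup, hlow⟩ := hbd t ht s B hR
  obtain ⟨R, hRd⟩ : ∃ R, R = realRadon φ ψ t := ⟨_, rfl⟩
  rw [← hRd] at hR hup hlow
  have hSm : ∀ r, MeasurableSet {z : Eucl d × Eucl d | ‖jointMap φ z - t‖ ≤ r} := fun r => by
    have : Continuous fun z => ‖jointMap φ z - t‖ :=
      ((continuous_jointMap fun l => (hφ l).continuous).sub continuous_const).norm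
    exact (isClosed_le this continuous_const).measurableSet
  refine hAbound _ (fun r r' hr => measureReal_mono fun z hz => le_trans hz hr)
    (fun r => measureReal_le_one) fun k hk n hkn => ?_
  obtain ⟨Nt, hNt⟩ : ∃ Nt : ℝ → ℝ, Nt = fun r => (μ.prod μ).real {z | ‖jointMap φ z - t‖ ≤ r} :=
    ⟨_, rfl⟩
  have hNt' : ∀ r, (μ.prod μ).real {z | ‖jointMap φ z - t‖ ≤ r} = Nt r := fun r => by rw [hNt]
  simp only [hNt']
  have hr : ∀ i, k ≤ i → l ^ i ≤ r₀ := fun i hi =>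
    (pow_le_pow_of_le_one hl0.le hl1.le (hk.trans hi)).trans hk₀.le
  -- the pairing at the scale `2 ^ (-n)` controls the measure
  have hlower : c / ((1 / 2 : ℝ) ^ n) ^ m * Nt (c₀ * (1 / 2) ^ n) ≤ ∫ x, R (f n) x * f n x := by
    have hρn := hρ.dilate (hδ0 n)
    rw [← hNt']
    refine hR.le_pair_mollify hE hμ.1 hρn.toIsTest hρn.toIsTest (hSm _) ?_
    refine hlow _ _ (hδ0 n) ((hδε n).trans (hr n hkn)) hρn.toIsTest
      ((hkρ _ (hδ0 n)).mono (hδ0 n) (by linarith)) hρn.nonneg fun y hy => ?_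
    rw [dilate, div_eq_inv_mul]
    gcongr
    refine hρc _ ?_
    rw [norm_smul, norm_inv, Real.norm_of_nonneg (hδ0 n).le, inv_mul_le_iff₀ (hδ0 n)]
    linarith
  -- replacing the mollifier in the first variable at the finest scale
  have htop : |∫ x, R (f n) x * (f n x - g n n x)| ≤ Cs * C₀ := by
    refine (hpair R hR _ (l ^ n) C₀ _ (hδ0 n) (hε0 n) hC₀ ((hf n).sub (hg n n)) fun ξ => ?_).trans ?_
    · rw [fourier_sub_ofReal (hf n) (hg n n), hff, hfg]
      refine le_trans (le_of_eq ?_) (norm_fourier_le_of_flat hρ hC₀ hflat (hε0 n).le le_rfl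
        ((1 / 2) ^ n) (fourierMeasure μ ξ) ξ)
      congr 1
      ring
    · rw [rpow_scale hl0, ← mul_pow, ← hθ₁d]
      exact mul_le_of_le_one_right (by positivity) (pow_le_one₀ hθ₁0 hθ₁.le)
  -- Both `1 - χ̂` factors are flat at the coarser scale `l ^ i`, whence `2 * C₀`; the factor `2 ^
  -- (β / 2)` in `Cx` comes from pairing with the mollification of index `i + 1`.
  have hx : ∀ i, |∫ x, R (f (i + 1)) x * (g n i x - g n (i + 1) x)| ≤ Cx * θ₁ ^ i := fun i => by
    refine (hpair R hR _ (l ^ i) (2 * C₀) _ (hδ0 (i + 1)) (hε0 i) (by positivity)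
      ((hg n i).sub (hg n (i + 1))) fun ξ => ?_).trans ?_
    · rw [fourier_sub_ofReal (hg n i) (hg n (i + 1)), hfg, hfg]
      have h1 := norm_fourier_le_of_flat hρ hC₀ hflat (hε0 i).le le_rfl
        ((1 / 2) ^ n) (fourierMeasure μ ξ) ξ
      have h2 := norm_fourier_le_of_flat hρ hC₀ hflat (hε0 (i + 1)).le
        (pow_le_pow_of_le_one hl0.le hl1.le (Nat.le_succ i)) ((1 / 2) ^ n) (fourierMeasure μ ξ) ξ
      refine le_trans (le_of_eq ?_) ((norm_sub_le _ _).trans (add_le_add h2 h1) |>.trans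
        (le_of_eq ?_))
      · congr 1
        ring
      · ring
    · rw [rpow_scale hl0, pow_succ ((2 : ℝ) ^ (β / 2)), hCx, hθ₁d, mul_pow]
      exact le_of_eq (by ring)
  -- The geometric error `δ / ε + ε` is at most `(1 / (2 * l)) ^ i + l ^ i ≤ 2 * θ ^ i`; the
  -- comparison of two adjacent mollifiers doubles it once more.
  have hy : ∀ i, k ≤ i → i < n → |(∫ x, R (f i) x * g n i x) - ∫ x, R (f (i + 1)) x * g n i x| ≤
      4 * C * (θ ^ i * (Nt (C' * l ^ i) / (l ^ i) ^ m)) := by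
    intro i hki hin
    have h := hR.abs_pair_dilate_sub_le hE hμ.1 hρ hkρ (by linarith) (hq n i) (hδ0 i) (hSm (C' * l ^ i))
      (e := C * (2 * θ ^ i) / (l ^ i) ^ m) (fun δ' hδ' hδi h hh u hu v hv => by
        refine (hup δ' (l ^ i) _ _ h hδ' (hδi.trans (hδε i)) (hr i hki) (hρ.dilate hδ').toIsTest
          (hq n i) ((hkρ δ' hδ').mono hδ' (by linarith)) (hqk n i hin.le) (hρ.dilate hδ').nonneg hh
          u hu v hv).trans ?_
        refine Set.indicator_le_indicator ?_
        have h1 : δ' / l ^ i ≤ θ ^ i := by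
          calc δ' / l ^ i ≤ (1 / 2) ^ i / l ^ i := by gcongr
            _ = (1 / (2 * l)) ^ i := by rw [← div_pow, div_div]
            _ ≤ θ ^ i := by
              gcongr
              rw [hθ]
              exact le_max_left _ _
        have h2 : l ^ i ≤ θ ^ i := by
          gcongr
          rw [hθ]
          exact le_max_right _ _
        gcongr
        linarith)
    rw [hNt', ← show (1 / 2 : ℝ) ^ (i + 1) = (1 / 2) ^ i / 2 by rw [pow_succ]; ring] at h
    exact h.trans (le_of_eq (by ring))
  have hbase : |∫ x, R (f k) x * g n k x| ≤ b k := by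
    refine hR.abs_pair_le (hf k) (hg n k) ENNReal.toReal_nonneg ENNReal.toReal_nonneg ?_ ?_
    · have hχk : IsTest (mollify (dilate χ (l ^ k)) μ) := isTest_mollify (hχ.dilate (hε0 k)) hE hμ.1
      rw [ENNReal.ofReal_toReal (hχk.memLp 2).eLpNorm_lt_top.ne]
      refine (dualNorm_le (by linarith) (hg n k)).trans
        (eLpNorm_le_of_fourier_le (hg n k) hχk fun ξ => ?_)
      rw [hfg, fourier_mollify (hχ.dilate (hε0 k)), fourier_dilate _ (hε0 k), norm_mul, norm_mul,
        norm_mul]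
      gcongr
      exact mul_le_of_le_one_right (norm_nonneg _) (hρ.norm_fourier_le_one _)
    · rw [ENNReal.ofReal_toReal ((hf k).memLp 2).eLpNorm_lt_top.ne]
  have hsub : ∀ i j j', ∫ x, R (f i) x * (g n j x - g n j' x) =
      (∫ x, R (f i) x * g n j x) - ∫ x, R (f i) x * g n j' x := fun i j j' => by
    rw [← integral_sub (hR.integrable (hf i) (hg n j)) (hR.integrable (hf i) (hg n j'))]
    simp only [mul_sub]
  -- One step of the staircase passes from `(f j, g n j)` to `(f (j + 1), g n j)` by geometry and on
  -- to `(f (j + 1), g n (j + 1))` by smoothing.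
  have htel : ∀ j, k ≤ j → j ≤ n → |∫ x, R (f j) x * g n j x| ≤ b k +
      ∑ i ∈ Finset.Ico k j, (4 * C * (θ ^ i * (Nt (C' * l ^ i) / (l ^ i) ^ m)) + Cx * θ₁ ^ i) := by
    intro j hkj
    induction j, hkj using Nat.le_induction with
    | base =>
      intro _
      simpa using hbase
    | succ j hkj ih =>
      intro hjn
      rw [Finset.sum_Ico_succ_top hkj]
      have h1 := ih (by omega)
      have h2 := hy j hkj (by omega)
      have h3 := hx j
      rw [hsub] at h3
      rw [abs_le] at *
      constructor <;> linarith [h1.1, h1.2, h2.1, h2.2, h3.1, h3.2]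
  have hθ₁2 : ∑ i ∈ Finset.Ico k n, Cx * θ₁ ^ i ≤ Cx / (1 - θ₁) := by
    rw [← Finset.mul_sum, div_eq_mul_inv, ← one_div]
    gcongr
    refine (geom_sum_Ico_le_of_lt_one hθ₁0 hθ₁).trans ?_
    have : 0 < 1 - θ₁ := by linarith
    gcongr
    exact pow_le_one₀ hθ₁0 hθ₁.le
  have hfin := htel n hkn le_rfl
  have htop' : ∫ x, R (f n) x * f n x ≤ Cs * C₀ + |∫ x, R (f n) x * g n n x| := by
    have h1 : ∫ x, R (f n) x * (f n x - g n n x) =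
        (∫ x, R (f n) x * f n x) - ∫ x, R (f n) x * g n n x := by
      rw [← integral_sub (hR.integrable (hf n) (hf n)) (hR.integrable (hf n) (hg n n))]
      simp only [mul_sub]
    rw [h1] at htop
    linarith [le_abs_self ((∫ x, R (f n) x * f n x) - ∫ x, R (f n) x * g n n x),
      le_abs_self (∫ x, R (f n) x * g n n x)]
  rw [Finset.sum_add_distrib, ← Finset.mul_sum] at hfin
  have hall := hlower.trans htop'
  have hδm : 0 < ((1 / 2 : ℝ) ^ n) ^ m := by positivity
  rw [div_mul_eq_mul_div, div_le_iff₀ hδm] at hall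
  rw [mul_assoc c⁻¹, ← mul_add, mul_left_comm, ← div_eq_inv_mul, le_div_iff₀ hc, mul_comm _ c]
  refine hall.trans ?_
  rw [mul_comm]
  exact mul_le_mul_of_nonneg_left (by linarith) hδm.le

end Main

theorem proposition2p2 (d m : ℕ) (hd : 2 ≤ d) (hm : 1 ≤ m)
    -- the defining functions, and the box of parameters
    (φ : Fin m → Eucl d × Eucl d → ℝ) (hφ : ∀ l, ContDiff ℝ ∞ (φ l))
    (T : Fin m → Set ℝ) (hT : ∀ l, (T l).OrdConnected ∧ (interior (T l)).Nonempty)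
    (hdeg : NondegenerateOn φ (Set.univ.pi T))
    -- the fractal set and the measure on it
    (E : Set (Eucl d)) (hE : IsCompact E) (α : ℝ≥0) (hdim : dimH E = α)
    (μ : Measure (Eucl d)) [IsProbabilityMeasure μ] (hμ : IsFrostman μ E α)
    -- the cutoff
    (ψ : Eucl d × Eucl d → ℝ) (hψ : ContDiff ℝ ∞ ψ) (hψc : HasCompactSupport ψ)
    (hψE : ∀ x ∈ E, ∀ y ∈ E, ψ (x, y) = 1)
    -- smoothing of order `s`, uniformly in `t`
    (s : ℝ) (hT_s : ∃ B : ℝ≥0, ∀ t ∈ Set.univ.pi T, BoundedToSobolev (radonTransform φ ψ t) s B)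
    (hs : (d : ℝ) - s < α) (hα : (α : ℝ) < d) :
    ∀ K ⊆ Set.univ.pi T, IsCompact K → ∃ C : ℝ≥0, ∀ t ∈ K, ∀ ε : ℝ, 0 < ε →
      (μ.prod μ) {p | p.1 ∈ E ∧ p.2 ∈ E ∧ ∀ l, t l ≤ φ l p ∧ φ l p ≤ t l + ε} ≤
        C * ENNReal.ofReal (ε ^ m) := by
  intro K hKT hK
  obtain ⟨B, hB⟩ := hT_s
  obtain ⟨A, hA, h⟩ := exists_measureReal_le φ hφ hdeg hK hKT hE hμ hψ hψc hψE hB hs hα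
  refine ⟨A.toNNReal, fun t ht ε hε => ?_⟩
  have hsub : {p : Eucl d × Eucl d | p.1 ∈ E ∧ p.2 ∈ E ∧ ∀ l, t l ≤ φ l p ∧ φ l p ≤ t l + ε} ⊆
      {z | ‖jointMap φ z - t‖ ≤ ε} := by
    rintro p ⟨-, -, hp⟩
    refine (pi_norm_le_iff_of_nonneg hε.le).2 fun l => ?_
    rw [Pi.sub_apply, Real.norm_eq_abs, abs_le]
    constructor
    · have : t l ≤ jointMap φ p l := (hp l).1
      linarith
    · have : jointMap φ p l ≤ t l + ε := (hp l).2
      linarith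
  refine (measure_mono hsub).trans ?_
  rw [← ofReal_measureReal, ← ENNReal.ofReal, ← ENNReal.ofReal_mul hA]
  exact ENNReal.ofReal_le_ofReal (h t ht ε hε)
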